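/- **Conventions.** An operad $\mathcal O$ (coloured, planar or symmetric) has a set of colours and sets of operations $\mathcal O(a_1,\dots,a_n;b)$ with associative, unital and (in the symmetric case) equivariant composition. $\mathcal S(\mathcal O)$ is the category whose objects are the finite words in the colours, with $\otimes$ the concatenation of words; an arrow $w\to v$ is a tensor product of operations, one for each letter of $v$, in the symmetric case precomposed with a coloured permutation and taken modulo the action of the symmetric groups on the operations. Thus every coordinate of $w$ is connected to exactly one operation of the arrow. $\mathcal O$ *satisfies the calculus of fractions* if in $\mathcal S(\mathcal O)$ any two arrows with the same codomain can be completed to a commutative square, and whenever $x,y\colon A\to B$ and $s\colon B\to C$ satisfy $s\circ x=s\circ y$ there is an arrow $t$ into $A$ with $x\circ t=y\circ t$. For an object $X$, $\pi_1(\mathcal O,X)$ is the automorphism group of $X$ in the groupoid obtained from $\mathcal S(\mathcal O)$ by inverting all arrows. An object $X$ is *split* if there are objects $A_1,A_2,A_3$ and an arrow $A_1\otimes X\otimes A_2\otimes X\otimes A_3\to X$. For objects $X,Y$, $X$ is *$Y$-progressive* if for every arrow $Z\to X$ there are objects $A_1,A_2$ and an arrow $A_1\otimes Y\otimes A_2\to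 Z$ in which all coordinates of $Y$ are connected to one and the same operation; $X$ is *progressive* if it is $X$-progressive. A *coefficient system* $\mathcal M$ assigns a $\mathbb Z G$-module $\mathcal M G$ to every group $G$. Let $\mathfrak P$ be a property of groups. $\mathcal M$ is *$\mathfrak P$-Künneth* if for all groups $G_1,G_2$ with $\mathfrak P$ and all integers $n_1,n_2\ge -1$: if $H_k(G_i,\mathcal M G_i)=0$ for all $k\le n_i$ ($i=1,2$), then $H_k(G_1\times G_2,\mathcal M(G_1\times G_2))=0$ for all $k\le n_1+n_2+1$. $\mathcal M$ is *$\mathfrak P$-inductive* if for every group $G$, every subgroup $H$ of $G$ with $\mathfrak P$ and every $k\ge 0$, $H_k(H,\mathcal M H)=0$ implies $H_k(H,\mathcal M G)=0$; here a subgroup is understood up to isomorphism, that is, as a group $H$ with an injective homomorphism $H\to G$, through which $H$ acts on $\mathcal M G$. *Künneth* and *inductive* mean the same without the restriction to $\mathfrak P$. The cohomological notions are obtained by replacing $H_k$ by $H^k$. **Theorem.** Let $\mathcal O$ be a planar or symmetric operad which satisfies the calculus of fractions, and let $\mathcal M$ be a coefficient system. 1. Let $\mathcal M$ be Künneth and inductive.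 Let $X$ be a split progressive object of $\mathcal S(\mathcal O)$ and $\Gamma=\pi_1(\mathcal O,X)$. If $H_0(\Gamma,\mathcal M\Gamma)=0$, then $H_k(\Gamma,\mathcal M\Gamma)=0$ for all $k\ge 0$. 2. More generally, let $\mathfrak P$ be a property of groups which is closed under taking products of two groups, and let $\mathcal M$ be $\mathfrak P$-Künneth and $\mathfrak P$-inductive. Let $X$ be a split progressive object such that $\Gamma=\pi_1(\mathcal O,X)$ satisfies $\mathfrak P$. If $H_0(\Gamma,\mathcal M\Gamma)=0$, then $H_k(\Gamma,\mathcal M\Gamma)=0$ for all $k\ge 0$. 3. Let $\mathfrak P$ and $\mathcal M$ be as in 2. Let $X$ be an object and $\Gamma=\pi_1(\mathcal O,X)$. Suppose there is a split object $Y$ such that $X$ is $Y$-progressive, $\Upsilon=\pi_1(\mathcal O,Y)$ satisfies $\mathfrak P$ and $H_0(\Upsilon,\mathcal M\Upsilon)=0$. Then $H_k(\Gamma,\mathcal M\Gamma)=0$ for all $k\ge 0$. The same three statements hold for cohomology, with the cohomological notions of ($\mathfrak P$-)Künneth and ($\mathfrak P$-)inductive and with $H^k$ in place of $H_k$ throughout.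 -/

import Mathlib

open CategoryTheory

universe u

/-! ### Operads

Operads are written in coordinate-free form: the inputs of an operation are indexed by an arbitrary
finite linearly ordered set, and operations are composed along maps of index sets.  Restricting to
the index sets `{1 < ⋯ < n}` gives the usual sets `O(a₁, …, aₙ; b)`.  In a planar operad only
monotone maps are used; in a symmetric operad all maps are used, so that in particular all
bijections of index sets (the symmetric groups) act on operations. Operations without inputs are not
excluded. -/

/-- The two sorts of operads that are considered. -/
inductive OperadKind
  | planar
  | symmetric

namespace OperadKind

variable (K : OperadKind)

/-- The maps of index sets along which operations may be composed or relabelled: the monotone maps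
in the planar case, all maps in the symmetric case. -/
def Adm {I J : Type} [LinearOrder I] [LinearOrder J] (f : I → J) : Prop :=
  K = planar → Monotone f

end OperadKind

section Fibres

variable {I J L : Type}

/-- The fibre of `f` over `j`. -/
abbrev Fib (f : I → J) (j : J) : Type := {i : I // f i = j}

/-- The map induced by `f` from the fibre of `g ∘ f` over `l` to the fibre of `g` over `l`. -/
def fibMap (f : I → J) (g : J → L) (l : L) : Fib (fun i => g (f i)) l → Fib g l :=
  fun i => ⟨f i.1, i.2⟩

/-- A fibre of the map induced by `f` on fibres is a fibre of `f`. -/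
def fibFib (f : I → J) (g : J → L) (l : L) (j : Fib g l) : Fib f j.1 ≃ Fib (fibMap f g l) j where
  toFun i := ⟨⟨i.1, (congrArg g i.2).trans j.2⟩, Subtype.ext i.2⟩
  invFun i := ⟨i.1.1, congrArg Subtype.val i.2⟩
  left_inv _ := rfl
  right_inv _ := rfl

/-- The fibre of the identity over `j` is the singleton `{j}`. -/
def fibId (j : I) : Unit ≃ Fib (fun i : I => i) j where
  toFun _ := ⟨j, rfl⟩
  invFun _ := ()
  left_inv _ := rfl
  right_inv i := Subtype.ext i.2.symm

/-- The fibre of the map to a singleton is everything. -/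
def fibUnit (x : Unit) : I ≃ Fib (fun _ : I => ()) x where
  toFun i := ⟨i, rfl⟩
  invFun i := i.1
  left_inv _ := rfl
  right_inv _ := rfl

/-- Relabelling the domain by `e` relabels the fibres. -/
def fibDom (e : I ≃ J) (f : J → L) (l : L) : Fib (fun i => f (e i)) l ≃ Fib f l where
  toFun i := ⟨e i.1, i.2⟩
  invFun j := ⟨e.symm j.1, (congrArg f (e.apply_symm_apply j.1)).trans j.2⟩
  left_inv i := Subtype.ext (e.symm_apply_apply i.1)
  right_inv j := Subtype.ext (e.apply_symm_apply j.1)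

/-- Relabelling the codomain by `e` does not change the fibres. -/
def fibCod (f : I → J) (e : J ≃ L) (j : J) : Fib (fun i => e (f i)) (e j) ≃ Fib f j where
  toFun i := ⟨i.1, e.injective i.2⟩
  invFun i := ⟨i.1, congrArg e i.2⟩
  left_inv _ := rfl
  right_inv _ := rfl

end Fibres

namespace OperadKind.Adm

variable {K : OperadKind} {I J : Type} [LinearOrder I] [LinearOrder J]

theorem id : K.Adm (fun i : I => i) := fun _ => monotone_id

theorem const (x : J) : K.Adm (fun _ : I => x) := fun _ => monotone_const

theorem comp {L : Type} [LinearOrder L] {f : I → J} {g : J → L} (hg : K.Adm g) (hf : K.Adm f) :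
    K.Adm (fun i => g (f i)) := fun h => (hg h).comp (hf h)

theorem fibMap {L : Type} {f : I → J} (hf : K.Adm f) (g : J → L) (l : L) :
    K.Adm (_root_.fibMap f g l) := fun h _ _ hi => hf h hi

theorem fibId (j : I) : K.Adm (_root_.fibId j) := fun _ _ _ _ => le_rfl

theorem fibUnit (x : Unit) : K.Adm (_root_.fibUnit (I := I) x) := fun _ _ _ hi => hi

theorem fibDom {L : Type} {e : I ≃ J} (he : K.Adm e) (f : J → L) (l : L) :
    K.Adm (_root_.fibDom e f l) := fun h _ _ hi => he h hi

theorem fibFib {J L : Type} (f : I → J) (g : J → L) (l : L) (j : Fib g l) :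
    K.Adm (_root_.fibFib f g l j) := fun _ _ _ hi => hi

theorem fibCod {J L : Type} (f : I → J) (e : J ≃ L) (j : J) : K.Adm (_root_.fibCod f e j) :=
  fun _ _ _ hi => hi

end OperadKind.Adm

/-- A coloured operad, planar or symmetric according to `K`.

* `Op I a c`: the operations with inputs indexed by `I`, input colours `a` and output colour `c`;
* `one c`: the identity operation of the colour `c`;
* `comp f θ φ`: the operation obtained by plugging, for every input `j` of `φ`, the output of `θ j`
  into `j`; the inputs of `θ j` are indexed by the fibre of `f` over `j`;
* `relabel e θ`: the operation `θ` with its inputs renamed along the bijection `e` (the action of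
  the symmetric groups; in the planar case `e` is an isomorphism of ordered sets).

The axioms say that relabelling is functorial, that composition is compatible with relabelling
(equivariance), unital and associative. -/
structure Operad (K : OperadKind) where
  Color : Type u
  Op : (I : Type) → [LinearOrder I] → [Finite I] → (I → Color) → Color → Type u
  one : (c : Color) → Op Unit (fun _ => c) c
  comp : {I J : Type} → [LinearOrder I] → [Finite I] → [LinearOrder J] → [Finite J] →
    {a : I → Color} → {b : J → Color} → {c : Color} → (f : I → J) → K.Adm f →
    ((j : J) → Op (Fib f j) (fun i => a i.1) (b j)) → Op J b c → Op I a c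
  relabel : {I J : Type} → [LinearOrder I] → [Finite I] → [LinearOrder J] → [Finite J] →
    {a : J → Color} → {c : Color} → (e : I ≃ J) → K.Adm e →
    Op I (fun i => a (e i)) c → Op J a c
  relabel_refl : ∀ {I : Type} [LinearOrder I] [Finite I] {a : I → Color} {c : Color}
    (θ : Op I a c), relabel (Equiv.refl I) OperadKind.Adm.id θ = θ
  relabel_trans : ∀ {I J L : Type} [LinearOrder I] [Finite I] [LinearOrder J] [Finite J]
    [LinearOrder L] [Finite L] {a : L → Color} {c : Color} (e : I ≃ J) (he : K.Adm e)
    (e' : J ≃ L) (he' : K.Adm e') (θ : Op I (fun i => a (e' (e i))) c),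
    relabel e' he' (relabel (a := fun j => a (e' j)) e he θ) =
      relabel (e.trans e') (he'.comp he) θ
  comp_relabel_dom : ∀ {I I' J : Type} [LinearOrder I] [Finite I] [LinearOrder I'] [Finite I']
    [LinearOrder J] [Finite J] {a : I' → Color} {b : J → Color} {c : Color}
    (e : I ≃ I') (he : K.Adm e) (f : I' → J) (hf : K.Adm f)
    (θ : (j : J) → Op (Fib (fun i => f (e i)) j) (fun i => a (e i.1)) (b j)) (φ : Op J b c),
    comp f hf (fun j => relabel (a := fun i => a i.1) (fibDom e f j) (he.fibDom f j) (θ j)) φ =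
      relabel e he (comp (fun i => f (e i)) (hf.comp he) θ φ)
  comp_relabel_cod : ∀ {I J J' : Type} [LinearOrder I] [Finite I] [LinearOrder J] [Finite J]
    [LinearOrder J'] [Finite J'] {a : I → Color} {b : J' → Color} {c : Color}
    (f : I → J) (hf : K.Adm f) (e : J ≃ J') (he : K.Adm e)
    (θ : (j : J') → Op (Fib (fun i => e (f i)) j) (fun i => a i.1) (b j))
    (φ : Op J (fun j => b (e j)) c),
    comp (fun i => e (f i)) (he.comp hf) θ (relabel e he φ) =
      comp f hf (fun j =>
        relabel (a := fun i => a i.1) (fibCod f e j) (.fibCod f e j) (θ (e j))) φ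
  one_comp : ∀ {I : Type} [LinearOrder I] [Finite I] {a : I → Color} {c : Color} (φ : Op I a c),
    comp (fun i => i) .id
      (fun i => relabel (a := fun i' => a i'.1) (fibId i) (.fibId i) (one (a i))) φ = φ
  comp_one : ∀ {I : Type} [LinearOrder I] [Finite I] {a : I → Color} {c : Color} (φ : Op I a c),
    comp (fun _ => ()) (.const ())
      (fun x => relabel (a := fun i' => a i'.1) (fibUnit x) (.fibUnit x) φ) (one c) = φ
  assoc : ∀ {I J L : Type} [LinearOrder I] [Finite I] [LinearOrder J] [Finite J]
    [LinearOrder L] [Finite L] {a : I → Color} {b : J → Color} {c : L → Color} {d : Color}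
    (f : I → J) (hf : K.Adm f) (g : J → L) (hg : K.Adm g)
    (θ : (j : J) → Op (Fib f j) (fun i => a i.1) (b j))
    (φ : (l : L) → Op (Fib g l) (fun j => b j.1) (c l)) (ψ : Op L c d),
    comp f hf θ (comp g hg φ ψ) =
      comp (fun i => g (f i)) (hg.comp hf)
        (fun l => comp (fibMap f g l) (hf.fibMap g l)
          (fun j => relabel (a := fun i => a i.1.1) (fibFib f g l j) (.fibFib f g l j) (θ j.1))
          (φ l)) ψ

namespace Operad

variable {K : OperadKind} (O : Operad.{u} K)

/-! ### The monoidal category `S(O)` -/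

/-- The objects of `S(O)`: the finite words in the colours. The tensor product of objects is the
concatenation of words. -/
def S : Type u := List O.Color

variable {O}

/-- The tensor product of objects of `S(O)`. -/
instance : Append O.S := ⟨List.append⟩

/-- The number of coordinates of an object. -/
def S.len (w : O.S) : ℕ := List.length w

/-- The colour of a coordinate. -/
def S.color (w : O.S) (i : Fin w.len) : O.Color := List.get w i

/-- An arrow `w → v` of `S(O)`: a tensor product of operations, one for every coordinate of `v`,
precomposed with a colored permutation in the symmetric case.  `idx` says to which operation a
coordinate of `w` is connected, and the operation with output `j` has the coordinates connected to
it as inputs. This is the normal form of the classes of pairs of a colored permutation and a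
sequence of operations, modulo the action of the symmetric groups on operations; in the planar case
`idx` is monotone, so that `w` is the concatenation of the inputs of the operations. -/
@[ext]
structure S.Hom (w v : O.S) : Type u where
  idx : Fin w.len → Fin v.len
  adm : K.Adm idx
  op : (j : Fin v.len) → O.Op (Fib idx j) (fun i => w.color i.1) (v.color j)

/-- The identity arrow: a tensor product of identity operations. -/
def S.Hom.id (w : O.S) : S.Hom w w where
  idx i := i
  adm := .id
  op j := O.relabel (a := fun i => w.color i.1) (fibId j) (.fibId j) (O.one (w.color j))

/-- The composition of arrows of `S(O)`, in diagrammatic order. -/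
def S.Hom.comp {w v z : O.S} (x : S.Hom w v) (y : S.Hom v z) : S.Hom w z where
  idx i := y.idx (x.idx i)
  adm := y.adm.comp x.adm
  op l := O.comp (fibMap x.idx y.idx l) (x.adm.fibMap y.idx l)
    (fun j => O.relabel (a := fun i => w.color i.1.1) (fibFib x.idx y.idx l j)
      (.fibFib x.idx y.idx l j) (x.op j.1))
    (y.op l)

theorem S.Hom.ext' {w v : O.S} {x y : S.Hom w v} (h : x.idx = y.idx)
    (h' : ∀ j, O.relabel (a := fun i => w.color i.1)
      (Equiv.subtypeEquivRight fun i => by rw [h] : Fib x.idx j ≃ Fib y.idx j)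
      (fun _ _ _ hi => hi) (x.op j) = y.op j) : x = y := by
  obtain ⟨f, hf, θ⟩ := x
  obtain ⟨g, hg, φ⟩ := y
  obtain rfl : f = g := h
  congr 1
  funext j
  exact (O.relabel_refl (θ j)).symm.trans (h' j)

theorem comp_congr {I J : Type} [LinearOrder I] [Finite I] [LinearOrder J] [Finite J]
    {a : I → O.Color} {b : J → O.Color} {f f' : I → J} (h : f = f')
    (hf : K.Adm f) (hf' : K.Adm f') {d : O.Color}
    (θ : (j : J) → O.Op (Fib f j) (fun i => a i.1) (b j)) (φ : O.Op J b d) :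
    O.comp f hf θ φ = O.comp f' hf'
      (fun j => O.relabel (a := fun i => a i.1)
        (Equiv.subtypeEquivRight fun i => by rw [h] : Fib f j ≃ Fib f' j)
        (fun _ _ _ hi => hi) (θ j)) φ := by
  subst h
  exact congrArg (fun s => O.comp f hf s φ) (funext fun j => (O.relabel_refl (θ j)).symm)

theorem assoc_aux {I J L M : Type} [LinearOrder I] [Finite I] [LinearOrder J] [Finite J]
    [LinearOrder L] {a : I → O.Color} {b : J → O.Color} {c : L → O.Color}
    (f : I → J) (hf : K.Adm f) (g : J → L) (h : L → M) (m : M) (l : Fib h m)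
    (θ : (j : J) → O.Op (Fib f j) (fun i => a i.1) (b j))
    (φ : (l : L) → O.Op (Fib g l) (fun j => b j.1) (c l)) :
    O.relabel (a := fun i => a i.1.1) (fibFib (fun i => g (f i)) h m l)
      (.fibFib (fun i => g (f i)) h m l)
      (O.comp (fibMap f g l.1) (hf.fibMap g l.1)
        (fun j => O.relabel (a := fun i => a i.1.1) (fibFib f g l.1 j) (.fibFib f g l.1 j) (θ j.1))
        (φ l.1)) =
    O.comp (fibMap (fibMap f (fun j => h (g j)) m) (fibMap g h m) l)
      ((hf.fibMap (fun j => h (g j)) m).fibMap (fibMap g h m) l)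
      (fun j => O.relabel (a := fun i => a i.1.1.1)
        (fibFib (fibMap f (fun j => h (g j)) m) (fibMap g h m) l j)
        (.fibFib (fibMap f (fun j => h (g j)) m) (fibMap g h m) l j)
        (O.relabel (a := fun i => a i.1.1) (fibFib f (fun j => h (g j)) m j.1)
          (.fibFib f (fun j => h (g j)) m j.1) (θ j.1.1)))
      (O.relabel (a := fun j => b j.1.1) (fibFib g h m l) (.fibFib g h m l) (φ l.1)) := by
  let e := fibFib g h m l
  let e' := fibFib (fun i => g (f i)) h m l
  let f₀ : Fib (fibMap (fun i => g (f i)) h m) l → Fib g l.1 :=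
    fun i => ⟨f i.1.1, congrArg Subtype.val i.2⟩
  have hf₀ : K.Adm f₀ := fun hK _ _ hi => hf hK hi
  have h1 := O.comp_relabel_cod
    (a := fun i : Fib (fibMap (fun i => g (f i)) h m) l => a i.1.1)
    (b := fun j : Fib (fibMap g h m) l => b j.1.1) f₀ hf₀ e (.fibFib g h m l)
    (fun j => O.relabel
        (a := fun i : Fib (fibMap (fibMap f (fun j => h (g j)) m) (fibMap g h m) l) j => a i.1.1.1)
        (fibFib (fibMap f (fun j => h (g j)) m) (fibMap g h m) l j)
        (.fibFib (fibMap f (fun j => h (g j)) m) (fibMap g h m) l j)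
        (O.relabel (a := fun i : Fib (fibMap f (fun j => h (g j)) m) j.1 => a i.1.1)
          (fibFib f (fun j => h (g j)) m j.1)
          (.fibFib f (fun j => h (g j)) m j.1) (θ j.1.1))) (φ l.1)
  refine Eq.trans ?_ h1.symm
  have h2 := O.comp_relabel_dom (a := fun i : Fib (fibMap (fun i => g (f i)) h m) l => a i.1.1)
    (b := fun j : Fib g l.1 => b j.1) e'
    (.fibFib (fun i => g (f i)) h m l) f₀ hf₀
    (fun j => O.relabel (a := fun i : Fib (fibMap f g l.1) j => a i.1.1)
      (fibFib f g l.1 j) (.fibFib f g l.1 j) (θ j.1))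
    (φ l.1)
  refine Eq.trans h2.symm ?_
  congr 1
  funext j
  refine (O.relabel_trans _ _ _ _ _).trans ?_
  refine Eq.trans ?_ (O.relabel_trans _ _ _ _ _).symm
  refine Eq.trans ?_ (O.relabel_trans _ _ _ _ _).symm
  rfl

/-- The category `S(O)`. -/
instance : Category O.S where
  Hom := S.Hom
  id := S.Hom.id
  comp := S.Hom.comp
  id_comp {w v} x := by
    refine S.Hom.ext' rfl fun j => ?_
    refine (O.relabel_refl _).trans ?_
    refine Eq.trans ?_ (O.one_comp (a := fun i : Fib x.idx j => w.color i.1) (x.op j))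
    exact congrArg (fun s => O.comp (I := Fib x.idx j) (J := Fib x.idx j) (fun i => i) .id s
      (x.op j)) (funext fun i => O.relabel_trans _ _ _ _ _)
  comp_id {w v} x := by
    refine S.Hom.ext' rfl fun j => ?_
    refine (O.relabel_refl _).trans ?_
    refine (comp_congr (f' := fun _ : Fib x.idx j => fibId j ()) (funext fun i => Subtype.ext i.2)
      _ (.const _) _ _).trans ?_
    refine (O.comp_relabel_cod (a := fun i : Fib x.idx j => w.color i.1)
      (b := fun i : Fib (fun i => i) j => v.color i.1)
      (fun _ => ()) (.const ()) (fibId j) (.fibId j) _ _).trans ?_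
    refine Eq.trans ?_ (O.comp_one (a := fun i : Fib x.idx j => w.color i.1) (x.op j))
    refine congrArg (fun s => O.comp (I := Fib x.idx j) (fun _ => ()) (.const ()) s
      (O.one (v.color j))) (funext fun i => ?_)
    refine (O.relabel_trans _ _ _ _ _).trans ?_
    refine (O.relabel_trans _ _ _ _ _).trans ?_
    rfl
  assoc {w v z r} x y t := by
    refine S.Hom.ext' rfl fun j => ?_
    refine (O.relabel_refl _).trans ?_
    refine Eq.trans ?_ (O.assoc
      (a := fun i : Fib (fun i => t.idx (y.idx (x.idx i))) j => w.color i.1)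
      (b := fun i : Fib (fun i => t.idx (y.idx i)) j => v.color i.1)
      (c := fun i : Fib t.idx j => z.color i.1) (fibMap x.idx (fun i => t.idx (y.idx i)) j)
      (x.adm.fibMap _ j) (fibMap y.idx t.idx j) (y.adm.fibMap _ j)
      (fun l => O.relabel (a := fun i => w.color i.1.1)
        (fibFib x.idx (fun i => t.idx (y.idx i)) j l)
        (.fibFib x.idx (fun i => t.idx (y.idx i)) j l) (x.op l.1))
      (fun l => O.relabel (a := fun i => v.color i.1.1) (fibFib y.idx t.idx j l)
        (.fibFib y.idx t.idx j l) (y.op l.1)) (t.op j)).symm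
    exact congrArg (fun s => O.comp (fibMap (fun i => y.idx (x.idx i)) t.idx j) _ s (t.op j))
      (funext fun l => assoc_aux (a := w.color) (b := v.color) x.idx x.adm y.idx t.idx j l
        x.op y.op)

/-! ### Notions for objects of `S(O)` -/

variable (O) in
/-- `O` satisfies the calculus of fractions: in `S(O)`, every pair of arrows with the same codomain
can be completed to a commutative square, and for parallel arrows `x, y` and an arrow `s` with
`x ≫ s = y ≫ s` there is an arrow `t` with `t ≫ x = t ≫ y`. -/
def CalculusOfFractions : Prop :=
  (⊤ : MorphismProperty O.S).HasRightCalculusOfFractions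

/-- The operad group `π₁(O, X)`: the automorphisms of `X` in the fundamental groupoid of `S(O)`, the
groupoid obtained from `S(O)` by inverting all arrows. The product of `f` and `g` is `f ≫ g`. -/
abbrev piOne (X : O.S) : Type u := FreeGroupoid.mk X ⟶ FreeGroupoid.mk X

/-- `X` is split: there is an arrow `A₁ ⊗ X ⊗ A₂ ⊗ X ⊗ A₃ → X`. -/
def IsSplit (X : O.S) : Prop :=
  ∃ A₁ A₂ A₃ : O.S, Nonempty ((A₁ ++ X ++ A₂ ++ X ++ A₃) ⟶ X)

/-- The link condition for an arrow `A₁ ⊗ Y ⊗ A₂ → Z`: the coordinates of `Y` are all connected to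
one and the same operation. -/
def LinkCondition {A₁ Y A₂ Z : O.S} (x : (A₁ ++ Y ++ A₂) ⟶ Z) : Prop :=
  ∀ p q : Fin (A₁ ++ Y ++ A₂).len, A₁.len ≤ p → (p : ℕ) < A₁.len + Y.len →
    A₁.len ≤ q → (q : ℕ) < A₁.len + Y.len → S.Hom.idx x p = S.Hom.idx x q

/-- `X` is `Y`-progressive: for every arrow `Z → X` there is an arrow `A₁ ⊗ Y ⊗ A₂ → Z` that
satisfies the link condition. -/
def IsProgressiveOver (X Y : O.S) : Prop :=
  ∀ (Z : O.S), (Z ⟶ X) → ∃ (A₁ A₂ : O.S) (x : (A₁ ++ Y ++ A₂) ⟶ Z), LinkCondition x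

/-- `X` is progressive. -/
def IsProgressive (X : O.S) : Prop := IsProgressiveOver X X

end Operad

/-! ### Coefficient systems -/

/-- A property of groups. -/
abbrev GroupProperty : Type (u + 1) := (G : Type u) → [Group G] → Prop

/-- The property is closed under taking products. -/
def GroupProperty.ClosedUnderProducts (P : GroupProperty.{u}) : Prop :=
  ∀ (G₁ G₂ : Type u) [Group G₁] [Group G₂], P G₁ → P G₂ → P (G₁ × G₂)

/-- A `ℤG`-module for every group `G`.  (`ULift ℤ` is the ring `ℤ`, placed in the universe of the
groups, as Mathlib's group homology requires.) -/
abbrev CoefficientSystem : Type (u + 1) :=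
  (G : Type u) → [Group G] → Rep.{u} (ULift.{u} ℤ) G

namespace CoefficientSystem

/-- `H_k(G, A) = 0`. -/
def HomologyVanishes {G : Type u} [Group G] (A : Rep.{u} (ULift.{u} ℤ) G) (k : ℕ) : Prop :=
  Limits.IsZero (groupHomology A k)

/-- `H^k(G, A) = 0`. -/
def CohomologyVanishes {G : Type u} [Group G] (A : Rep.{u} (ULift.{u} ℤ) G) (k : ℕ) : Prop :=
  Limits.IsZero (groupCohomology A k)

variable (M : CoefficientSystem.{u}) (P : GroupProperty.{u})

/-- `M` is `P`-Künneth (in homology). -/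
def KunnethFor : Prop :=
  ∀ (G₁ G₂ : Type u) [Group G₁] [Group G₂], P G₁ → P G₂ →
    ∀ n₁ n₂ : ℤ, -1 ≤ n₁ → -1 ≤ n₂ →
      (∀ k : ℕ, (k : ℤ) ≤ n₁ → HomologyVanishes (M G₁) k) →
      (∀ k : ℕ, (k : ℤ) ≤ n₂ → HomologyVanishes (M G₂) k) →
      ∀ k : ℕ, (k : ℤ) ≤ n₁ + n₂ + 1 → HomologyVanishes (M (G₁ × G₂)) k

/-- `M` is `P`-inductive (in homology). A subgroup `H` of `G` is given by an injective homomorphism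
`i : H → G`; the `G`-module `M G` is an `H`-module through `i`. -/
def InductiveFor : Prop :=
  ∀ (H G : Type u) [Group H] [Group G] (i : H →* G), Function.Injective i → P H →
    ∀ k : ℕ, HomologyVanishes (M H) k → HomologyVanishes (Rep.res i (M G)) k

/-- `M` is Künneth (in homology). -/
def Kunneth : Prop := M.KunnethFor fun _ _ => True

/-- `M` is inductive (in homology). -/
def Inductive : Prop := M.InductiveFor fun _ _ => True

/-- `M` is `P`-Künneth in cohomology. -/
def CoKunnethFor : Prop :=
  ∀ (G₁ G₂ : Type u) [Group G₁] [Group G₂], P G₁ → P G₂ →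
    ∀ n₁ n₂ : ℤ, -1 ≤ n₁ → -1 ≤ n₂ →
      (∀ k : ℕ, (k : ℤ) ≤ n₁ → CohomologyVanishes (M G₁) k) →
      (∀ k : ℕ, (k : ℤ) ≤ n₂ → CohomologyVanishes (M G₂) k) →
      ∀ k : ℕ, (k : ℤ) ≤ n₁ + n₂ + 1 → CohomologyVanishes (M (G₁ × G₂)) k

/-- `M` is `P`-inductive in cohomology. -/
def CoInductiveFor : Prop :=
  ∀ (H G : Type u) [Group H] [Group G] (i : H →* G), Function.Injective i → P H →
    ∀ k : ℕ, CohomologyVanishes (M H) k → CohomologyVanishes (Rep.res i (M G)) k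

/-- `M` is Künneth in cohomology. -/
def CoKunneth : Prop := M.CoKunnethFor fun _ _ => True

/-- `M` is inductive in cohomology. -/
def CoInductive : Prop := M.CoInductiveFor fun _ _ => True

end CoefficientSystem

/-! Write Γ = π₁(X) and Υ = π₁(Y). For every m the group Γ has a conjugation invariant family of
subgroups isomorphic to Υ^(m+1) such that any finitely many members are normalized by some member
(`hasNormalizingFamily`). Künneth turns the vanishing of H_0(Υ, MΥ) into vanishing for Υ^(m+1) in
degrees ≤ m (`groupPower_vanishing`), inductivity carries this to the members of the family with
coefficients in MΓ, and `DetectedOnSimplices.of_family` passes it on to Γ. Degree q is settled by m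
= q.

From the family to Γ: Γ acts by conjugation on the lists N_0, …, N_p of members in which every entry
normalizes all later ones. Since finite sets have lower bounds, coning off shows that the augmented
complex of these lists is acyclic. The stabilizer of a list is the intersection of the normalizers
of its entries; it contains N_0 as a normal subgroup, so vanishing passes from N_0 to the
stabilizer, by the same method applied to the cosets of N_0. Shapiro's lemma gives vanishing for the
module E of chains with coefficients in A = MΓ. The passage from E to A needs no spectral sequence:
summed over all degrees, with K the cycles in E, acyclicity is a short exact sequence 0 → K → E → A
⊕ K → 0. As K is a retract of A ⊕ K, it shifts dimensions repeatedly. Cohomology is dual.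

Construction of the family: by the calculus of fractions an element of π₁(W) is a roof of two arrows
Z → W, and it is supported on a set J of coordinates if some roof has legs that agree off J.
Suitable disjoint supports give commuting elements and trivial intersection, and the elements of
π₁(A ⊗ Y ⊗ B) supported on the block Y form a copy of Υ. Splitting Y repeatedly gives a copy of
Υ^(m+1) over the block, in π₁(W') for some W' → A ⊗ Y ⊗ B (`exists_power_embedding`). It is
normalized by the elements supported on any single coordinate, because a coordinate lies either
inside or outside the support of each factor. For finitely many such subgroups, a common refinement
Z → X makes single coordinates of Z normalize them all (`exists_normalized`). Progressivity sends a
whole block Y to one coordinate of Z, so the copy of Υ^(m+1) over this block normalizes them. -/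

/-! ### Dimension shifting -/

section DimensionShift

open Limits

variable {k G : Type u} [CommRing k] [Group G]

theorem groupHomology.isZero_of_retract {A B : Rep.{u} k G} (r : Retract A B) (n : ℕ)
    (hB : IsZero (groupHomology B n)) : IsZero (groupHomology A n) := by
  let r' := r.map (groupHomology.functor k G n)
  rw [IsZero.iff_id_eq_zero]
  exact r'.retract.symm.trans (by rw [hB.eq_zero_of_tgt r'.i]; exact zero_comp)

theorem groupCohomology.isZero_of_retract {A B : Rep.{u} k G} (r : Retract A B) (n : ℕ)
    (hB : IsZero (groupCohomology B n)) : IsZero (groupCohomology A n) := by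
  let r' := r.map (groupCohomology.functor k G n)
  rw [IsZero.iff_id_eq_zero]
  exact r'.retract.symm.trans (by rw [hB.eq_zero_of_tgt r'.i]; exact zero_comp)

/-- If the first term of a short exact sequence is a retract of the last one, vanishing of homology
in a range passes from the middle term to the last term. -/
theorem groupHomology.isZero_of_shortExact {X : ShortComplex (Rep.{u} k G)} (hX : X.ShortExact)
    (r : Retract X.X₁ X.X₃) (n : ℕ) (h : ∀ q < n, IsZero (groupHomology X.X₂ q)) (q : ℕ)
    (hq : q < n) : IsZero (groupHomology X.X₃ q) := by
  induction q with
  | zero =>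
    have := hX.epi_g
    have : Epi (groupHomology.map (MonoidHom.id G) X.g 0) := groupHomology.epi_map_0_of_epi X.g
    exact (h 0 hq).of_epi (groupHomology.map (MonoidHom.id G) X.g 0)
  | succ q ih =>
    -- The connecting map embeds H_{q+1}(X₃) into H_q(X₁), which is a retract of H_q(X₃) and hence
    -- zero by induction.
    have := groupHomology.mono_δ_of_isZero hX q (h (q + 1) hq)
    exact (groupHomology.isZero_of_retract r q (ih (by omega))).of_mono
      (groupHomology.δ hX (q + 1) q rfl)

/-- Dual to the homological case: H^q(X₃) surjects onto H^{q+1}(X₁), and H^q(X₃) is a retract of the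
group H^q(X₁) already known to vanish. -/
theorem groupCohomology.isZero_of_shortExact {X : ShortComplex (Rep.{u} k G)} (hX : X.ShortExact)
    (r : Retract X.X₃ X.X₁) (n : ℕ) (h : ∀ q < n, IsZero (groupCohomology X.X₂ q)) (q : ℕ)
    (hq : q < n) : IsZero (groupCohomology X.X₁ q) := by
  induction q with
  | zero =>
    have := hX.mono_f
    have : Mono (groupCohomology.map (MonoidHom.id G) X.f 0) :=
      groupCohomology.mono_map_0_of_mono X.f
    exact (h 0 hq).of_mono (groupCohomology.map (MonoidHom.id G) X.f 0)
  | succ q ih =>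
    have := groupCohomology.epi_δ_of_isZero hX q (h (q + 1) hq)
    exact (groupCohomology.isZero_of_retract r q (ih (by omega))).of_epi
      (groupCohomology.δ hX q (q + 1) rfl)

/-- Chain level form of vanishing, needed to treat infinitely many orbits by hand. Writing the
neighbouring degrees as `next` and `prev` includes n = 0, where `next` takes its default value and
the differential is zero. -/
theorem groupHomology.isZero_iff {A : Rep.{u} k G} {n : ℕ} :
    IsZero (groupHomology A n) ↔
      ∀ z : (inhomogeneousChains A).X n,
        (inhomogeneousChains A).d n ((ComplexShape.down ℕ).next n) z = 0 →
          ∃ y, (inhomogeneousChains A).d ((ComplexShape.down ℕ).prev n) n y = z := by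
  unfold groupHomology
  rw [← HomologicalComplex.exactAt_iff_isZero_homology,
    HomologicalComplex.exactAt_iff, ShortComplex.moduleCat_exact_iff]
  rfl

theorem groupCohomology.isZero_iff {A : Rep.{u} k G} {n : ℕ} :
    IsZero (groupCohomology A n) ↔
      ∀ z : (inhomogeneousCochains A).X n,
        (inhomogeneousCochains A).d n ((ComplexShape.up ℕ).next n) z = 0 →
          ∃ y, (inhomogeneousCochains A).d ((ComplexShape.up ℕ).prev n) n y = z := by
  unfold groupCohomology
  rw [← HomologicalComplex.exactAt_iff_isZero_homology,
    HomologicalComplex.exactAt_iff, ShortComplex.moduleCat_exact_iff]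
  rfl

/-- Homology classes supported on a vanishing representation are boundaries. -/
theorem groupHomology.exists_boundary_of_factor {A B : Rep.{u} k G} {n : ℕ}
    (hB : IsZero (groupHomology B n)) (π : A ⟶ B) (ι : B ⟶ A) (z : (inhomogeneousChains A).X n)
    (hz : (inhomogeneousChains A).d n ((ComplexShape.down ℕ).next n) z = 0) :
    ∃ y, (inhomogeneousChains A).d ((ComplexShape.down ℕ).prev n) n y =
      (chainsMap (MonoidHom.id G) (π ≫ ι)).f n z := by
  have comm : ∀ {A B : Rep.{u} k G} (φ : A ⟶ B) (i j : ℕ) (w : (inhomogeneousChains A).X i),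
      (inhomogeneousChains B).d i j ((chainsMap (MonoidHom.id G) φ).f i w) =
        (chainsMap (MonoidHom.id G) φ).f j ((inhomogeneousChains A).d i j w) := fun φ i j w =>
    congr($((chainsMap (MonoidHom.id G) φ).comm i j) w)
  obtain ⟨y, hy⟩ := isZero_iff.1 hB ((chainsMap (MonoidHom.id G) π).f n z)
    ((comm π _ _ z).trans (by rw [hz, map_zero]))
  refine ⟨(chainsMap (MonoidHom.id G) ι).f _ y, ?_⟩
  rw [comm ι, hy, chainsMap_id_comp]
  rfl

theorem groupCohomology.exists_coboundary_of_factor {A B : Rep.{u} k G} {n : ℕ}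
    (hB : IsZero (groupCohomology B n)) (π : A ⟶ B) (ι : B ⟶ A)
    (z : (inhomogeneousCochains A).X n)
    (hz : (inhomogeneousCochains A).d n ((ComplexShape.up ℕ).next n) z = 0) :
    ∃ y, (inhomogeneousCochains A).d ((ComplexShape.up ℕ).prev n) n y =
      (cochainsMap (MonoidHom.id G) (π ≫ ι)).f n z := by
  have comm : ∀ {A B : Rep.{u} k G} (φ : A ⟶ B) (i j : ℕ) (w : (inhomogeneousCochains A).X i),
      (inhomogeneousCochains B).d i j ((cochainsMap (MonoidHom.id G) φ).f i w) =
        (cochainsMap (MonoidHom.id G) φ).f j ((inhomogeneousCochains A).d i j w) := fun φ i j w =>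
    congr($((cochainsMap (MonoidHom.id G) φ).comm i j) w)
  obtain ⟨y, hy⟩ := isZero_iff.1 hB ((cochainsMap (MonoidHom.id G) π).f n z)
    ((comm π _ _ z).trans (by rw [hz, map_zero]))
  refine ⟨(cochainsMap (MonoidHom.id G) ι).f _ y, ?_⟩
  rw [comm ι, hy, cochainsMap_id_comp]
  rfl

end DimensionShift

/-! ### Permutation modules with coefficients -/

section Permutation

open Limits Representation

variable {k G : Type u} [CommRing k] [Group G]

section Actions

variable (X : Type u) [MulAction G X] {V : Type u} [AddCommGroup V] [Module k V]
  (ρ : Representation k G V)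

/-- The diagonal action on finitely supported functions with values in a representation. -/
noncomputable def Representation.finsuppDiag : Representation k G (X →₀ V) where
  toFun g := Finsupp.lmapDomain V k (g • ·) ∘ₗ Finsupp.mapRange.linearMap (ρ g)
  map_one' := by ext; simp
  map_mul' g h := by ext; simp [mul_smul]

@[simp]
theorem Representation.finsuppDiag_single (g : G) (x : X) (a : V) :
    ρ.finsuppDiag X g (Finsupp.single x a) = Finsupp.single (g • x) (ρ g a) := by
  simp [finsuppDiag]

/-- The diagonal action on functions with values in a representation. -/
def Representation.funDiag : Representation k G (X → V) where
  toFun g :=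
    { toFun f x := ρ g (f (g⁻¹ • x))
      map_add' _ _ := by ext; simp
      map_smul' _ _ := by ext; simp }
  map_one' := by ext; simp
  map_mul' g h := by ext; simp [mul_smul]

@[simp]
theorem Representation.funDiag_apply (g : G) (f : X → V) (x : X) :
    ρ.funDiag X g f x = ρ g (f (g⁻¹ • x)) := rfl

end Actions

/-- `X →₀ A` with the diagonal action. -/
noncomputable abbrev Rep.finsuppDiag (X : Type u) [MulAction G X] (A : Rep.{u} k G) :
    Rep.{u} k G :=
  Rep.of (A.ρ.finsuppDiag X)

/-- `X → A` with the diagonal action. -/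
abbrev Rep.funDiag (X : Type u) [MulAction G X] (A : Rep.{u} k G) : Rep.{u} k G :=
  Rep.of (A.ρ.funDiag X)

variable {X : Type u} [MulAction G X] (A : Rep.{u} k G)

section Orbit

variable (x₀ : X)

/-- This is the defining relation of the coinvariants. It makes the projection to the induced
representation independent of the group element chosen to move the base point to x. -/
theorem Representation.IndV.mk_stabilizer_mul
    (s : MulAction.stabilizer G x₀) (h : G) (a : A) :
    IndV.mk (MulAction.stabilizer G x₀).subtype
        (A.ρ.comp (MulAction.stabilizer G x₀).subtype) (s.1 * h) (A.ρ s.1 a) =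
      IndV.mk (MulAction.stabilizer G x₀).subtype
        (A.ρ.comp (MulAction.stabilizer G x₀).subtype) h a := by
  have := Coinvariants.mk_self_apply (Representation.tprod
    ((leftRegular k G).comp (MulAction.stabilizer G x₀).subtype)
    (A.ρ.comp (MulAction.stabilizer G x₀).subtype)) s
    (TensorProduct.tmul k (MonoidAlgebra.single h 1) a)
  simpa using this

open Classical in
/-- The projection of `X →₀ A` to the orbit of `x₀`, as a map to the induced representation. -/
noncomputable def Rep.finsuppDiagToInd :
    A.finsuppDiag X ⟶ Rep.ind (MulAction.stabilizer G x₀).subtype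
      (Rep.res (MulAction.stabilizer G x₀).subtype A) :=
  Rep.ofHom
    { toLinearMap := Finsupp.lsum k fun x =>
        if h : ∃ g : G, g • x₀ = x then
          IndV.mk (MulAction.stabilizer G x₀).subtype _ (h.choose)⁻¹ ∘ₗ A.ρ (h.choose)⁻¹
        else 0
      isIntertwining' := fun γ => by
        ext x a
        simp only [LinearMap.comp_apply, Finsupp.lsingle_apply, finsuppDiag_single,
          Finsupp.lsum_single]
        by_cases h : ∃ g : G, g • x₀ = x
        · have h' : ∃ g : G, g • x₀ = γ • x := ⟨γ * h.choose, by rw [mul_smul, h.choose_spec]⟩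
          rw [dif_pos h, dif_pos h']
          have hs : h'.choose⁻¹ * (γ * h.choose) ∈ MulAction.stabilizer G x₀ := by
            rw [MulAction.mem_stabilizer_iff, mul_smul, inv_smul_eq_iff, mul_smul, h.choose_spec,
              h'.choose_spec]
          have := IndV.mk_stabilizer_mul A x₀ ⟨_, hs⟩ (h.choose⁻¹ * γ⁻¹) (A.ρ h.choose⁻¹ a)
          rw [LinearMap.comp_apply, LinearMap.comp_apply]
          refine Eq.trans ?_ (this.trans (ind_mk _ _ _ _ _).symm)
          have e₁ : A.ρ h'.choose⁻¹ (A.ρ γ a) =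
              A.ρ (h'.choose⁻¹ * (γ * h.choose)) (A.ρ h.choose⁻¹ a) := by
            simp only [← Module.End.mul_apply, ← map_mul]
            congr 2
            group
          rw [e₁]
          exact congrArg (fun t => IndV.mk (MulAction.stabilizer G x₀).subtype _ t _) (by group)
        · have h' : ¬ ∃ g : G, g • x₀ = γ • x := fun ⟨g, hg⟩ =>
            h ⟨γ⁻¹ * g, by rw [mul_smul, hg, inv_smul_smul]⟩
          rw [dif_neg h, dif_neg h']
          simp }

/-- The inclusion of the induced representation as the part of `X →₀ A` supported on the orbit of
`x₀`. -/
noncomputable def Rep.indToFinsuppDiag :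
    Rep.ind (MulAction.stabilizer G x₀).subtype
      (Rep.res (MulAction.stabilizer G x₀).subtype A) ⟶ A.finsuppDiag X :=
  (Rep.indResHomEquiv (MulAction.stabilizer G x₀).subtype
    (Rep.res (MulAction.stabilizer G x₀).subtype A) (A.finsuppDiag X)).symm
    (Rep.ofHom
      { toLinearMap := Finsupp.lsingle x₀
        isIntertwining' := fun s => by
          ext a : 1
          have hs : s.1 • x₀ = x₀ := s.2
          exact ((finsuppDiag_single X A.ρ s.1 x₀ a).trans
            (congrArg (Finsupp.single · (A.ρ s.1 a)) hs)).symm })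

theorem Rep.indToFinsuppDiag_mk (h : G) (a : A) :
    (Rep.indToFinsuppDiag A x₀).hom (IndV.mk (MulAction.stabilizer G x₀).subtype
      (A.ρ.comp (MulAction.stabilizer G x₀).subtype) h a) =
      Finsupp.single (h⁻¹ • x₀) (A.ρ h⁻¹ a) := by
  simp [indToFinsuppDiag, indResHomEquiv]

open Classical in
theorem Rep.finsuppDiag_orbit_proj (z : X →₀ A) :
    (Rep.finsuppDiagToInd A x₀ ≫ Rep.indToFinsuppDiag A x₀).hom z =
      z.filter (· ∈ MulAction.orbit G x₀) := by
  induction z using Finsupp.induction_linear with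
  | zero => exact (map_zero _).trans (Finsupp.filter_zero _).symm
  | add f g hf hg => rw [map_add, hf, hg, Finsupp.filter_add]
  | single x a =>
    rw [hom_comp, IntertwiningMap.comp_apply]
    by_cases h : ∃ g : G, g • x₀ = x
    · have : (finsuppDiagToInd A x₀).hom (Finsupp.single x a) =
          IndV.mk (MulAction.stabilizer G x₀).subtype
            (A.ρ.comp (MulAction.stabilizer G x₀).subtype) (h.choose)⁻¹
            (A.ρ (h.choose)⁻¹ a) := by
        refine (Finsupp.lsum_single k _ x a).trans ?_
        rw [dif_pos h]; rfl
      rw [this, Rep.indToFinsuppDiag_mk, inv_inv, h.choose_spec, ← Module.End.mul_apply, ← map_mul,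
        mul_inv_cancel, map_one, Finsupp.filter_single_of_pos _ (by exact h)]
      rfl
    · have : (finsuppDiagToInd A x₀).hom (Finsupp.single x a) = 0 := by
        refine (Finsupp.lsum_single k _ x a).trans ?_
        rw [dif_neg h]; rfl
      rw [this, map_zero, Finsupp.filter_single_of_neg _ (by exact h)]

/-- Restriction of functions to the orbit of `x₀`, as a map to the coinduced representation. -/
noncomputable def Rep.funDiagToCoind :
    A.funDiag X ⟶ Rep.coind (MulAction.stabilizer G x₀).subtype
      (Rep.res (MulAction.stabilizer G x₀).subtype A) :=
  Rep.ofHom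
    { toFun f := ⟨fun h => A.ρ h (f (h⁻¹ • x₀)), fun s h => by
        have : s.1⁻¹ • x₀ = x₀ := (s⁻¹).2
        simp [mul_smul, this]⟩
      map_add' _ _ := by ext; simp
      map_smul' _ _ := by ext; simp
      isIntertwining' := fun γ => by
        ext f h
        simp only [LinearMap.comp_apply, LinearMap.coe_mk, AddHom.coe_mk, funDiag_apply]
        change A.ρ h (A.ρ γ (f (γ⁻¹ • h⁻¹ • x₀))) = A.ρ (h * γ) (f ((h * γ)⁻¹ • x₀))
        simp [mul_smul] }

open Classical in
/-- Extension by zero of functions on the orbit of `x₀`. -/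
noncomputable def Rep.coindToFunDiag :
    Rep.coind (MulAction.stabilizer G x₀).subtype
      (Rep.res (MulAction.stabilizer G x₀).subtype A) ⟶ A.funDiag X :=
  Rep.ofHom
    { toFun φ x := if h : ∃ g : G, g • x₀ = x then A.ρ h.choose (φ.1 h.choose⁻¹) else 0
      map_add' _ _ := by ext x; by_cases h : ∃ g : G, g • x₀ = x <;> simp [h]
      map_smul' _ _ := by ext x; by_cases h : ∃ g : G, g • x₀ = x <;> simp [h]
      isIntertwining' := fun γ => by
        ext φ x
        by_cases h : ∃ g : G, g • x₀ = x
        · have h' : ∃ g : G, g • x₀ = γ⁻¹ • x := ⟨γ⁻¹ * h.choose, by rw [mul_smul, h.choose_spec]⟩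
          have hs : h'.choose⁻¹ * (γ⁻¹ * h.choose) ∈ MulAction.stabilizer G x₀ := by
            rw [MulAction.mem_stabilizer_iff, mul_smul, inv_smul_eq_iff, mul_smul, h.choose_spec,
              h'.choose_spec]
          have := φ.2 ⟨_, hs⟩ (h.choose⁻¹ * γ)
          simp only [LinearMap.comp_apply, LinearMap.coe_mk, AddHom.coe_mk, coind_apply,
            dif_pos h, funDiag_apply,
            dif_pos h']
          have e : φ.1 h'.choose⁻¹ = A.ρ (h'.choose⁻¹ * (γ⁻¹ * h.choose))
              (φ.1 (h.choose⁻¹ * γ)) := by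
            refine Eq.trans ?_ this
            simp [mul_assoc]
          rw [e]
          simp only [← Module.End.mul_apply, ← map_mul]
          congr 2
          group
        · have h' : ¬ ∃ g : G, g • x₀ = γ⁻¹ • x := fun ⟨g, hg⟩ =>
            h ⟨γ * g, by rw [mul_smul, hg, smul_inv_smul]⟩
          simp [h, h'] }

open Classical in
theorem Rep.funDiag_orbit_proj (f : X → A) (x : X) :
    (Rep.funDiagToCoind A x₀ ≫ Rep.coindToFunDiag A x₀).hom f x =
      if x ∈ MulAction.orbit G x₀ then f x else 0 := by
  by_cases h : ∃ g : G, g • x₀ = x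
  · have : (Rep.funDiagToCoind A x₀ ≫ Rep.coindToFunDiag A x₀).hom f x =
        A.ρ h.choose (A.ρ h.choose⁻¹ (f (h.choose⁻¹⁻¹ • x₀))) := dif_pos h
    rw [this, inv_inv, h.choose_spec, ← Module.End.mul_apply, ← map_mul, mul_inv_cancel, map_one,
      if_pos (by exact h)]
    rfl
  · exact (dif_neg h).trans (if_neg h).symm

end Orbit

/-- The module is the direct sum, over the orbits, of representations induced from stabilizers, so
Shapiro's lemma applies to each summand. A cycle meets only finitely many orbits, so finitely many
bounding chains can be added up. -/
theorem groupHomology.isZero_finsuppDiag {n : ℕ}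
    (h : ∀ x : X, IsZero (groupHomology (Rep.res (MulAction.stabilizer G x).subtype A) n)) :
    IsZero (groupHomology (A.finsuppDiag X) n) := by
  classical
  refine isZero_iff.2 fun z hz => ?_
  let p (ω : MulAction.orbitRel.Quotient G X) : A.finsuppDiag X ⟶ A.finsuppDiag X :=
    Rep.finsuppDiagToInd A ω.out ≫ Rep.indToFinsuppDiag A ω.out
  have key (ω : MulAction.orbitRel.Quotient G X) :
      ∃ y, (inhomogeneousChains (A.finsuppDiag X)).d ((ComplexShape.down ℕ).prev n) n y =
        (chainsMap (MonoidHom.id G) (p ω)).f n z :=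
    exists_boundary_of_factor ((h ω.out).of_iso (indIso _ _ n)) _ _ z hz
  choose y hy using key
  -- The orbits met by the values of z; the projections of z to them add up to z.
  let F : Finset (MulAction.orbitRel.Quotient G X) :=
    (Finsupp.support (α := Fin n → G) (M := X →₀ A) z).biUnion fun s =>
      ((show (Fin n → G) →₀ (X →₀ A) from z) s).support.image (Quotient.mk _)
  refine ⟨∑ ω ∈ F, y ω, ?_⟩
  rw [map_sum, Finset.sum_congr rfl fun ω _ => hy ω]
  refine Finsupp.ext (M := X →₀ A) fun s => ?_
  have e1 (ω : MulAction.orbitRel.Quotient G X) :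
      (show (Fin n → G) →₀ (X →₀ A) from (chainsMap (A := A.finsuppDiag X)
        (B := A.finsuppDiag X) (MonoidHom.id G) (p ω)).f n z) s =
        ((show (Fin n → G) →₀ (X →₀ A) from z) s).filter (· ∈ MulAction.orbit G ω.out) := by
    have := chainsMap_id_f_hom_eq_mapRange n (p ω)
    exact (congrArg (fun t : (Fin n → G) →₀ (X →₀ A) => t s) congr($this z)).trans
      (Rep.finsuppDiag_orbit_proj A ω.out _)
  refine (Finsupp.finsetSum_apply F (N := X →₀ A) _ s).trans ?_
  refine (Finset.sum_congr rfl fun ω _ => e1 ω).trans ?_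
  generalize hw : (show (Fin n → G) →₀ (X →₀ A) from z) s = w
  refine Finsupp.ext fun x => ?_
  rw [Finsupp.finsetSum_apply]
  have e2 (ω : MulAction.orbitRel.Quotient G X) :
      x ∈ MulAction.orbit G ω.out ↔ Quotient.mk _ x = ω := by
    conv_rhs => rw [← Quotient.out_eq ω]
    exact (Quotient.eq (r := MulAction.orbitRel G X)).symm
  simp only [Finsupp.filter_apply, e2]
  rw [Finset.sum_ite_eq]
  refine ite_eq_left_iff.2 fun hx => ?_
  by_contra hne
  have hwx : w x ≠ 0 := fun h0 => hne (h0.symm.trans rfl)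
  refine hx (Finset.mem_biUnion.2 ⟨s, Finsupp.mem_support_iff.2 ?_,
    Finset.mem_image.2 ⟨x, Finsupp.mem_support_iff.2 ?_, rfl⟩⟩)
  · intro h0
    exact hwx (by rw [← hw]; exact congrArg (fun t : X →₀ A => t x) h0)
  · exact fun h0 => hwx (by rw [← hw]; exact h0)

/-- The module is a product of coinduced representations, one for each orbit. Bounding cochains are
chosen orbit by orbit and assembled, which needs no finiteness. -/
theorem groupCohomology.isZero_funDiag {n : ℕ}
    (h : ∀ x : X, IsZero (groupCohomology (Rep.res (MulAction.stabilizer G x).subtype A) n)) :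
    IsZero (groupCohomology (A.funDiag X) n) := by
  classical
  refine isZero_iff.2 fun z hz => ?_
  let p (ω : MulAction.orbitRel.Quotient G X) : A.funDiag X ⟶ A.funDiag X :=
    Rep.funDiagToCoind A ω.out ≫ Rep.coindToFunDiag A ω.out
  let c (ω : MulAction.orbitRel.Quotient G X) :=
    cochainsMap (A := A.funDiag X) (B := A.funDiag X) (MonoidHom.id G) (p ω)
  have e2 (ω : MulAction.orbitRel.Quotient G X) (x : X) :
      x ∈ MulAction.orbit G ω.out ↔ Quotient.mk _ x = ω := by
    conv_rhs => rw [← Quotient.out_eq ω]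
    exact (Quotient.eq (r := MulAction.orbitRel G X)).symm
  have ev (ω : MulAction.orbitRel.Quotient G X) (j : ℕ) (w : (Fin j → G) → X → A)
      (s : Fin j → G) (x : X) :
      (show (Fin j → G) → X → A from (c ω).f j w) s x =
        if Quotient.mk _ x = ω then w s x else 0 := by
    have := Rep.funDiag_orbit_proj A ω.out (w s) x
    simp only [e2] at this
    exact this
  have comm (ω : MulAction.orbitRel.Quotient G X) (i j : ℕ)
      (w : (inhomogeneousCochains (A.funDiag X)).X i) :
      (inhomogeneousCochains _).d i j ((c ω).f i w) =
        (c ω).f j ((inhomogeneousCochains _).d i j w) :=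
    congr($((c ω).comm i j) w)
  have key (ω : MulAction.orbitRel.Quotient G X) :
      ∃ y, (inhomogeneousCochains (A.funDiag X)).d ((ComplexShape.up ℕ).prev n) n y =
        (c ω).f n z :=
    exists_coboundary_of_factor ((h ω.out).of_iso (coindIso _ n)) _ _ z hz
  choose y hy using key
  -- At x the value is taken from the cochain chosen for the orbit of x.
  let y' : (inhomogeneousCochains (A.funDiag X)).X ((ComplexShape.up ℕ).prev n) := fun s x =>
    (show (Fin ((ComplexShape.up ℕ).prev n) → G) → X → A from y (Quotient.mk _ x)) s x
  refine ⟨y', ?_⟩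
  have hy' (ω : MulAction.orbitRel.Quotient G X) :
      (c ω).f _ y' =
        (c ω).f _ (y ω) := by
    refine funext fun s => funext fun x => ?_
    refine (ev ω _ y' s x).trans (Eq.trans ?_ (ev ω _ (y ω) s x).symm)
    split_ifs with hx
    · subst hx; rfl
    · rfl
  have fin (w w' : (inhomogeneousCochains (A.funDiag X)).X n)
      (hw : ∀ ω, (c ω).f n w =
        (c ω).f n w') : w = w' := by
    refine funext fun s => funext fun x => ?_
    have := congrArg (fun t : (Fin n → G) → X → A => t s x) (hw (Quotient.mk _ x))
    have := (ev _ n w s x).symm.trans (this.trans (ev _ n w' s x))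
    simpa using this
  refine fin _ _ fun ω => ?_
  rw [← comm ω, hy', comm ω, hy ω]
  refine funext fun s => funext fun x => ?_
  refine (ev ω _ _ s x).trans (Eq.trans ?_ (ev ω _ z s x).symm)
  split_ifs with hx
  · exact (ev ω _ z s x).trans (if_pos hx)
  · rfl

end Permutation

/-! ### Chains of lists -/

namespace ListChain

section Boundary

variable {k V A : Type*} [CommRing k] [AddCommGroup A] [Module k A]

/-- Adding a vertex in front. -/
noncomputable def cone (k : Type*) {V A : Type*} [CommRing k] [AddCommGroup A] [Module k A]
    (v : V) : (List V →₀ A) →ₗ[k] (List V →₀ A) :=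
  Finsupp.lmapDomain A k (List.cons v)

@[simp]
theorem cone_single (v : V) (l : List V) (a : A) :
    cone k v (Finsupp.single l a) = Finsupp.single (v :: l) a := by
  simp [cone]

/-- The alternating sum of the faces of a list. -/
noncomputable def faces (k A : Type*) {V : Type*} [CommRing k] [AddCommGroup A] [Module k A] :
    List V → (A →ₗ[k] (List V →₀ A))
  | [] => 0
  | v :: l => Finsupp.lsingle l - cone k v ∘ₗ faces k A l

/-- The boundary operator on chains of lists, augmented by the empty list. -/
noncomputable def bd (k V A : Type*) [CommRing k] [AddCommGroup A] [Module k A] :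
    (List V →₀ A) →ₗ[k] (List V →₀ A) :=
  Finsupp.lsum k (faces k A)

theorem bd_single (l : List V) (a : A) : bd k V A (Finsupp.single l a) = faces k A l a :=
  Finsupp.lsum_single k _ l a

@[simp]
theorem bd_single_nil (a : A) : bd k V A (Finsupp.single [] a) = 0 :=
  bd_single [] a

theorem bd_single_cons (v : V) (l : List V) (a : A) :
    bd k V A (Finsupp.single (v :: l) a) =
      Finsupp.single l a - cone k v (bd k V A (Finsupp.single l a)) := by
  simp [bd_single, faces]

/-- The cone identity, from which ∂∂ = 0 and all acyclicity statements follow. All degrees are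
treated together, so no grading is carried along. -/
theorem bd_cone (v : V) (z : List V →₀ A) : bd k V A (cone k v z) = z - cone k v (bd k V A z) := by
  induction z using Finsupp.induction_linear with
  | zero => simp
  | add f g hf hg => simp only [map_add, hf, hg]; abel
  | single l a => rw [cone_single, bd_single_cons]

theorem bd_bd (z : List V →₀ A) : bd k V A (bd k V A z) = 0 := by
  induction z using Finsupp.induction_linear with
  | zero => simp
  | add f g hf hg => simp only [map_add, hf, hg, add_zero]
  | single l a =>
    induction l with
    | nil => simp
    | cons v l ih => rw [bd_single_cons, map_sub, bd_cone, ih]; simp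

/-- The chains supported on lists with a given property. -/
abbrev supp (k A : Type*) {V : Type*} [CommRing k] [AddCommGroup A] [Module k A]
    (p : List V → Prop) : Submodule k (List V →₀ A) :=
  Finsupp.supported A k {l | p l}

theorem supp_induction {p : List V → Prop} {N : Type*} [AddCommGroup N] [Module k N]
    (φ : (List V →₀ A) →ₗ[k] N) (S : Submodule k N)
    (h : ∀ l a, p l → φ (Finsupp.single l a) ∈ S) {z : List V →₀ A} (hz : z ∈ supp k A p) :
    φ z ∈ S := by
  rw [← Finsupp.sum_single z, Finsupp.sum, map_sum]
  exact S.sum_mem fun l hl => h l _ (hz hl)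

theorem cone_mem {p q : List V → Prop} {v : V} (h : ∀ l, p l → q (v :: l)) {z : List V →₀ A}
    (hz : z ∈ supp k A p) : cone k v z ∈ supp k A q :=
  supp_induction _ _ (fun l a hl => by
    rw [cone_single]; exact Finsupp.single_mem_supported k a (h l hl)) hz

theorem bd_single_mem (l : List V) (a : A) :
    bd k V A (Finsupp.single l a) ∈ supp k A (fun m => m.Sublist l ∧ m.length < l.length) := by
  induction l with
  | nil => simp
  | cons v l ih =>
    rw [bd_single_cons]
    refine Submodule.sub_mem _ (Finsupp.single_mem_supported k a
      ⟨List.sublist_cons_self v l, by simp⟩) ?_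
    exact cone_mem (fun m hm => ⟨hm.1.cons_cons v, by simpa using hm.2⟩) ih

theorem bd_mem {p : List V → Prop} (hp : ∀ l m, p l → m.Sublist l → p m) {z : List V →₀ A}
    (hz : z ∈ supp k A p) : bd k V A z ∈ supp k A p :=
  supp_induction _ _ (fun l a hl =>
    Finsupp.supported_mono (fun _ hm => hp l _ hl hm.1) (bd_single_mem l a)) hz

theorem bd_single_map {W B : Type*} [AddCommGroup B] [Module k B] (e : V → W) (φ : A →ₗ[k] B)
    (l : List V) (a : A) :
    bd k W B (Finsupp.single (l.map e) (φ a)) =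
      Finsupp.lmapDomain B k (List.map e) (Finsupp.mapRange.linearMap φ
        (bd k V A (Finsupp.single l a))) := by
  have key (v : V) (z : List V →₀ A) :
      Finsupp.lmapDomain B k (List.map e) (Finsupp.mapRange.linearMap φ (cone k v z)) =
        cone k (e v) (Finsupp.lmapDomain B k (List.map e) (Finsupp.mapRange.linearMap φ z)) := by
    induction z using Finsupp.induction_linear with
    | zero => simp
    | add f g hf hg => simp only [map_add, hf, hg]
    | single m b => simp
  induction l with
  | nil => simp
  | cons v l ih =>
    rw [List.map_cons, bd_single_cons, bd_single_cons, ih, map_sub, map_sub, key]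
    simp

/-- Over every relation for which finite sets have lower bounds, cycles are boundaries. -/
theorem exists_bd_eq {R : V → V → Prop} (hR : ∀ s : Finset V, ∃ v, ∀ w ∈ s, R v w)
    {z : List V →₀ A} (hz : z ∈ supp k A (List.Pairwise R)) (h0 : bd k V A z = 0) :
    ∃ y ∈ supp k A (fun l => l ≠ [] ∧ l.Pairwise R), bd k V A y = z := by
  classical
  obtain ⟨v, hv⟩ := hR (z.support.biUnion List.toFinset)
  refine ⟨cone k v z, ?_, by rw [bd_cone, h0]; simp⟩
  have hz' : z ∈ supp k A (fun l => l.Pairwise R ∧ ∀ w ∈ l, R v w) := fun l hl =>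
    ⟨hz hl, fun w hw => hv w (Finset.mem_biUnion.2 ⟨l, hl, List.mem_toFinset.2 hw⟩)⟩
  exact cone_mem (fun l hl => ⟨by simp, List.pairwise_cons.2 ⟨hl.2, hl.1⟩⟩) hz'

/-! ### Cochains -/

/-- The pairing of cochains and integral chains. -/
noncomputable def pair (f : List V → A) : (List V →₀ ℤ) →ₗ[ℤ] A :=
  Finsupp.lsum ℤ fun l => (LinearMap.toSpanSingleton ℤ A (f l))

@[simp]
theorem pair_single (f : List V → A) (l : List V) (n : ℤ) :
    pair f (Finsupp.single l n) = n • f l := by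
  simp [pair]

theorem pair_add (f g : List V → A) (z : List V →₀ ℤ) : pair (f + g) z = pair f z + pair g z := by
  induction z using Finsupp.induction_linear with
  | zero => simp
  | add x y hx hy => simp only [map_add, hx, hy]; abel
  | single l n => simp

theorem pair_comp {B : Type*} [AddCommGroup B] (φ : A →+ B) (f : List V → A) (z : List V →₀ ℤ) :
    pair (fun l => φ (f l)) z = φ (pair f z) := by
  induction z using Finsupp.induction_linear with
  | zero => simp
  | add x y hx hy => simp only [map_add, hx, hy]
  | single l n => simp

theorem pair_congr {f g : List V → A} {p : List V → Prop} (h : ∀ l, p l → f l = g l)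
    {z : List V →₀ ℤ} (hz : z ∈ supp ℤ ℤ p) : pair f z = pair g z := by
  rw [← sub_eq_zero, ← LinearMap.sub_apply]
  exact (Submodule.mem_bot ℤ).1 (supp_induction (pair f - pair g) ⊥
    (fun l a hl => by simp [h l hl]) hz)

/-- The coboundary operator. -/
noncomputable def cobd (f : List V → A) (l : List V) : A := pair f (bd ℤ V ℤ (Finsupp.single l 1))

theorem pair_cobd (f : List V → A) (z : List V →₀ ℤ) : pair (cobd f) z = pair f (bd ℤ V ℤ z) := by
  induction z using Finsupp.induction_linear with
  | zero => simp
  | add x y hx hy => simp only [map_add, hx, hy]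
  | single l n =>
    rw [pair_single, cobd, ← map_smul, ← map_smul, Finsupp.smul_single, smul_eq_mul, mul_one]

theorem cobd_cobd (f : List V → A) (l : List V) : cobd (cobd f) l = 0 := by
  rw [cobd, pair_cobd, bd_bd, map_zero]

@[simp]
theorem cobd_nil (f : List V → A) : cobd f [] = 0 := by simp [cobd]

@[simp]
theorem cobd_singleton (f : List V → A) (v : V) : cobd f [v] = f [] := by
  simp [cobd, bd_single_cons]

theorem cobd_add (f g : List V → A) (l : List V) : cobd (f + g) l = cobd f l + cobd g l :=
  pair_add f g _

theorem cobd_comp {B : Type*} [AddCommGroup B] (φ : A →+ B) (f : List V → A) (l : List V) :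
    cobd (fun l => φ (f l)) l = φ (cobd f l) :=
  pair_comp φ f _

theorem cobd_congr {f g : List V → A} {l : List V} (h : ∀ m, m.Sublist l → f m = g m) :
    cobd f l = cobd g l :=
  pair_congr (p := fun m => m.Sublist l ∧ m.length < l.length) (fun m hm => h m hm.1)
    (bd_single_mem l 1)

theorem cobd_map {W : Type*} (e : V → W) (f : List W → A) (l : List V) :
    cobd f (l.map e) = cobd (fun m => f (m.map e)) l := by
  have key (z : List V →₀ ℤ) : pair f (Finsupp.lmapDomain ℤ ℤ (List.map e)
      (Finsupp.mapRange.linearMap (LinearMap.id : ℤ →ₗ[ℤ] ℤ) z)) = pair (fun m => f (m.map e)) z := by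
    induction z using Finsupp.induction_linear with
    | zero => simp
    | add x y hx hy => simp only [map_add, hx, hy]
    | single l n => simp
  exact (congrArg (pair f) (bd_single_map (k := ℤ) e (LinearMap.id : ℤ →ₗ[ℤ] ℤ) l 1)).trans
    (key _)

open Classical in
/-- A contracting homotopy of the complex of integral chains, built from a choice of lower bounds
of finite sets of vertices. -/
noncomputable def contract (bot : Finset V → V) (l : List V) : List V →₀ ℤ :=
  let w : List V →₀ ℤ := Finsupp.single l 1 - ∑ m ∈ (bd ℤ V ℤ (Finsupp.single l 1)).support.attach,
    bd ℤ V ℤ (Finsupp.single l 1) m.1 • contract bot m.1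
  cone ℤ (bot (w.support.biUnion List.toFinset)) w
termination_by l.length
decreasing_by exact (bd_single_mem l 1 m.2).2

/-- The sum in the recursion is the linear extension of `contract` applied to the boundary of l,
which is `pair` with values in the chains. -/
theorem contract_eq (bot : Finset V → V) (l : List V) :
    ∃ v, contract bot l = cone ℤ v (Finsupp.single l 1 -
      pair (contract bot) (bd ℤ V ℤ (Finsupp.single l 1))) ∧
      ∃ s : Finset V, v = bot s ∧ Finsupp.single l 1 -
        pair (contract bot) (bd ℤ V ℤ (Finsupp.single l 1)) ∈ supp ℤ ℤ (fun m => ∀ x ∈ m, x ∈ s) := by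
  classical
  have e : ∑ m ∈ (bd ℤ V ℤ (Finsupp.single l 1)).support.attach,
      bd ℤ V ℤ (Finsupp.single l 1) m.1 • contract bot m.1 =
      pair (contract bot) (bd ℤ V ℤ (Finsupp.single l 1)) := by
    rw [Finset.sum_attach _ (fun m => bd ℤ V ℤ (Finsupp.single l 1) m • contract bot m)]
    simp [pair, Finsupp.lsum_apply, Finsupp.sum]
  rw [contract, e]
  refine ⟨_, rfl, _, rfl, fun m hm x hx => ?_⟩
  exact Finset.mem_biUnion.2 ⟨m, hm, List.mem_toFinset.2 hx⟩

/-- Cochains need not have finite support, so a single cone point does not suffice, and a homotopy h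
with ∂h + h∂ = 1 is built by recursion on length. The chain w = l - h(∂l) is a cycle by induction,
and h(l) is its cone over a common lower bound of its vertices. -/
theorem contract_spec {R : V → V → Prop} {bot : Finset V → V} (hbot : ∀ s, ∀ w ∈ s, R (bot s) w)
    (l : List V) (hl : l.Pairwise R) :
    contract bot l ∈ supp ℤ ℤ (List.Pairwise R) ∧
      bd ℤ V ℤ (contract bot l) + pair (contract bot) (bd ℤ V ℤ (Finsupp.single l 1)) =
        Finsupp.single l 1 := by
  induction hn : l.length using Nat.strong_induction_on generalizing l with
  | _ n ih =>
  subst hn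
  obtain ⟨v, hv, s, rfl, hs⟩ := contract_eq bot l
  set w : List V →₀ ℤ := Finsupp.single l 1 - pair (contract bot) (bd ℤ V ℤ (Finsupp.single l 1))
    with hw
  have hmem : bd ℤ V ℤ (Finsupp.single l (1 : ℤ)) ∈
      supp ℤ ℤ (fun m => m.length < l.length ∧ m.Pairwise R) :=
    Finsupp.supported_mono (fun m hm => And.intro hm.2 (hl.sublist hm.1))
      (show _ ∈ supp ℤ ℤ (fun m => m.Sublist l ∧ m.length < l.length) from bd_single_mem l 1)
  have hwR : w ∈ supp ℤ ℤ (List.Pairwise R) := by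
    refine Submodule.sub_mem _ (Finsupp.single_mem_supported ℤ 1 hl) ?_
    exact supp_induction (pair (contract bot)) _ (fun m a hm => by
      rw [pair_single]; exact Submodule.smul_mem _ _ (ih _ hm.1 m hm.2 rfl).1) hmem
  -- On the shorter lists occurring in ∂l the homotopy identity gives ∂h∂l = ∂l - h∂∂l = ∂l.
  have h1 : bd ℤ V ℤ w = 0 := by
    have := supp_induction (bd ℤ V ℤ ∘ₗ pair (contract bot) + pair (contract bot) ∘ₗ bd ℤ V ℤ -
      LinearMap.id) ⊥ (fun m a hm => by
        have := (ih _ hm.1 m hm.2 rfl).2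
        have e : Finsupp.single m a = a • Finsupp.single m (1 : ℤ) := by simp
        rw [e, map_smul]
        refine Submodule.smul_mem _ _ ((Submodule.mem_bot ℤ).2 ?_)
        simp only [LinearMap.sub_apply, LinearMap.add_apply, LinearMap.comp_apply, pair_single,
          one_smul, LinearMap.id_apply, this, sub_self]) hmem
    rw [Submodule.mem_bot] at this
    simp only [LinearMap.sub_apply, LinearMap.add_apply, LinearMap.comp_apply, bd_bd, map_zero,
      add_zero, LinearMap.id_apply, sub_eq_zero] at this
    rw [hw, map_sub, this, sub_self]
  rw [hv]
  refine ⟨cone_mem (p := fun m => m.Pairwise R ∧ ∀ x ∈ m, x ∈ s) (fun m hm =>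
    List.pairwise_cons.2 ⟨fun x hx => hbot s x (hm.2 x hx), hm.1⟩)
    (fun m hm => And.intro (hwR hm) (hs hm)), ?_⟩
  rw [bd_cone, h1, map_zero, sub_zero, hw, sub_add_cancel]

/-- Over every relation for which finite sets have lower bounds, cocycles are coboundaries. -/
theorem exists_cobd_eq {R : V → V → Prop} (hR : ∀ s : Finset V, ∃ v, ∀ w ∈ s, R v w)
    (f : List V → A) (hf : ∀ l, l.Pairwise R → cobd f l = 0) :
    ∃ g : List V → A, ∀ l, l.Pairwise R → cobd g l = f l := by
  choose bot hbot using hR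
  refine ⟨fun l => pair f (contract bot l), fun l hl => ?_⟩
  obtain ⟨h1, h2⟩ := contract_spec hbot l hl
  have e := pair_comp (pair f).toAddMonoidHom (contract bot) (bd ℤ V ℤ (Finsupp.single l 1))
  refine e.trans ?_
  rw [eq_sub_of_add_eq' h2]
  change pair f _ = _
  rw [map_sub, pair_single, one_smul, ← pair_cobd, pair_congr (g := 0) hf h1]
  have : pair (0 : List V → A) = 0 := by ext; simp
  rw [this, LinearMap.zero_apply, sub_zero]

end Boundary

end ListChain

/-! ### Short exact sequences and products of representations. -/

theorem Rep.shortExact_of {k G : Type u} [CommRing k] [Group G] {A B C : Rep.{u} k G}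
    (f : A ⟶ B) (g : B ⟶ C) (w : f ≫ g = 0) (hf : Function.Injective f.hom)
    (hg : Function.Surjective g.hom) (h : ∀ x, g.hom x = 0 → ∃ y, f.hom y = x) :
    (ShortComplex.mk f g w).ShortExact where
  exact := by
    rw [← ShortComplex.exact_map_iff_of_faithful _ (forget₂ (Rep.{u} k G) (ModuleCat.{u} k)),
      ShortComplex.moduleCat_exact_iff]
    exact h
  mono_f := (Rep.mono_iff_injective f).2 hf
  epi_g := (Rep.epi_iff_surjective g).2 hg

section Prod

variable {k G : Type u} [CommRing k] [Group G] (A B : Rep.{u} k G)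

/-- The product of two representations. -/
noncomputable abbrev Rep.prod : Rep.{u} k G := Rep.of (A.ρ.prod B.ρ)

/-- The first factor is a retract of a product. -/
noncomputable def Rep.retractFst : Retract A (A.prod B) where
  i := Rep.ofHom { toLinearMap := LinearMap.inl k A B, isIntertwining' := fun g => by ext <;> simp }
  r := Rep.ofHom { toLinearMap := LinearMap.fst k A B, isIntertwining' := fun g => by ext <;> simp }
  retract := by ext; rfl

/-- The second factor is a retract of a product. -/
noncomputable def Rep.retractSnd : Retract B (A.prod B) where
  i := Rep.ofHom { toLinearMap := LinearMap.inr k A B, isIntertwining' := fun g => by ext <;> simp }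
  r := Rep.ofHom { toLinearMap := LinearMap.snd k A B, isIntertwining' := fun g => by ext <;> simp }
  retract := by ext; rfl

end Prod

/-! ### Vanishing of homology from the stabilizers of simplices. -/

namespace ListChain

variable {G V : Type u} [Group G] [MulAction G V]

/-- The nonempty lists in which every entry is related to the later ones. -/
abbrev Simplex (R : V → V → Prop) : Type u := {l : List V // l ≠ [] ∧ l.Pairwise R}

variable {R : V → V → Prop}

/-- The translation of lists. -/
abbrev tr (g : G) : List V → List V := List.map (g • ·)

theorem map_eq_self_iff {α : Type*} {f : α → α} {l : List α} :
    l.map f = l ↔ ∀ x ∈ l, f x = x := by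
  induction l with
  | nil => simp
  | cons a l ih => simp [ih]

theorem tr_mem (hR : ∀ (g : G) v w, R v w → R (g • v) (g • w)) (g : G) {l : List V}
    (hl : l ≠ [] ∧ l.Pairwise R) : tr g l ≠ [] ∧ (tr g l).Pairwise R :=
  ⟨by simpa using hl.1, List.pairwise_map.2 (hl.2.imp (hR g _ _))⟩

/-- The action on simplices. -/
abbrev simplexAction (hR : ∀ (g : G) v w, R v w → R (g • v) (g • w)) :
    MulAction G (Simplex R) where
  smul g l := ⟨tr g l.1, tr_mem hR g l.2⟩
  one_smul l := Subtype.ext (by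
    change List.map (fun v => (1 : G) • v) l.1 = l.1
    simp)
  mul_smul g h l := Subtype.ext (by
    change List.map (fun v => (g * h) • v) l.1 = List.map _ (List.map _ l.1)
    simp [mul_smul])

variable {k : Type u} [CommRing k]

section Homology

variable (R) in
open Classical in
/-- The part of a chain supported on simplices. -/
noncomputable def restr (k A : Type*) [CommRing k] [AddCommGroup A] [Module k A] :
    (List V →₀ A) →ₗ[k] (Simplex R →₀ A) :=
  Finsupp.lsum k fun l => if h : l ≠ [] ∧ l.Pairwise R then Finsupp.lsingle ⟨l, h⟩ else 0

variable (R) in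
/-- Chains of simplices are chains of lists. -/
noncomputable def incl (k A : Type*) [CommRing k] [AddCommGroup A] [Module k A] :
    (Simplex R →₀ A) →ₗ[k] (List V →₀ A) :=
  Finsupp.lmapDomain A k Subtype.val

variable {A : Type u} [AddCommGroup A] [Module k A]

@[simp]
theorem incl_single (l : Simplex R) (a : A) :
    incl R k A (Finsupp.single l a) = Finsupp.single l.1 a := by
  simp [incl]

theorem restr_single (l : Simplex R) (a : A) :
    restr R k A (Finsupp.single l.1 a) = Finsupp.single l a := by
  refine (Finsupp.lsum_single k _ _ _).trans ?_
  rw [dif_pos l.2]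
  rfl

theorem restr_single_of_not {l : List V} (h : ¬ (l ≠ [] ∧ l.Pairwise R)) (a : A) :
    restr R k A (Finsupp.single l a) = 0 := by
  refine (Finsupp.lsum_single k _ _ _).trans ?_
  rw [dif_neg h]
  rfl

theorem restr_incl (z : Simplex R →₀ A) : restr R k A (incl R k A z) = z := by
  induction z using Finsupp.induction_linear with
  | zero => simp
  | add x y hx hy => simp only [map_add, hx, hy]
  | single l a => rw [incl_single, restr_single]

theorem incl_nil (z : Simplex R →₀ A) : incl R k A z [] = 0 := by
  induction z using Finsupp.induction_linear with
  | zero => simp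
  | add x y hx hy => simp only [map_add, Finsupp.add_apply, hx, hy, add_zero]
  | single l a => rw [incl_single, Finsupp.single_eq_of_ne l.2.1.symm]

theorem incl_mem (z : Simplex R →₀ A) : incl R k A z ∈ supp k A (List.Pairwise R) := by
  induction z using Finsupp.induction_linear with
  | zero => simp
  | add x y hx hy => rw [map_add]; exact Submodule.add_mem _ hx hy
  | single l a => rw [incl_single]; exact Finsupp.single_mem_supported k a l.2.2

/-- The augmented complex is the sum of A, sitting on the empty list, and the chains of simplices.
-/
theorem incl_restr {z : List V →₀ A} (hz : z ∈ supp k A (List.Pairwise R)) :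
    Finsupp.single [] (z []) + incl R k A (restr R k A z) = z := by
  have := supp_induction (Finsupp.lsingle [] ∘ₗ Finsupp.lapply [] +
    incl R k A ∘ₗ restr R k A - LinearMap.id) ⊥ (fun l a hl => by
      rw [Submodule.mem_bot, LinearMap.sub_apply, LinearMap.add_apply, LinearMap.comp_apply,
        LinearMap.comp_apply, LinearMap.id_apply, sub_eq_zero]
      by_cases h : l = []
      · subst h
        rw [restr_single_of_not (by simp)]
        simp
      · rw [restr_single ⟨l, h, hl⟩, incl_single]
        simp [h]) hz
  rw [Submodule.mem_bot] at this
  simpa [sub_eq_zero] using this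

variable (ρ : Representation k G A)

/-- The diagonal action on chains of lists. -/
noncomputable def act (g : G) : (List V →₀ A) →ₗ[k] (List V →₀ A) :=
  Finsupp.lmapDomain A k (tr g) ∘ₗ Finsupp.mapRange.linearMap (ρ g)

@[simp]
theorem act_single (g : G) (l : List V) (a : A) :
    act ρ g (Finsupp.single l a) = Finsupp.single (tr g l) (ρ g a) := by
  simp [act]

theorem bd_act (g : G) (z : List V →₀ A) : bd k V A (act ρ g z) = act ρ g (bd k V A z) := by
  induction z using Finsupp.induction_linear with
  | zero => simp
  | add x y hx hy => simp only [map_add, hx, hy]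
  | single l a => rw [act_single]; exact bd_single_map _ (ρ g) l a

theorem act_nil (g : G) (z : List V →₀ A) : act ρ g z [] = ρ g (z []) := by
  induction z using Finsupp.induction_linear with
  | zero => simp
  | add x y hx hy => simp only [map_add, Finsupp.add_apply, hx, hy]
  | single l a =>
    rw [act_single]
    cases l <;> simp

variable (hR : ∀ (g : G) v w, R v w → R (g • v) (g • w))

theorem incl_act (g : G) (z : Simplex R →₀ A) :
    letI := simplexAction hR
    incl R k A (ρ.finsuppDiag (Simplex R) g z) = act ρ g (incl R k A z) := by
  let := simplexAction hR
  induction z using Finsupp.induction_linear with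
  | zero => simp
  | add x y hx hy => simp only [map_add, hx, hy]
  | single l a =>
    rw [Representation.finsuppDiag_single, incl_single, incl_single, act_single]
    rfl

theorem restr_act (g : G) (z : List V →₀ A) :
    letI := simplexAction hR
    restr R k A (act ρ g z) = ρ.finsuppDiag (Simplex R) g (restr R k A z) := by
  let := simplexAction hR
  induction z using Finsupp.induction_linear with
  | zero => simp
  | add x y hx hy => simp only [map_add, hx, hy]
  | single l a =>
    rw [act_single]
    by_cases h : l ≠ [] ∧ l.Pairwise R
    · rw [restr_single ⟨l, h⟩, Representation.finsuppDiag_single]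
      exact restr_single (⟨tr g l, tr_mem hR g h⟩ : Simplex R) _
    · rw [restr_single_of_not h, restr_single_of_not, map_zero]
      intro h'
      refine h ?_
      have := tr_mem hR g⁻¹ h'
      simpa [tr, Function.comp_def] using this

end Homology

open Limits

/-- The cycles of the augmented complex are A ⊕ K, where K consists of the cycles supported on
nonempty lists. Acyclicity says that the boundary maps E onto A ⊕ K with kernel K, and dimension
shifting along this sequence gives the claim. -/
theorem _root_.groupHomology.isZero_of_simplices (A : Rep.{u} k G)
    (hR : ∀ (g : G) v w, R v w → R (g • v) (g • w)) (hbot : ∀ s : Finset V, ∃ v, ∀ w ∈ s, R v w)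
    (n : ℕ) (h : ∀ (S : Subgroup G) (l : List V), l ≠ [] → l.Pairwise R →
      (∀ g, g ∈ S ↔ ∀ v ∈ l, g • v = v) →
      ∀ q < n, IsZero (groupHomology (Rep.res S.subtype A) q)) (q : ℕ) (hq : q < n) :
    IsZero (groupHomology A q) := by
  let := simplexAction hR
  let E := A.finsuppDiag (Simplex R)
  have hE : ∀ q < n, IsZero (groupHomology E q) := fun q hq =>
    groupHomology.isZero_finsuppDiag A fun x => h _ x.1 x.2.1 x.2.2 (fun g => by
      rw [MulAction.mem_stabilizer_iff, Subtype.ext_iff]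
      change List.map _ x.1 = x.1 ↔ _
      exact map_eq_self_iff) q hq
  have hsub : ∀ l m : List V, l.Pairwise R → m.Sublist l → m.Pairwise R :=
    fun l m h h' => h.sublist h'
  let K : Submodule k E := LinearMap.ker (bd k V A ∘ₗ incl R k A)
  have hK : ∀ g, K ≤ K.comap (E.ρ g) := fun g z hz => by
    change bd k V A (incl R k A (A.ρ.finsuppDiag (Simplex R) g z)) = 0
    have hz' : bd k V A (incl R k A z) = 0 := hz
    rw [incl_act, bd_act, hz', map_zero]
  let KR := E.subrepresentation K hK
  let d : E →ₗ[k] E := restr R k A ∘ₗ bd k V A ∘ₗ incl R k A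
  have split (z : E) : Finsupp.single [] (bd k V A (incl R k A z) []) + incl R k A (d z) =
      bd k V A (incl R k A z) := incl_restr (bd_mem hsub (incl_mem z))
  have hd (z : E) : d z ∈ K := by
    have := congrArg (bd k V A) (split z)
    rwa [map_add, bd_single_nil, zero_add, bd_bd] at this
  let f : KR ⟶ E := E.subtype K hK
  -- The boundary, split into its coefficient at the empty list (the augmentation) and its part on
  -- simplices.
  let g : E ⟶ A.prod KR := Rep.ofHom
    { toLinearMap := (Finsupp.lapply [] ∘ₗ bd k V A ∘ₗ incl R k A).prod (d.codRestrict K hd)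
      isIntertwining' := fun γ => LinearMap.ext fun z => by
        refine Prod.ext ?_ (Subtype.ext ?_)
        · change bd k V A (incl R k A (A.ρ.finsuppDiag (Simplex R) γ z)) [] =
            A.ρ γ (bd k V A (incl R k A z) [])
          rw [incl_act, bd_act, act_nil]
        · change restr R k A (bd k V A (incl R k A (A.ρ.finsuppDiag (Simplex R) γ z))) =
            A.ρ.finsuppDiag (Simplex R) γ (restr R k A (bd k V A (incl R k A z)))
          rw [incl_act, bd_act, restr_act] }
  have hg1 (z : E) : (g.hom z).1 = bd k V A (incl R k A z) [] := rfl
  have hg2 (z : E) : (g.hom z).2.1 = d z := rfl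
  have hz0 (z : E) (hz : g.hom z = 0) : z ∈ K := by
    have e1 := hg1 z
    have e2 := hg2 z
    rw [hz] at e1 e2
    change bd k V A (incl R k A z) = 0
    rw [← split z, ← e1, ← e2]
    change Finsupp.single [] (0 : A) + incl R k A 0 = 0
    simp
  have hKz (z : E) (hz : z ∈ K) : g.hom z = 0 := by
    have hz' : bd k V A (incl R k A z) = 0 := hz
    refine Prod.ext ?_ (Subtype.ext ?_)
    · rw [hg1, hz']; rfl
    · rw [hg2]
      change restr R k A (bd k V A (incl R k A z)) = 0
      rw [hz', map_zero]
  have hS : (ShortComplex.mk f g (Rep.hom_ext (Representation.IntertwiningMap.ext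
      (LinearMap.ext fun z => hKz z.1 z.2)))).ShortExact := by
    refine Rep.shortExact_of f g _ Subtype.val_injective ?_ fun x hx => ⟨⟨x, hz0 x hx⟩, rfl⟩
    rintro ⟨a, ⟨w, hw⟩⟩
    have hmem : Finsupp.single [] a + incl R k A w ∈ supp k A (List.Pairwise R) :=
      Submodule.add_mem _ (Finsupp.single_mem_supported k a List.Pairwise.nil) (incl_mem w)
    obtain ⟨y, hy, hy'⟩ := exists_bd_eq hbot hmem (by
      rw [map_add, bd_single_nil, zero_add]; exact hw)
    have hy0 : y [] = 0 := by
      by_contra h0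
      exact (hy (Finsupp.mem_support_iff.2 h0)).1 rfl
    have hincl : incl R k A (restr R k A y) = y := by
      have := incl_restr (k := k) (z := y) (R := R) (fun l hl => (hy hl).2)
      rwa [hy0, Finsupp.single_zero, zero_add] at this
    refine ⟨restr R k A y, Prod.ext ?_ (Subtype.ext ?_)⟩
    · rw [hg1, hincl, hy', Finsupp.add_apply, incl_nil]
      simp
    · rw [hg2]
      change restr R k A (bd k V A (incl R k A (restr R k A y))) = w
      rw [hincl, hy', map_add, restr_incl, restr_single_of_not (by simp), zero_add]
  exact groupHomology.isZero_of_retract (A.retractFst KR) q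
    (groupHomology.isZero_of_shortExact hS (A.retractSnd KR) n hE q hq)

end ListChain

/-! ### Vanishing of cohomology from the stabilizers of simplices. -/

namespace ListChain

variable {G V : Type u} [Group G] [MulAction G V] {R : V → V → Prop} {k : Type u} [CommRing k]

open Limits

section Cohomology

variable {A : Type u} [AddCommGroup A] [Module k A]

open Classical in
/-- Extension by zero of cochains. -/
noncomputable def ext (f : Simplex R → A) (l : List V) : A :=
  if h : l ≠ [] ∧ l.Pairwise R then f ⟨l, h⟩ else 0

@[simp]
theorem ext_val (f : Simplex R → A) (l : Simplex R) : ext f l.1 = f l := dif_pos l.2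

@[simp]
theorem ext_nil (f : Simplex R → A) : ext f [] = 0 := dif_neg (by simp)

theorem ext_restrict (f : List V → A) (h0 : f [] = 0) {l : List V} (hl : l.Pairwise R) :
    ext (R := R) (fun x => f x.1) l = f l := by
  by_cases h : l = []
  · subst h; rw [ext_nil, h0]
  · exact dif_pos ⟨h, hl⟩

theorem ext_add (f g : Simplex R → A) : ext (f + g) = ext f + ext g := by
  funext l
  by_cases h : l ≠ [] ∧ l.Pairwise R <;> simp [ext, h]

theorem ext_smul (c : k) (f : Simplex R → A) : ext (c • f) = fun l => c • ext f l := by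
  funext l
  by_cases h : l ≠ [] ∧ l.Pairwise R <;> simp [ext, h]

variable (R k A) in
/-- The coboundary operator on cochains of simplices. -/
noncomputable def dd : (Simplex R → A) →ₗ[k] (Simplex R → A) where
  toFun f x := cobd (ext f) x.1
  map_add' f g := funext fun x => by rw [ext_add, cobd_add]; rfl
  map_smul' c f := funext fun x => by
    rw [ext_smul]
    exact cobd_comp (DistribSMul.toAddMonoidHom A c) (ext f) x.1

theorem dd_restrict (f : List V → A) (h0 : f [] = 0) (x : Simplex R) :
    dd R k A (fun y => f y.1) x = cobd f x.1 :=
  cobd_congr fun _ hm => ext_restrict f h0 (x.2.2.sublist hm)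

theorem dd_dd (f : Simplex R → A) : dd R k A (dd R k A f) = 0 := by
  funext x
  refine (dd_restrict (cobd (ext f)) (cobd_nil _) x).trans (cobd_cobd _ _)

variable (ρ : Representation k G A) (hR : ∀ (g : G) v w, R v w → R (g • v) (g • w))

theorem ext_funDiag (g : G) (f : Simplex R → A) (l : List V) :
    letI := simplexAction hR
    ext (ρ.funDiag (Simplex R) g f) l = ρ g (ext f (tr g⁻¹ l)) := by
  let := simplexAction hR
  by_cases h : l ≠ [] ∧ l.Pairwise R
  · rw [ext, ext, dif_pos h, dif_pos (tr_mem hR g⁻¹ h)]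
    rfl
  · have h' : ¬ (tr g⁻¹ l ≠ [] ∧ (tr g⁻¹ l).Pairwise R) := fun h' => h (by
      have := tr_mem hR g h'
      simpa [tr, Function.comp_def] using this)
    rw [ext, ext, dif_neg h, dif_neg h', map_zero]

theorem dd_funDiag (g : G) (f : Simplex R → A) :
    letI := simplexAction hR
    dd R k A (ρ.funDiag (Simplex R) g f) = ρ.funDiag (Simplex R) g (dd R k A f) := by
  let := simplexAction hR
  funext x
  change cobd (ext (ρ.funDiag (Simplex R) g f)) x.1 = ρ g (cobd (ext f) (tr g⁻¹ x.1))
  rw [show ext (ρ.funDiag (Simplex R) g f) = fun l => ρ g (ext f (tr g⁻¹ l)) from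
    funext (ext_funDiag ρ hR g f), cobd_map]
  exact cobd_comp (ρ g).toAddMonoidHom (fun m => ext f (tr g⁻¹ m)) x.1

/-- The simplex consisting of one vertex. -/
abbrev vertex (v : V) : Simplex R := ⟨[v], by simp⟩

variable (R k A) in
/-- The constant cochains in dimension zero. -/
noncomputable def const0 : A →ₗ[k] (Simplex R → A) where
  toFun a x := if x.1.length = 1 then a else 0
  map_add' a b := funext fun x => by by_cases h : x.1.length = 1 <;> simp [h]
  map_smul' a b := funext fun x => by by_cases h : x.1.length = 1 <;> simp [h]

/-- Exhibits the constant cochain of degree zero as a coboundary in the augmented complex, hence as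
a cocycle. -/
theorem cobd_nil_cochain (a : A) (l : List V) :
    cobd (fun m : List V => if m = [] then a else 0) l = if l.length = 1 then a else 0 := by
  induction l with
  | nil => simp
  | cons v l ih =>
    rcases l with - | ⟨w, l⟩
    · simp
    · have : (w :: l).length ≠ 0 := by simp
      rw [cobd, pair_congr (g := fun _ => 0) (p := fun m => m.length + 1 = (v :: w :: l).length)]
      · have : pair (0 : List V → A) = 0 := by ext; simp
        rw [if_neg (by simp)]
        exact congr($this _)
      · intro m hm
        rw [if_neg]
        rintro rfl
        simp at hm
      · generalize v :: w :: l = t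
        induction t with
        | nil => simp
        | cons x t ih =>
          rw [bd_single_cons]
          refine Submodule.sub_mem _ (Finsupp.single_mem_supported ℤ 1 (by simp)) ?_
          exact cone_mem (p := fun m => m.length + 1 = t.length) (fun m hm => by simpa using hm) ih

end Cohomology

/-- Here the short exact sequence is 0 → A ⊕ K → E → K → 0: a cocycle is constant on vertices, and
what remains after subtracting this constant lies in K. -/
theorem _root_.groupCohomology.isZero_of_simplices (A : Rep.{u} k G)
    (hR : ∀ (g : G) v w, R v w → R (g • v) (g • w)) (hbot : ∀ s : Finset V, ∃ v, ∀ w ∈ s, R v w)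
    (n : ℕ) (h : ∀ (S : Subgroup G) (l : List V), l ≠ [] → l.Pairwise R →
      (∀ g, g ∈ S ↔ ∀ v ∈ l, g • v = v) →
      ∀ q < n, IsZero (groupCohomology (Rep.res S.subtype A) q)) (q : ℕ) (hq : q < n) :
    IsZero (groupCohomology A q) := by
  let := simplexAction hR
  let E := A.funDiag (Simplex R)
  have hE : ∀ q < n, IsZero (groupCohomology E q) := fun q hq =>
    groupCohomology.isZero_funDiag A fun x => h _ x.1 x.2.1 x.2.2 (fun g => by
      rw [MulAction.mem_stabilizer_iff, Subtype.ext_iff]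
      change List.map _ x.1 = x.1 ↔ _
      exact map_eq_self_iff) q hq
  obtain ⟨v₀, -⟩ := hbot ∅
  -- These are exactly the coboundaries of cochains of simplices: such cochains vanish on the empty
  -- list, so their coboundaries vanish on vertices.
  let K : Submodule k E := LinearMap.ker (dd R k A) ⊓
    LinearMap.ker (LinearMap.funLeft k A (vertex : V → Simplex R))
  have memK (z : E) : z ∈ K ↔ dd R k A z = 0 ∧ ∀ v : V, z (vertex v) = 0 :=
    and_congr Iff.rfl ⟨fun h v => congrFun h v, fun h => funext h⟩
  have hK : ∀ g, K ≤ K.comap (E.ρ g) := fun g z hz => by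
    obtain ⟨h1, h2⟩ := (memK z).1 hz
    refine (memK _).2 ⟨(dd_funDiag A.ρ hR g z).trans (by rw [h1, map_zero]), fun v => ?_⟩
    exact (congrArg (A.ρ g) (h2 (g⁻¹ • v))).trans (map_zero _)
  let KR := E.subrepresentation K hK
  have hd (z : E) : dd R k A z ∈ K :=
    (memK _).2 ⟨dd_dd z, fun v => (cobd_singleton _ v).trans (ext_nil z)⟩
  let f : A.prod KR ⟶ E := Rep.ofHom
    { toLinearMap := (const0 R k A).coprod K.subtype
      isIntertwining' := fun γ => LinearMap.ext fun z => funext fun x => by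
        change (if x.1.length = 1 then A.ρ γ z.1 else 0) + A.ρ γ (z.2.1 (γ⁻¹ • x)) =
          A.ρ γ ((if (List.map _ x.1).length = 1 then z.1 else 0) + z.2.1 (γ⁻¹ • x))
        rw [List.length_map, map_add]
        split_ifs <;> simp }
  let g : E ⟶ KR := Rep.ofHom
    { toLinearMap := (dd R k A).codRestrict K hd
      isIntertwining' := fun γ => LinearMap.ext fun z =>
        Subtype.ext (dd_funDiag A.ρ hR γ z) }
  have hf (z : A.prod KR) (x : Simplex R) :
      f.hom z x = (if x.1.length = 1 then z.1 else 0) + z.2.1 x := rfl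
  have hg (z : E) : (g.hom z).1 = dd R k A z := rfl
  have hconst (a : A) : dd R k A (const0 R k A a) = 0 := by
    have : const0 R k A a = fun y => cobd (fun m : List V => if m = [] then a else 0) y.1 :=
      funext fun y => (cobd_nil_cochain a y.1).symm
    rw [this]
    exact funext fun x => (dd_restrict _ (cobd_nil _) x).trans (cobd_cobd _ _)
  have exact_ext (z : E) (hz : dd R k A z = 0) :
      ∃ t : List V → A, ∀ l, l.Pairwise R → cobd t l = ext z l :=
    exists_cobd_eq hbot (ext z) fun l hl => by
      by_cases h0 : l = []
      · subst h0; simp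
      · exact congrFun hz ⟨l, h0, hl⟩
  have hfg : f ≫ g = 0 := by
    refine Rep.hom_ext (Representation.IntertwiningMap.ext (LinearMap.ext fun z => Subtype.ext ?_))
    change dd R k A (const0 R k A z.1 + z.2.1) = 0
    rw [map_add, hconst, zero_add]
    exact ((memK _).1 z.2.2).1
  have hS : (ShortComplex.mk f g hfg).ShortExact := by
    refine Rep.shortExact_of f g _ ?_ ?_ fun x hx => ?_
    · rw [injective_iff_map_eq_zero]
      intro z hz
      have h1 : z.1 = 0 := by
        have := (hf z (vertex v₀)).symm.trans (congrFun hz _)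
        rw [((memK _).1 z.2.2).2 v₀, add_zero] at this
        exact this
      refine Prod.ext h1 (Subtype.ext (funext fun x => ?_))
      have := (hf z x).symm.trans (congrFun hz x)
      rw [h1, ite_self, zero_add] at this
      exact this
    · rintro ⟨z, hz⟩
      obtain ⟨h1, h2⟩ := (memK z).1 hz
      obtain ⟨t, ht⟩ := exact_ext z h1
      -- The value at the empty list must vanish for t to be a cochain of simplices extended by
      -- zero; it is read off at a vertex.
      have ht0 : t [] = 0 := by
        rw [← cobd_singleton t v₀, ht [v₀] (by simp)]
        exact (ext_val z (vertex v₀)).trans (h2 v₀)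
      refine ⟨fun x => t x.1, Subtype.ext (funext fun x => ?_)⟩
      exact (dd_restrict t ht0 x).trans ((ht x.1 x.2.2).trans (ext_val z x))
    · have hx' : dd R k A x = 0 := (hg x).symm.trans (congrArg Subtype.val hx)
      obtain ⟨t, ht⟩ := exact_ext x hx'
      have hxv (v : V) : x (vertex v) = t [] := by
        rw [← cobd_singleton t v, ht [v] (by simp)]
        exact (ext_val x (vertex v)).symm
      refine ⟨(t [], ⟨x - const0 R k A (t []), (memK _).2 ⟨?_, fun v => ?_⟩⟩), ?_⟩
      · rw [map_sub, hx', hconst, sub_zero]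
      · change x (vertex v) - t [] = 0
        rw [hxv, sub_self]
      · change const0 R k A (t []) + (x - const0 R k A (t [])) = x
        abel
  exact groupCohomology.isZero_of_retract (A.retractFst KR) q
    (groupCohomology.isZero_of_shortExact hS (A.retractSnd KR) n hE q hq)

end ListChain

/-! ### From families of subgroups to the whole group. -/

section Family

open Limits

variable {k : Type u} [CommRing k]

/-- A vanishing property of representations of groups, invariant under isomorphisms, which passes
from the stabilizers of simplices to the whole group. -/
structure DetectedOnSimplices (Van : ∀ {G : Type u} [Group G], Rep.{u} k G → ℕ → Prop) : Prop where
  of_equiv : ∀ {G H : Type u} [Group G] [Group H] {A : Rep.{u} k G} {B : Rep.{u} k H} (e : G ≃* H)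
    (e' : A.V ≃ₗ[k] B.V), (∀ g, e' ∘ₗ A.ρ g = B.ρ (e g) ∘ₗ e') → ∀ q, Van A q → Van B q
  of_simplices : ∀ {G V : Type u} [Group G] [MulAction G V] {R : V → V → Prop} (A : Rep.{u} k G),
    (∀ (g : G) v w, R v w → R (g • v) (g • w)) → (∀ s : Finset V, ∃ v, ∀ w ∈ s, R v w) →
    ∀ n : ℕ, (∀ (S : Subgroup G) (l : List V), l ≠ [] → l.Pairwise R →
      (∀ g, g ∈ S ↔ ∀ v ∈ l, g • v = v) → ∀ q < n, Van (Rep.res S.subtype A) q) →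
    ∀ q < n, Van A q

theorem detectedOnSimplices_groupHomology :
    DetectedOnSimplices (k := k) fun A q => IsZero (groupHomology A q) where
  of_equiv e e' he q h := h.of_iso (groupHomology.mapIso e e' he q).symm
  of_simplices A hR hbot n h q hq := groupHomology.isZero_of_simplices A hR hbot n h q hq

theorem detectedOnSimplices_groupCohomology :
    DetectedOnSimplices (k := k) fun A q => IsZero (groupCohomology A q) where
  of_equiv e e' he q h := h.of_iso (groupCohomology.mapIso e.symm e'.symm (fun h => by
    rw [LinearEquiv.toLinearMap_symm_comp_eq, ← LinearMap.comp_assoc, he]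
    simp [LinearMap.comp_assoc]) q)
  of_simplices A hR hbot n h q hq := groupCohomology.isZero_of_simplices A hR hbot n h q hq

namespace DetectedOnSimplices

variable {Van : ∀ {G : Type u} [Group G], Rep.{u} k G → ℕ → Prop} (hV : DetectedOnSimplices Van)
  {G : Type u} [Group G] (A : Rep.{u} k G)

include hV

/-- Replaces the Hochschild–Serre spectral sequence. On the cosets of N with the relation that
always holds, every simplex has stabilizer N by normality. -/
theorem of_normal (N : Subgroup G) [N.Normal] (n : ℕ)
    (h : ∀ q < n, Van (Rep.res N.subtype A) q) : ∀ q < n, Van A q := by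
  refine hV.of_simplices (V := G ⧸ N) (R := fun _ _ => True) A (fun _ _ _ _ => trivial)
    (fun _ => ⟨(1 : G), fun _ _ => trivial⟩) n fun S l hl _ hS => ?_
  have key (g x : G) : g • (x : G ⧸ N) = x ↔ g ∈ N := by
    rw [MulAction.Quotient.smul_coe, eq_comm, QuotientGroup.eq, smul_eq_mul, ← mul_assoc]
    have := Subgroup.Normal.mem_comm_iff (H := N) inferInstance (a := x⁻¹ * g) (b := x)
    rw [this, ← mul_assoc, mul_inv_cancel, one_mul]
  obtain rfl : S = N := by
    ext g
    rw [hS]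
    refine ⟨fun hg => ?_, fun hg v _ => ?_⟩
    · obtain ⟨v, hv⟩ := List.exists_mem_of_ne_nil l hl
      obtain ⟨x, rfl⟩ := QuotientGroup.mk_surjective v
      exact (key g x).1 (hg _ hv)
    · obtain ⟨x, rfl⟩ := QuotientGroup.mk_surjective v
      exact (key g x).2 hg
  exact h

theorem of_le {N S : Subgroup G} (hNS : N ≤ S) (hN : S ≤ Subgroup.normalizer N) (n : ℕ)
    (h : ∀ q < n, Van (Rep.res N.subtype A) q) : ∀ q < n, Van (Rep.res S.subtype A) q := by
  have : (N.subgroupOf S).Normal := Subgroup.normal_subgroupOf_of_le_normalizer hN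
  exact hV.of_normal _ (N.subgroupOf S) n fun q hq =>
    hV.of_equiv (Subgroup.subgroupOfEquivOfLe hNS).symm (LinearEquiv.refl k A)
      (fun g => rfl) q (h q hq)

/-- If every finite set of members of a conjugation invariant family of subgroups is normalized by
a member of the family, vanishing passes from the family to the group. -/
theorem of_family (𝒩 : Set (Subgroup G))
    (hconj : ∀ N ∈ 𝒩, ∀ g : G, N.map (MulAut.conj g).toMonoidHom ∈ 𝒩)
    (hbot : ∀ s : Finset (Subgroup G), (∀ M ∈ s, M ∈ 𝒩) →
      ∃ N ∈ 𝒩, ∀ M ∈ s, N ≤ Subgroup.normalizer M) (n : ℕ)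
    (h : ∀ N ∈ 𝒩, ∀ q < n, Van (Rep.res N.subtype A) q) : ∀ q < n, Van A q := by
  classical
  let : MulAction G 𝒩 :=
    { smul g N := ⟨N.1.map (MulAut.conj g).toMonoidHom, hconj N.1 N.2 g⟩
      one_smul N := Subtype.ext (by
        change N.1.map (MulAut.conj (1 : G)).toMonoidHom = N.1
        rw [map_one]
        exact Subgroup.map_id _)
      mul_smul g g' N := Subtype.ext (by
        change N.1.map (MulAut.conj (g * g')).toMonoidHom = (N.1.map _).map _
        rw [map_mul, Subgroup.map_map]
        rfl) }
  have hmem (g x : G) (N : 𝒩) : x ∈ (g • N).1 ↔ g⁻¹ * x * g ∈ N.1 := by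
    change x ∈ N.1.map (MulAut.conj g).toMonoidHom ↔ _
    constructor
    · rintro ⟨y, hy, rfl⟩
      simpa [mul_assoc] using hy
    · exact fun hx => ⟨_, hx, by simp [mul_assoc]⟩
  have hfix (g : G) (N : 𝒩) : g • N = N ↔ g ∈ Subgroup.normalizer N.1 := by
    rw [← inv_mem_iff, Subgroup.mem_normalizer_iff, Subtype.ext_iff, SetLike.ext_iff]
    simp only [hmem, inv_inv]
    exact forall_congr' fun x => iff_comm
  refine hV.of_simplices (V := 𝒩) (R := fun N M => N.1 ≤ Subgroup.normalizer M.1) A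
    (fun g N M hNM x hx => ?_) (fun s => ?_) n fun S l hl hlR hS => ?_
  · rw [← hfix]
    have := (hfix _ M).2 (hNM ((hmem g x N).1 hx))
    have e : x = g * (g⁻¹ * x * g) * g⁻¹ := by group
    rw [e, mul_smul, inv_smul_smul, mul_smul, this]
  · obtain ⟨N, hN, hNs⟩ := hbot (s.image Subtype.val) (by simp +contextual)
    exact ⟨⟨N, hN⟩, fun M hM => hNs M.1 (Finset.mem_image_of_mem _ hM)⟩
  · obtain ⟨N, l, rfl⟩ := List.exists_cons_of_ne_nil hl
    -- The first entry normalizes itself and all later entries, so it lies in the stabilizer; the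
    -- stabilizer fixes the first entry, that is, normalizes it.
    refine hV.of_le A (N := N.1) (fun x hx => ?_) (fun x hx => ?_) n (h N.1 N.2)
    · rw [hS]
      intro M hM
      rw [hfix]
      rcases List.mem_cons.1 hM with rfl | hM
      · exact Subgroup.le_normalizer hx
      · exact List.rel_of_pairwise_cons hlR hM hx
    · exact (hfix x N).1 ((hS x).1 hx N List.mem_cons_self)

end DetectedOnSimplices

end Family

/-! ### Powers of a group and coefficient systems -/

/-- The group `Υ × ⋯ × Υ` with `m + 1` factors. -/
def groupPower (Υ : Type u) [Group Υ] : ℕ → GrpCat.{u}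
  | 0 => GrpCat.of Υ
  | m + 1 => GrpCat.of (groupPower Υ m × Υ)

/-- `Γ` has a nonempty conjugation invariant family of subgroups isomorphic to `H`, such that every
finite subfamily is normalized by a member of the family. -/
def HasNormalizingFamily (Γ H : Type u) [Group Γ] [Group H] : Prop :=
  ∃ 𝒩 : Set (Subgroup Γ), (∀ N ∈ 𝒩, ∀ g : Γ, N.map (MulAut.conj g).toMonoidHom ∈ 𝒩) ∧
    (∀ s : Finset (Subgroup Γ), (∀ M ∈ s, M ∈ 𝒩) →
      ∃ N ∈ 𝒩, ∀ M ∈ s, N ≤ Subgroup.normalizer M) ∧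
    ∀ N ∈ 𝒩, ∃ φ : H →* Γ, Function.Injective φ ∧ φ.range = N

namespace DetectedOnSimplices

variable {Van : ∀ {G : Type u} [Group G], Rep.{u} (ULift.{u} ℤ) G → ℕ → Prop}

theorem groupPower_vanishing {M : CoefficientSystem.{u}} {P : GroupProperty.{u}}
    (hP : P.ClosedUnderProducts)
    (hK : ∀ (G₁ G₂ : Type u) [Group G₁] [Group G₂], P G₁ → P G₂ →
      ∀ n₁ n₂ : ℤ, -1 ≤ n₁ → -1 ≤ n₂ → (∀ k : ℕ, (k : ℤ) ≤ n₁ → Van (M G₁) k) →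
        (∀ k : ℕ, (k : ℤ) ≤ n₂ → Van (M G₂) k) →
        ∀ k : ℕ, (k : ℤ) ≤ n₁ + n₂ + 1 → Van (M (G₁ × G₂)) k)
    {Υ : Type u} [Group Υ] (hΥ : P Υ) (h0 : Van (M Υ) 0) (m : ℕ) :
    P (groupPower Υ m) ∧ ∀ k ≤ m, Van (M (groupPower Υ m)) k := by
  induction m with
  | zero =>
    refine ⟨hΥ, fun k hk => ?_⟩
    obtain rfl : k = 0 := by omega
    exact h0
  | succ m ih =>
    refine ⟨hP _ _ ih.1 hΥ, fun k hk => ?_⟩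
    -- Each further factor, vanishing in degree 0 only, gains one degree: m + 0 + 1 = m + 1.
    refine hK (groupPower Υ m) Υ ih.1 hΥ m 0 (by omega) (by omega)
      (fun k hk => ih.2 k (by omega)) (fun k hk => ?_) k (by omega)
    obtain rfl : k = 0 := by omega
    exact h0

/-- For degree q the family of copies of Υ^(q+1) is used: Künneth gives vanishing up to degree q on
these groups, and inductivity transfers it to their action on MΓ. -/
theorem coefficientSystem_vanishing (hV : DetectedOnSimplices Van) {M : CoefficientSystem.{u}}
    {P : GroupProperty.{u}} (hP : P.ClosedUnderProducts)
    (hK : ∀ (G₁ G₂ : Type u) [Group G₁] [Group G₂], P G₁ → P G₂ →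
      ∀ n₁ n₂ : ℤ, -1 ≤ n₁ → -1 ≤ n₂ → (∀ k : ℕ, (k : ℤ) ≤ n₁ → Van (M G₁) k) →
        (∀ k : ℕ, (k : ℤ) ≤ n₂ → Van (M G₂) k) →
        ∀ k : ℕ, (k : ℤ) ≤ n₁ + n₂ + 1 → Van (M (G₁ × G₂)) k)
    (hI : ∀ (H G : Type u) [Group H] [Group G] (i : H →* G), Function.Injective i → P H →
      ∀ k : ℕ, Van (M H) k → Van (Rep.res i (M G)) k)
    {Γ Υ : Type u} [Group Γ] [Group Υ] (hΥ : P Υ) (h0 : Van (M Υ) 0)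
    (hfam : ∀ m, HasNormalizingFamily Γ (groupPower Υ m)) (q : ℕ) : Van (M Γ) q := by
  obtain ⟨𝒩, hconj, hbot, hφ⟩ := hfam q
  obtain ⟨hPp, hvan⟩ := groupPower_vanishing hP hK hΥ h0 q
  refine hV.of_family (M Γ) 𝒩 hconj hbot (q + 1) (fun N hN k hk => ?_) q (by omega)
  obtain ⟨φ, hinj, rfl⟩ := hφ N hN
  exact hV.of_equiv (MonoidHom.ofInjective hinj) (@LinearEquiv.refl (ULift.{u} ℤ) (M Γ).V _ _ (M Γ).hV2) (fun g => rfl) k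
    (hI _ Γ φ hinj hPp k (hvan k (by omega)))

end DetectedOnSimplices

namespace OperadKind.Adm

variable {K : OperadKind} {I J : Type} [LinearOrder I] [LinearOrder J]

theorem symm {e : I ≃ J} (he : K.Adm e) : K.Adm e.symm := fun h i j hij => by
  by_contra! hlt
  have := he h hlt.le
  rw [e.apply_symm_apply, e.apply_symm_apply] at this
  exact hlt.ne (by rw [le_antisymm hij this])

theorem of_val {I' J' : Type} [LinearOrder I'] [LinearOrder J'] {p : I' → Prop} {q : J' → Prop}
    {e : {i // p i} → {j // q j}} {d : I' → J'} (hd : K.Adm d) (h : ∀ x, (e x).1 = d x.1) :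
    K.Adm e := fun hK x y hxy => by
  change (e x).1 ≤ (e y).1
  rw [h, h]
  exact hd hK hxy

end OperadKind.Adm

namespace Operad

variable {K : OperadKind} {O : Operad.{u} K}

/-! ### Operations that agree up to relabelling -/

section OpRel

variable {I J L : Type} [LinearOrder I] [Finite I] [LinearOrder J] [Finite J] [LinearOrder L]
  [Finite L]

/-- Two operations agree up to the relabelling `E` of the inputs; the colours are required to be
equal, but not definitionally so. -/
inductive OpRel : {I J : Type} → [LinearOrder I] → [Finite I] → [LinearOrder J] → [Finite J] →
    {a : I → O.Color} → {b : J → O.Color} → {c c' : O.Color} →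
    (I ≃ J) → O.Op I a c → O.Op J b c' → Prop
  | mk {I J : Type} [LinearOrder I] [Finite I] [LinearOrder J] [Finite J] {b : J → O.Color}
      {c : O.Color} (E : I ≃ J) (hE : K.Adm E) (θ : O.Op I (fun i => b (E i)) c) :
      OpRel E θ (O.relabel E hE θ)

variable {a : I → O.Color} {b : J → O.Color} {d : L → O.Color} {c c' c'' : O.Color}

namespace OpRel

theorem color {E : I ≃ J} {θ : O.Op I a c} {θ' : O.Op J b c'} (h : OpRel E θ θ') (i : I) :
    b (E i) = a i := by
  cases h; rfl

theorem refl (θ : O.Op I a c) : OpRel (Equiv.refl I) θ θ := by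
  have := OpRel.mk (b := a) (Equiv.refl I) OperadKind.Adm.id θ
  rwa [O.relabel_refl] at this

theorem trans {E : I ≃ J} {E' : J ≃ L} {θ : O.Op I a c} {θ' : O.Op J b c'} {θ'' : O.Op L d c''}
    (h : OpRel E θ θ') (h' : OpRel E' θ' θ'') : OpRel (E.trans E') θ θ'' := by
  cases h' with
  | mk _ hE' θ' =>
    cases h with
    | mk _ hE θ =>
      rw [O.relabel_trans]
      exact OpRel.mk (E.trans E') _ θ

theorem spec {E : I ≃ J} {θ : O.Op I a c} {θ' : O.Op J b c'} (h : OpRel E θ θ') :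
    ∃ (hE : K.Adm E) (ha : a = fun i => b (E i)) (hc : c = c'),
      O.relabel E hE (hc ▸ ha ▸ θ) = θ' := by
  cases h with
  | mk _ hE θ => exact ⟨hE, rfl, rfl, rfl⟩

theorem eq {E : I ≃ J} {θ : O.Op I a c} {θ' θ'' : O.Op J b c'} (h : OpRel E θ θ')
    (h' : OpRel E θ θ'') : θ' = θ'' := by
  obtain ⟨_, _, _, rfl⟩ := h.spec
  obtain ⟨_, _, _, rfl⟩ := h'.spec
  rfl

theorem relabel_eq {E : I ≃ J} {hE : K.Adm E} {θ : O.Op I (fun i => b (E i)) c} {θ' : O.Op J b c}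
    (h : OpRel E θ θ') : O.relabel E hE θ = θ' :=
  (OpRel.mk E hE θ).eq h

theorem symm_of_eq_refl {F : I ≃ I} (hF : F = Equiv.refl I) (h : K.Adm F)
    (θ : O.Op I (fun i => a (F i)) c) : OpRel F.symm (O.relabel F h θ) θ := by
  subst hF
  rw [show O.relabel (Equiv.refl I) h θ = θ from O.relabel_refl θ]
  exact refl θ

/-- Relabelling there and back is relabelling by an equivalence that is the identity only
propositionally; `symm_of_eq_refl` absorbs the change of colour types. -/
theorem symm {E : I ≃ J} {θ : O.Op I a c} {θ' : O.Op J b c'} (h : OpRel E θ θ') :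
    OpRel E.symm θ' θ := by
  cases h with
  | mk _ hE θ =>
  generalize hE' : E.symm = e
  obtain rfl : E = e.symm := by rw [← hE']; rfl
  obtain ⟨a', rfl⟩ : ∃ a' : I → O.Color, b = fun j => a' (e j) :=
    ⟨fun i => b (e.symm i), funext fun j => by simp⟩
  have h1 := OpRel.mk e hE.symm (O.relabel (a := fun j => a' (e j)) e.symm hE θ)
  rw [O.relabel_trans] at h1
  have h2 := h1.trans (symm_of_eq_refl (F := e.symm.trans e) (by simp) (hE.symm.comp hE) θ)
  have : e.trans (e.symm.trans e).symm = e := by ext; simp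
  rwa [this] at h2

theorem exists_left {E : I ≃ J} (hE : K.Adm E) (θ' : O.Op J b c') (ha : ∀ i, b (E i) = a i)
    (hc : c = c') : ∃ θ : O.Op I a c, OpRel E θ θ' := by
  subst hc
  generalize hE' : E.symm = E'
  obtain rfl : E = E'.symm := by rw [← hE']; rfl
  obtain rfl : b = fun j => a (E' j) := funext fun j => by rw [← ha]; simp
  exact ⟨_, (OpRel.mk E' hE.symm θ').symm⟩

theorem exists_right {E : I ≃ J} (hE : K.Adm E) (θ : O.Op I a c) (ha : ∀ i, b (E i) = a i)
    (hc : c = c') : ∃ θ' : O.Op J b c', OpRel E θ θ' := by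
  subst hc
  obtain rfl : a = fun i => b (E i) := funext fun i => (ha i).symm
  exact ⟨_, OpRel.mk E hE θ⟩

end OpRel

end OpRel

end Operad

namespace Operad

variable {K : OperadKind} {O : Operad.{u} K}

/-- Equivariance in the inner and outer variables at once: both composites reduce, by the two
relabelling axioms, to a composition along one map. -/
theorem OpRel.comp {I I' J J' : Type} [LinearOrder I] [Finite I] [LinearOrder I'] [Finite I']
    [LinearOrder J] [Finite J] [LinearOrder J'] [Finite J'] {a : I → O.Color} {a' : I' → O.Color}
    {b : J → O.Color} {b' : J' → O.Color} {c c' : O.Color} {f : I → J} {hf : K.Adm f}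
    {f' : I' → J'} {hf' : K.Adm f'} {EI : I ≃ I'} (hEI : K.Adm EI) {EJ : J ≃ J'}
    {θ : (j : J) → O.Op (Fib f j) (fun i => a i.1) (b j)}
    {θ' : (j : J') → O.Op (Fib f' j) (fun i => a' i.1) (b' j)} {φ : O.Op J b c} {φ' : O.Op J' b' c'}
    (hφ : OpRel EJ φ φ') (hcomm : ∀ i, f' (EI i) = EJ (f i))
    (hθ : ∀ j, ∃ E : Fib f j ≃ Fib f' (EJ j), (∀ x, (E x).1 = EI x.1) ∧
      OpRel E (θ j) (θ' (EJ j))) :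
    OpRel EI (O.comp f hf θ φ) (O.comp f' hf' θ' φ') := by
  cases hφ with
  | mk _ hEJ φ =>
  obtain ⟨g, rfl⟩ : ∃ g : I' → J, f = fun i => g (EI i) := ⟨fun i => f (EI.symm i), by simp⟩
  obtain rfl : f' = fun i => EJ (g i) := by
    funext i
    obtain ⟨i, rfl⟩ := EI.surjective i
    exact hcomm i
  obtain rfl : a = fun i => a' (EI i) := by
    funext i
    obtain ⟨E, hE, h⟩ := hθ (g (EI i))
    have := h.color ⟨i, rfl⟩
    rw [hE] at this
    exact this.symm
  have hg : K.Adm g := by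
    have := hf.comp hEI.symm
    simpa using this
  have key : (fun j => O.relabel (a := fun i => a' i.1) (fibCod g EJ j) (.fibCod g EJ j)
      (θ' (EJ j))) = fun j => O.relabel (a := fun i => a' i.1) (fibDom EI g j) (hEI.fibDom g j)
      (θ j) := by
    funext j
    obtain ⟨E, hE, h⟩ := hθ j
    have h1 := h.trans (OpRel.mk (b := fun i => a' i.1) (fibCod g EJ j) (.fibCod g EJ j)
      (θ' (EJ j)))
    have : E.trans (fibCod g EJ j) = fibDom EI g j := by
      ext x
      exact hE x
    rw [this] at h1
    exact h1.eq (OpRel.mk (b := fun i => a' i.1) (fibDom EI g j) (hEI.fibDom g j) (θ j))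
  rw [O.comp_relabel_cod g hg EJ hEJ θ' φ, key, O.comp_relabel_dom EI hEI g hg θ φ]
  exact OpRel.mk EI hEI _

namespace S

/-! ### Corresponding operations of arrows -/

/-- The operation of `f'` at `j'` is the operation of `f` at `j`, after renaming the coordinates of
the source along `d`. -/
def Corr {V Y Z W : O.S} (d : Fin V.len → Fin Z.len) (f' : V ⟶ Y) (j' : Fin Y.len) (f : Z ⟶ W)
    (j : Fin W.len) : Prop :=
  ∃ E : Fib (S.Hom.idx f') j' ≃ Fib (S.Hom.idx f) j, (∀ x, (E x).1 = d x.1) ∧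
    OpRel E (S.Hom.op f' j') (S.Hom.op f j)

namespace Corr

variable {V Y Z W U P : O.S} {d : Fin V.len → Fin Z.len}

theorem idx {f' : V ⟶ Y} {j' : Fin Y.len} {f : Z ⟶ W} {j : Fin W.len} (h : Corr d f' j' f j)
    {x : Fin V.len} (hx : S.Hom.idx f' x = j') : S.Hom.idx f (d x) = j := by
  obtain ⟨E, hE, -⟩ := h
  rw [← hE ⟨x, hx⟩]
  exact (E ⟨x, hx⟩).2

theorem exists_idx {f' : V ⟶ Y} {j' : Fin Y.len} {f : Z ⟶ W} {j : Fin W.len}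
    (h : Corr d f' j' f j) {z : Fin Z.len} (hz : S.Hom.idx f z = j) :
    ∃ x, d x = z ∧ S.Hom.idx f' x = j' := by
  obtain ⟨E, hE, -⟩ := h
  obtain ⟨x, hx⟩ := E.surjective ⟨z, hz⟩
  exact ⟨x.1, by rw [← hE, hx], x.2⟩

theorem refl (f : Z ⟶ W) (j : Fin W.len) : Corr (fun i => i) f j f j :=
  ⟨Equiv.refl _, fun _ => rfl, .refl _⟩

theorem trans {A B : O.S} {e : Fin Z.len → Fin A.len} {f' : V ⟶ Y} {j' : Fin Y.len} {f : Z ⟶ W}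
    {j : Fin W.len} {g : A ⟶ B} {l : Fin B.len} (h : Corr d f' j' f j) (h' : Corr e f j g l) :
    Corr (fun i => e (d i)) f' j' g l := by
  obtain ⟨E, hE, h⟩ := h
  obtain ⟨E', hE', h'⟩ := h'
  exact ⟨E.trans E', fun x => by simp [hE, hE'], h.trans h'⟩

theorem symm {f' : Z ⟶ Y} {j' : Fin Y.len} {f : Z ⟶ W} {j : Fin W.len}
    (h : Corr (fun i => i) f' j' f j) : Corr (fun i => i) f j f' j' := by
  obtain ⟨E, hE, h⟩ := h
  exact ⟨E.symm, fun x => by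
    have := hE (E.symm x)
    rw [E.apply_symm_apply] at this
    exact this.symm, h.symm⟩

/-- Both operations are determined by a third one. -/
theorem cancel {V' Y' : O.S} {d' : Fin V'.len → Fin Z.len} {e : Fin V.len → Fin V'.len}
    (hd' : Function.Injective d') (hde : ∀ i, d' (e i) = d i)
    {f₁ : V ⟶ Y} {j₁ : Fin Y.len} {f₂ : V' ⟶ Y'} {j₂ : Fin Y'.len} {f : Z ⟶ W} {j : Fin W.len}
    (h₁ : Corr d f₁ j₁ f j) (h₂ : Corr d' f₂ j₂ f j) : Corr e f₁ j₁ f₂ j₂ := by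
  obtain ⟨E, hE, h⟩ := h₁
  obtain ⟨E', hE', h'⟩ := h₂
  refine ⟨E.trans E'.symm, fun x => hd' ?_, h.trans h'.symm⟩
  rw [hde, ← hE, ← hE', Equiv.trans_apply, E'.apply_symm_apply]

/-- Composition is local: an operation of a composite depends only on the outer operation and on the
inner operations plugged into it. This allows arrows to be compared one output at a time. -/
theorem comp (hd : K.Adm d) {e : Fin Y.len → Fin W.len} {f' : V ⟶ Y} {g' : Y ⟶ P} {f : Z ⟶ W}
    {g : W ⟶ U} {l' : Fin P.len} {l : Fin U.len} (hg : Corr e g' l' g l)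
    (hf : ∀ j', S.Hom.idx g' j' = l' → Corr d f' j' f (e j')) :
    Corr d (f' ≫ g') l' (f ≫ g) l := by
  obtain ⟨EJ, hEJ, hop⟩ := hg
  let F : Fib (S.Hom.idx (f' ≫ g')) l' → Fib (S.Hom.idx (f ≫ g)) l := fun x =>
    ⟨d x.1, by
      have h1 := (hf _ x.2).idx rfl
      change S.Hom.idx g (S.Hom.idx f (d x.1)) = l
      rw [h1, ← hEJ ⟨_, x.2⟩]
      exact (EJ ⟨_, x.2⟩).2⟩
  have hF : Function.Bijective F := by
    constructor
    · intro x y hxy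
      have hxy' : d x.1 = d y.1 := congrArg Subtype.val hxy
      have hx := (hf _ x.2).idx rfl
      have hy := (hf _ y.2).idx rfl
      have hidx : S.Hom.idx f' x.1 = S.Hom.idx f' y.1 := by
        have : EJ ⟨_, x.2⟩ = EJ ⟨_, y.2⟩ := Subtype.ext (by rw [hEJ, hEJ, ← hx, ← hy, hxy'])
        exact congrArg Subtype.val (EJ.injective this)
      obtain ⟨E, hE, -⟩ := hf _ y.2
      have : E ⟨x.1, hidx⟩ = E ⟨y.1, rfl⟩ := Subtype.ext (by rw [hE, hE]; exact hxy')
      exact Subtype.ext (congrArg (fun t => t.1) (E.injective this))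
    · intro z
      obtain ⟨j', hj'⟩ := EJ.surjective ⟨S.Hom.idx f z.1, z.2⟩
      have hj : e j'.1 = S.Hom.idx f z.1 := by rw [← hEJ, hj']
      obtain ⟨x, hx, hx'⟩ := (hf _ j'.2).exists_idx hj.symm
      exact ⟨⟨x, by
        change S.Hom.idx g' (S.Hom.idx f' x) = l'
        rw [hx']; exact j'.2⟩, Subtype.ext hx⟩
  refine ⟨Equiv.ofBijective F hF, fun _ => rfl, ?_⟩
  refine OpRel.comp (.of_val hd fun _ => rfl) hop (fun x => Subtype.ext ?_) fun j' => ?_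
  · rw [hEJ]
    exact (hf _ x.2).idx rfl
  · obtain ⟨E, hE, h⟩ := hf j'.1 j'.2
    have h1 := (OpRel.mk (b := fun i => V.color i.1.1)
      (fibFib (S.Hom.idx f') (S.Hom.idx g') l' j') (.fibFib _ _ _ _) (S.Hom.op f' j'.1)).symm
    have hval : e j'.1 = (EJ j').1 := (hEJ j').symm
    -- The two names of the output are only propositionally equal, so it is generalized before
    -- substituting.
    have h2 : ∀ (w : Fin W.len) (hw : e j'.1 = w) (w' : Fib (S.Hom.idx g) l) (hw' : w = w'.1),
        ∃ E' : Fib (fibMap (S.Hom.idx f') (S.Hom.idx g') l') j' ≃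
          Fib (fibMap (S.Hom.idx f) (S.Hom.idx g) l) w', (∀ x, (E' x).1.1 = d x.1.1) ∧
          OpRel E' (O.relabel (a := fun i => V.color i.1.1)
            (fibFib (S.Hom.idx f') (S.Hom.idx g') l' j') (.fibFib _ _ _ _) (S.Hom.op f' j'.1))
            (O.relabel (a := fun i => Z.color i.1.1)
            (fibFib (S.Hom.idx f) (S.Hom.idx g) l w') (.fibFib _ _ _ _) (S.Hom.op f w'.1)) := by
      rintro w hw w' rfl
      have h : ∃ E : Fib (S.Hom.idx f') j'.1 ≃ Fib (S.Hom.idx f) w'.1, (∀ x, (E x).1 = d x.1) ∧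
          OpRel E (S.Hom.op f' j'.1) (S.Hom.op f w'.1) := by
        rw [← hw]; exact ⟨E, hE, h⟩
      obtain ⟨E, hE, h⟩ := h
      refine ⟨_, fun x => ?_, (h1.trans h).trans (OpRel.mk (b := fun i => Z.color i.1.1)
        (fibFib (S.Hom.idx f) (S.Hom.idx g) l w') (.fibFib _ _ _ _) (S.Hom.op f w'.1))⟩
      exact hE _
    obtain ⟨E', hE', h'⟩ := h2 _ hval _ rfl
    exact ⟨E', fun x => Subtype.ext (hE' x), h'⟩

theorem hom_ext {f g : Z ⟶ W} (h : ∀ j, Corr (fun i => i) f j g j) : f = g := by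
  have hidx : S.Hom.idx f = S.Hom.idx g := funext fun i => ((h _).idx rfl).symm
  refine S.Hom.ext' hidx fun j => ?_
  obtain ⟨E, hE, h⟩ := h j
  obtain rfl : E = Equiv.subtypeEquivRight fun i => by rw [hidx] :=
    Equiv.ext fun x => Subtype.ext (hE x)
  exact h.relabel_eq

end Corr

end S

end Operad

namespace Operad

variable {K : OperadKind} {O : Operad.{u} K}

namespace S

namespace Corr

variable {V Y Z W U P : O.S} {d : Fin V.len → Fin Z.len}

/-- Two operations that correspond to the same one correspond to each other. -/
theorem of_same {f : V ⟶ Y} {j : Fin Y.len} {g : Z ⟶ W} {l : Fin W.len} {h : Z ⟶ U}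
    {k : Fin U.len} (h₁ : Corr d f j g l) (h₂ : Corr d f j h k) :
    Corr (fun i => i) g l h k := by
  obtain ⟨E, hE, hop⟩ := h₁
  obtain ⟨E', hE', hop'⟩ := h₂
  refine ⟨E.symm.trans E', fun x => ?_, hop.symm.trans hop'⟩
  obtain ⟨x, rfl⟩ := E.surjective x
  rw [Equiv.trans_apply, E.symm_apply_apply, hE, hE']

end Corr

theorem Corr.id {V Z : O.S} {d : Fin V.len → Fin Z.len} {y : Fin V.len}
    (h : Z.color (d y) = V.color y) : Corr d (𝟙 V) y (𝟙 Z) (d y) := by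
  have one {c c' : O.Color} (h : c = c') : OpRel (.refl _) (O.one c) (O.one c') := by
    subst h
    exact .refl _
  exact ⟨_, fun x => congrArg d x.2.symm, (OpRel.mk (b := fun i => V.color i.1) (fibId y)
    (.fibId y) (O.one (V.color y))).symm.trans ((one h.symm).trans
      (OpRel.mk (b := fun i => Z.color i.1) (fibId (d y)) (.fibId (d y)) (O.one (Z.color (d y)))))⟩

/-- Transport of an operation along an injective renaming of coordinates. -/
theorem exists_op {V Y Z : O.S} {J : Type} {idx : Fin Z.len → J} {j : J} {c : O.Color} (g : V ⟶ Y)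
    (j' : Fin Y.len) (d : Fin V.len → Fin Z.len) (hd : K.Adm d) (hinj : Function.Injective d)
    (hcol : ∀ x, Z.color (d x) = V.color x) (hout : Y.color j' = c)
    (h : ∀ z, idx z = j ↔ ∃ x, d x = z ∧ S.Hom.idx g x = j') :
    ∃ θ : O.Op (Fib idx j) (fun i => Z.color i.1) c,
      ∃ E : Fib (S.Hom.idx g) j' ≃ Fib idx j, (∀ x, (E x).1 = d x.1) ∧
        OpRel E (S.Hom.op g j') θ := by
  let E : Fib (S.Hom.idx g) j' ≃ Fib idx j := Equiv.ofBijective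
    (fun x => ⟨d x.1, (h _).2 ⟨x.1, rfl, x.2⟩⟩)
    ⟨fun x y hxy => Subtype.ext (hinj (congrArg Subtype.val hxy)), fun z => by
      obtain ⟨x, hx, hx'⟩ := (h z.1).1 z.2
      exact ⟨⟨x, hx'⟩, Subtype.ext hx⟩⟩
  obtain ⟨θ, hθ⟩ := OpRel.exists_right (E := E) (c' := c) (b := fun i => Z.color i.1)
    (.of_val hd fun _ => rfl) (S.Hom.op g j') (fun i => hcol i.1) hout
  exact ⟨θ, E, fun _ => rfl, hθ⟩

/-! ### Gluing arrows along sets of coordinates. -/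

/-- Sets of coordinates along which arrows can be glued. -/
def Admissible {W : O.S} (J : Set (Fin W.len)) : Prop := K = .planar → J.OrdConnected

theorem Admissible.preimage {Z W : O.S} {J : Set (Fin W.len)} (hJ : Admissible J) (u : Z ⟶ W) :
    Admissible (S.Hom.idx u ⁻¹' J) := fun hK =>
  @Set.OrdConnected.preimage_mono _ _ _ _ _ _ (hJ hK) (S.Hom.adm u hK)

theorem Admissible.singleton {W : O.S} (w : Fin W.len) : Admissible {w} := fun _ =>
  Set.ordConnected_singleton

/-- Operations may be taken from r over J and from q elsewhere, because both arrows send the same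
coordinates into J. In the planar case order-connectedness of J keeps the glued index map monotone.
-/
theorem exists_glue {Z W : O.S} (q r : Z ⟶ W) {J : Set (Fin W.len)} (hJ : Admissible J)
    (hqr : ∀ z, S.Hom.idx q z ∈ J ↔ S.Hom.idx r z ∈ J) :
    ∃ f : Z ⟶ W, (∀ j ∈ J, Corr (fun i => i) f j r j) ∧ ∀ j ∉ J, Corr (fun i => i) f j q j := by
  classical
  let idx : Fin Z.len → Fin W.len := fun z =>
    if S.Hom.idx q z ∈ J then S.Hom.idx r z else S.Hom.idx q z
  have hidx : K.Adm idx := fun hK z z' hz => by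
    have hq := S.Hom.adm q hK hz
    have hr := S.Hom.adm r hK hz
    have hc := (hJ hK).out
    by_cases h : S.Hom.idx q z ∈ J <;> by_cases h' : S.Hom.idx q z' ∈ J <;> simp only [idx, h, h',
      if_true, if_false]
    · exact hr
    -- Otherwise the image of z' under q would lie between two points of J, hence in J.
    · by_contra! hlt
      exact h' (hc h ((hqr z).1 h) ⟨hq, hlt.le⟩)
    · by_contra! hlt
      exact h (hc ((hqr z').1 h') h' ⟨hlt.le, hq⟩)
    · exact hq
  have key : ∀ j, ∃ θ : O.Op (Fib idx j) (fun i => Z.color i.1) (W.color j),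
      (j ∈ J → ∃ E : Fib (S.Hom.idx r) j ≃ Fib idx j, (∀ x, (E x).1 = x.1) ∧
        OpRel E (S.Hom.op r j) θ) ∧
      (j ∉ J → ∃ E : Fib (S.Hom.idx q) j ≃ Fib idx j, (∀ x, (E x).1 = x.1) ∧
        OpRel E (S.Hom.op q j) θ) := by
    intro j
    by_cases hj : j ∈ J
    · obtain ⟨θ, hθ⟩ := exists_op (idx := idx) (j := j) r j (fun i => i) .id
        Function.injective_id (fun _ => rfl) rfl fun z => by
          have := hqr z
          simp only [idx, exists_eq_left]
          split_ifs with h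
          · rfl
          · exact ⟨fun e => absurd (e ▸ hj) h, fun e => absurd (this.2 (e ▸ hj)) h⟩
      exact ⟨θ, fun _ => hθ, fun h => absurd hj h⟩
    · obtain ⟨θ, hθ⟩ := exists_op (idx := idx) (j := j) q j (fun i => i) .id
        Function.injective_id (fun _ => rfl) rfl fun z => by
          have := hqr z
          simp only [idx, exists_eq_left]
          split_ifs with h
          · exact ⟨fun e => absurd (e ▸ this.1 h) hj, fun e => absurd (e ▸ h) hj⟩
          · rfl
      exact ⟨θ, fun h => absurd h hj, fun _ => hθ⟩
  choose op hop using key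
  let f : Z ⟶ W := (⟨idx, hidx, op⟩ : S.Hom Z W)
  exact ⟨f, fun j hj => Corr.symm ((hop j).1 hj), fun j hj => Corr.symm ((hop j).2 hj)⟩

/-! ### Shuffles of words -/

/-- The word `Z` is a shuffle of the words `V` and `U`. -/
structure Shuffle (V U Z : O.S) where
  /-- the positions of the letters of `V` and `U` in `Z` -/
  equiv : Fin V.len ⊕ Fin U.len ≃ Fin Z.len
  strictMono_inl : StrictMono fun v => equiv (.inl v)
  strictMono_inr : StrictMono fun v => equiv (.inr v)
  color_inl : ∀ v, Z.color (equiv (.inl v)) = V.color v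
  color_inr : ∀ v, Z.color (equiv (.inr v)) = U.color v

namespace Shuffle

variable {V U Z Y P W : O.S}

/-- The positions of the letters of the first word. -/
def inl (σ : Shuffle V U Z) (v : Fin V.len) : Fin Z.len := σ.equiv (.inl v)

/-- The positions of the letters of the second word. -/
def inr (σ : Shuffle V U Z) (v : Fin U.len) : Fin Z.len := σ.equiv (.inr v)

theorem inl_injective (σ : Shuffle V U Z) : Function.Injective σ.inl := σ.strictMono_inl.injective

theorem inr_injective (σ : Shuffle V U Z) : Function.Injective σ.inr := σ.strictMono_inr.injective

theorem adm_inl (σ : Shuffle V U Z) : K.Adm σ.inl := fun _ => σ.strictMono_inl.monotone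

theorem adm_inr (σ : Shuffle V U Z) : K.Adm σ.inr := fun _ => σ.strictMono_inr.monotone

theorem inl_ne_inr (σ : Shuffle V U Z) (v : Fin V.len) (u : Fin U.len) : σ.inl v ≠ σ.inr u :=
  fun h => Sum.inl_ne_inr (σ.equiv.injective h)

theorem cases (σ : Shuffle V U Z) (z : Fin Z.len) : (∃ v, σ.inl v = z) ∨ ∃ u, σ.inr u = z := by
  obtain ⟨x | x, hx⟩ := σ.equiv.surjective z
  · exact .inl ⟨x, hx⟩
  · exact .inr ⟨x, hx⟩

theorem mem_range_inr {σ : Shuffle V U Z} {z : Fin Z.len} :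
    z ∈ Set.range σ.inr ↔ z ∉ Set.range σ.inl := by
  constructor
  · rintro ⟨u, rfl⟩ ⟨v, hv⟩
    exact σ.inl_ne_inr v u hv
  · intro h
    exact (σ.cases z).resolve_left h

/-- The two words change their roles. -/
def swap (σ : Shuffle V U Z) : Shuffle U V Z where
  equiv := (Equiv.sumComm _ _).trans σ.equiv
  strictMono_inl := σ.strictMono_inr
  strictMono_inr := σ.strictMono_inl
  color_inl := σ.color_inr
  color_inr := σ.color_inl

/-- The map of positions of shuffles induced by maps of the positions of the two words. -/
def map (σ : Shuffle V U Z) (τ : Shuffle Y P W) (f : Fin V.len → Fin Y.len)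
    (g : Fin U.len → Fin P.len) (z : Fin Z.len) : Fin W.len :=
  τ.equiv (Sum.map f g (σ.equiv.symm z))

variable (σ : Shuffle V U Z) (τ : Shuffle Y P W)

theorem map_inl (f : Fin V.len → Fin Y.len) (g : Fin U.len → Fin P.len) (v : Fin V.len) :
    σ.map τ f g (σ.inl v) = τ.inl (f v) := by
  simp [map, inl]

theorem map_inr (f : Fin V.len → Fin Y.len) (g : Fin U.len → Fin P.len) (u : Fin U.len) :
    σ.map τ f g (σ.inr u) = τ.inr (g u) := by
  simp [map, inr]

/-- The arrow `h` is a shuffle of the arrows `f` and `g`. -/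
def IsShuffled (h : Z ⟶ W) (f : V ⟶ Y) (g : U ⟶ P) : Prop :=
  (∀ y, Corr σ.inl f y h (τ.inl y)) ∧ ∀ p, Corr σ.inr g p h (τ.inr p)

theorem exists_isShuffled (f : V ⟶ Y) (g : U ⟶ P)
    (hfg : K.Adm (σ.map τ (S.Hom.idx f) (S.Hom.idx g))) : ∃ h, IsShuffled σ τ h f g := by
  set idx := σ.map τ (S.Hom.idx f) (S.Hom.idx g) with hidx
  have key : ∀ w, ∃ θ : O.Op (Fib idx w) (fun i => Z.color i.1) (W.color w),
      (∀ y, τ.inl y = w → ∃ E : Fib (S.Hom.idx f) y ≃ Fib idx w, (∀ x, (E x).1 = σ.inl x.1) ∧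
        OpRel E (S.Hom.op f y) θ) ∧
      (∀ p, τ.inr p = w → ∃ E : Fib (S.Hom.idx g) p ≃ Fib idx w, (∀ x, (E x).1 = σ.inr x.1) ∧
        OpRel E (S.Hom.op g p) θ) := by
    intro w
    obtain ⟨y, rfl⟩ | ⟨p, rfl⟩ := τ.cases w
    · obtain ⟨θ, hθ⟩ := exists_op (idx := idx) (j := τ.inl y) f y σ.inl σ.adm_inl σ.inl_injective
        σ.color_inl (τ.color_inl y).symm fun z => by
          obtain ⟨v, rfl⟩ | ⟨u, rfl⟩ := σ.cases z
          · simp [hidx, map_inl, τ.inl_injective.eq_iff, σ.inl_injective.eq_iff]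
          · simp [hidx, map_inr, (τ.inl_ne_inr _ _).symm, σ.inl_ne_inr]
      refine ⟨θ, fun y' hy' => ?_, fun p hp => absurd hp.symm (τ.inl_ne_inr _ _)⟩
      obtain rfl := τ.inl_injective hy'
      exact hθ
    · obtain ⟨θ, hθ⟩ := exists_op (idx := idx) (j := τ.inr p) g p σ.inr σ.adm_inr σ.inr_injective
        σ.color_inr (τ.color_inr p).symm fun z => by
          obtain ⟨v, rfl⟩ | ⟨u, rfl⟩ := σ.cases z
          · simp [hidx, map_inl, τ.inl_ne_inr, (σ.inl_ne_inr _ _).symm]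
          · simp [hidx, map_inr, τ.inr_injective.eq_iff, σ.inr_injective.eq_iff]
      refine ⟨θ, fun p hp => absurd hp (τ.inl_ne_inr _ _), fun y' hy' => ?_⟩
      obtain rfl := τ.inr_injective hy'
      exact hθ
  choose op hop using key
  exact ⟨(⟨idx, hfg, op⟩ : S.Hom Z W), fun y => (hop _).1 y rfl, fun p => (hop _).2 p rfl⟩

variable {σ τ}

theorem IsShuffled.unique {h h' : Z ⟶ W} {f : V ⟶ Y} {g : U ⟶ P} (H : IsShuffled σ τ h f g)
    (H' : IsShuffled σ τ h' f g) : h = h' := by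
  refine Corr.hom_ext fun w => ?_
  obtain ⟨y, rfl⟩ | ⟨p, rfl⟩ := τ.cases w
  · exact (H.1 y).of_same (H'.1 y)
  · exact (H.2 p).of_same (H'.2 p)

theorem IsShuffled.comp {A B C : O.S} {ρ : Shuffle A B C} {h : Z ⟶ W} {f : V ⟶ Y} {g : U ⟶ P}
    {h' : W ⟶ C} {f' : Y ⟶ A} {g' : P ⟶ B} (H : IsShuffled σ τ h f g)
    (H' : IsShuffled τ ρ h' f' g') : IsShuffled σ ρ (h ≫ h') (f ≫ f') (g ≫ g') :=
  ⟨fun y => .comp σ.adm_inl (H'.1 y) fun j' _ => H.1 j',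
    fun y => .comp σ.adm_inr (H'.2 y) fun j' _ => H.2 j'⟩

theorem IsShuffled.id : IsShuffled σ σ (𝟙 Z) (𝟙 V) (𝟙 U) :=
  ⟨fun y => .id (σ.color_inl y), fun y => .id (σ.color_inr y)⟩

theorem exists_restrict (σ : Shuffle V U Z) (τ : Shuffle Y P W) (h : Z ⟶ W)
    (H : ∀ z, S.Hom.idx h z ∈ Set.range τ.inl ↔ z ∈ Set.range σ.inl) :
    ∃ f : V ⟶ Y, ∀ y, Corr σ.inl f y h (τ.inl y) := by
  choose idx hidx using fun v => (H (σ.inl v)).2 ⟨v, rfl⟩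
  have hadm : K.Adm idx := fun hK v v' hv => τ.strictMono_inl.le_iff_le.1 <| by
    change τ.inl _ ≤ τ.inl _
    rw [hidx, hidx]
    exact S.Hom.adm h hK (σ.strictMono_inl.monotone hv)
  have key : ∀ y, ∃ θ : O.Op (Fib idx y) (fun i => V.color i.1) (Y.color y),
      ∃ E : Fib idx y ≃ Fib (S.Hom.idx h) (τ.inl y), (∀ x, (E x).1 = σ.inl x.1) ∧
        OpRel E θ (S.Hom.op h (τ.inl y)) := by
    intro y
    let E : Fib idx y ≃ Fib (S.Hom.idx h) (τ.inl y) := Equiv.ofBijective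
      (fun x => ⟨σ.inl x.1, (hidx _).symm.trans (congrArg τ.inl x.2)⟩)
      ⟨fun x x' hx => Subtype.ext (σ.inl_injective (congrArg Subtype.val hx)), fun z => by
        obtain ⟨v, hv⟩ := (H z.1).1 ⟨y, z.2.symm⟩
        refine ⟨⟨v, τ.inl_injective ?_⟩, Subtype.ext hv⟩
        rw [hidx, hv, z.2]⟩
    obtain ⟨θ, hθ⟩ := OpRel.exists_left (E := E) (.of_val σ.adm_inl fun _ => rfl)
      (S.Hom.op h (τ.inl y)) (a := fun i => V.color i.1) (b := fun i => Z.color i.1)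
      (fun i => σ.color_inl i.1) (τ.color_inl y).symm
    exact ⟨θ, E, fun _ => rfl, hθ⟩
  choose op hop using key
  exact ⟨(⟨idx, hadm, op⟩ : S.Hom V Y), hop⟩

/-- An arrow that respects the partition restricts to both parts, and these restrictions shuffle
back to it. -/
theorem exists_isShuffled_of_range (σ : Shuffle V U Z) (τ : Shuffle Y P W) (h : Z ⟶ W)
    (H : ∀ z, S.Hom.idx h z ∈ Set.range τ.inl ↔ z ∈ Set.range σ.inl) :
    ∃ f g, IsShuffled σ τ h f g := by
  obtain ⟨f, hf⟩ := exists_restrict σ τ h H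
  obtain ⟨g, hg⟩ := exists_restrict σ.swap τ.swap h fun z => by
    change _ ∈ Set.range τ.inr ↔ _ ∈ Set.range σ.inr
    rw [mem_range_inr, mem_range_inr, H]
  exact ⟨f, g, hf, hg⟩

end Shuffle

theorem exists_subword (Z : O.S) (s : Set (Fin Z.len)) :
    ∃ (V : O.S) (d : Fin V.len → Fin Z.len), StrictMono d ∧ Set.range d = s ∧
      ∀ v, Z.color (d v) = V.color v := by
  classical
  let V : O.S := List.ofFn fun i => Z.color (s.toFinset.orderEmbOfFin rfl i)
  have hV : V.len = s.toFinset.card := List.length_ofFn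
  refine ⟨V, fun v => s.toFinset.orderEmbOfFin rfl (Fin.cast hV v), fun v w hvw => ?_, ?_,
    fun v => ?_⟩
  · exact (s.toFinset.orderEmbOfFin rfl).strictMono hvw
  · have := Finset.range_orderEmbOfFin s.toFinset rfl
    rw [Set.coe_toFinset] at this
    exact ((finCongr hV).surjective.range_comp _).trans this
  · exact (List.get_ofFn (fun i => Z.color (s.toFinset.orderEmbOfFin rfl i)) v).symm

theorem exists_shuffle (Z : O.S) (s : Set (Fin Z.len)) :
    ∃ (V U : O.S) (σ : Shuffle V U Z), Set.range σ.inl = s := by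
  obtain ⟨V, d, hd, hr, hc⟩ := exists_subword Z s
  obtain ⟨U, d', hd', hr', hc'⟩ := exists_subword Z sᶜ
  refine ⟨V, U, ⟨Equiv.ofBijective (Sum.elim d d') ⟨hd.injective.sumElim hd'.injective ?_, ?_⟩,
    hd, hd', hc, hc'⟩, hr⟩
  · intro a b h
    have h1 : d a ∈ s := hr ▸ ⟨a, rfl⟩
    have h2 : d' b ∈ sᶜ := hr' ▸ ⟨b, rfl⟩
    exact h2 (h ▸ h1)
  · rw [← Set.range_eq_univ, Set.Sum.elim_range, hr, hr', Set.union_compl_self]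

/-! ### Concatenations as shuffles. -/

theorem len_append (V W : O.S) : (V ++ W).len = V.len + W.len := List.length_append

theorem color_append_left {V W : O.S} {i : Fin (V ++ W).len} {j : Fin V.len} (h : (i : ℕ) = j) :
    (V ++ W).color i = V.color j := by
  obtain ⟨i, hi⟩ := i
  obtain rfl : i = j := h
  exact List.getElem_append_left j.2

theorem color_append_right {V W : O.S} {i : Fin (V ++ W).len} {j : Fin W.len}
    (h : (i : ℕ) = V.len + j) : (V ++ W).color i = W.color j := by
  obtain ⟨i, hi⟩ := i
  obtain rfl : i = V.len + j := h
  refine (List.getElem_append_right (Nat.le_add_right _ _)).trans ?_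
  exact getElem_congr_idx (c := (show List O.Color from W)) (Nat.add_sub_cancel_left _ _)

namespace Shuffle

/-- The word `A ++ V ++ B` as a shuffle of `V` and `A ++ B`. -/
noncomputable def word (A V B : O.S) : Shuffle V (A ++ B) (A ++ V ++ B) where
  equiv := Equiv.ofBijective (Sum.elim
    (fun v => ⟨A.len + v, by have := len_append (A ++ V) B; have := len_append A V; omega⟩)
    (fun u => ⟨if (u : ℕ) < A.len then u else u + V.len, by
      have := len_append (A ++ V) B; have := len_append A V; have := len_append A B
      have := u.2; split_ifs <;> omega⟩)) <| by
    have h1 := len_append (A ++ V) B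
    have h2 := len_append A V
    have h3 := len_append A B
    constructor
    · refine Function.Injective.sumElim (fun v v' h => ?_) (fun u u' h => ?_) fun v u h => ?_
      · have : A.len + (v : ℕ) = A.len + v' := Fin.val_eq_of_eq h
        exact Fin.ext (by omega)
      · have : (if (u : ℕ) < A.len then (u : ℕ) else u + V.len) =
          if (u' : ℕ) < A.len then (u' : ℕ) else u' + V.len := Fin.val_eq_of_eq h
        refine Fin.ext ?_
        split_ifs at this <;> omega
      · have : A.len + (v : ℕ) = if (u : ℕ) < A.len then (u : ℕ) else u + V.len :=
          Fin.val_eq_of_eq h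
        have := v.2
        split_ifs at * <;> omega
    · intro z
      have := z.2
      by_cases hz : (z : ℕ) < A.len
      · exact ⟨.inr ⟨z, by omega⟩, Fin.ext (by simp [hz])⟩
      · by_cases hz' : (z : ℕ) < A.len + V.len
        · exact ⟨.inl ⟨z - A.len, by omega⟩, Fin.ext (by simp; omega)⟩
        · refine ⟨.inr ⟨z - V.len, by omega⟩, Fin.ext ?_⟩
          simp only [Sum.elim_inr]
          split_ifs <;> omega
  strictMono_inl v v' h := Nat.add_lt_add_left (Fin.lt_def.1 h) _
  strictMono_inr u u' h := by
    have : (u : ℕ) < u' := h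
    change (if (u : ℕ) < A.len then (u : ℕ) else u + V.len) <
      if (u' : ℕ) < A.len then (u' : ℕ) else u' + V.len
    split_ifs <;> omega
  color_inl v := by
    have := len_append A V
    refine (color_append_left (j := ⟨A.len + v, by omega⟩) rfl).trans ?_
    exact color_append_right rfl
  color_inr u := by
    have h1 := len_append (A ++ V) B
    have h2 := len_append A V
    have h3 := len_append A B
    have hu := u.2
    by_cases h : (u : ℕ) < A.len
    · refine (color_append_left (j := ⟨u, by omega⟩) ?_).trans
        ((color_append_left (W := V) (j := ⟨u, h⟩) rfl).trans
          (color_append_left (V := A) (j := ⟨u, h⟩) rfl).symm)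
      exact if_pos h
    · refine (color_append_right (j := ⟨u - A.len, by omega⟩) ?_).trans
        (color_append_right ?_).symm
      · refine (if_neg h).trans ?_
        change (u : ℕ) + V.len = (A ++ V).len + (u - A.len)
        omega
      · change (u : ℕ) = A.len + (u - A.len)
        omega

variable (A B : O.S)

theorem word_inl_val {V : O.S} (v : Fin V.len) : ((word A V B).inl v : ℕ) = A.len + v := rfl

theorem word_inr_val {V : O.S} (u : Fin (A ++ B).len) :
    ((word A V B).inr u : ℕ) = if (u : ℕ) < A.len then (u : ℕ) else u + V.len := rfl

theorem range_word_inl (V : O.S) : Set.range (word A V B).inl =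
    {i : Fin (A ++ V ++ B).len | A.len ≤ (i : ℕ) ∧ (i : ℕ) < A.len + V.len} := by
  ext i
  constructor
  · rintro ⟨v, rfl⟩
    have := v.2
    simp only [Set.mem_ofPred_eq, word_inl_val]
    omega
  · rintro ⟨h, h'⟩
    exact ⟨⟨i - A.len, by omega⟩, Fin.ext (by simp only [word_inl_val]; omega)⟩

variable {A B}

/-- The maps to `A ++ Y ++ B` that are monotone on the two parts of a shuffle are monotone if they
respect the relative order of the two parts. -/
theorem adm_map_word {V U Z Y : O.S} (σ : Shuffle V U Z) {f : Fin V.len → Fin Y.len}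
    {g : Fin U.len → Fin (A ++ B).len} (hf : K.Adm f) (hg : K.Adm g)
    (h : K = .planar → ∀ v u, σ.inl v ≤ σ.inr u → A.len ≤ (g u : ℕ))
    (h' : K = .planar → ∀ v u, σ.inr u ≤ σ.inl v → (g u : ℕ) < A.len) :
    K.Adm (σ.map (word A Y B) f g) := by
  intro hK z z' hz
  obtain ⟨v, rfl⟩ | ⟨u, rfl⟩ := σ.cases z <;> obtain ⟨v', rfl⟩ | ⟨u', rfl⟩ := σ.cases z' <;>
    simp only [map_inl, map_inr]
  · exact (word A Y B).strictMono_inl.monotone (hf hK (σ.strictMono_inl.le_iff_le.1 hz))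
  · have := h hK _ _ hz
    have := (f v).2
    rw [Fin.le_def, word_inl_val, word_inr_val]
    split_ifs <;> omega
  · have := h' hK _ _ hz
    rw [Fin.le_def, word_inl_val, word_inr_val]
    split_ifs; omega
  · exact (word A Y B).strictMono_inr.monotone (hg hK (σ.strictMono_inr.le_iff_le.1 hz))

end Shuffle

end S

end Operad

/-! ### Roofs, and supports of elements of the fundamental groups. -/

namespace Operad

variable {K : OperadKind} {O : Operad.{u} K}

open FreeGroupoid (homMk)

theorem homMk_comp {T Z W : O.S} (a : T ⟶ Z) (b : Z ⟶ W) : homMk (a ≫ b) = homMk a ≫ homMk b :=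
  Functor.map_comp _ _ _

namespace CalculusOfFractions

variable (hO : O.CalculusOfFractions)

include hO

theorem exists_square {Z Z' W : O.S} (a : Z ⟶ W) (b : Z' ⟶ W) :
    ∃ (T : O.S) (s : T ⟶ Z) (t : T ⟶ Z'), s ≫ a = t ≫ b := by
  have : (⊤ : MorphismProperty O.S).HasRightCalculusOfFractions := hO
  obtain ⟨φ, h⟩ := (MorphismProperty.LeftFraction.mk (W := ⊤) a b trivial).exists_rightFraction
  exact ⟨_, φ.s, φ.f, h⟩

theorem homMk_eq_iff {Z W : O.S} {a b : Z ⟶ W} :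
    homMk a = homMk b ↔ ∃ (T : O.S) (t : T ⟶ Z), t ≫ a = t ≫ b := by
  have : (⊤ : MorphismProperty O.S).HasRightCalculusOfFractions := hO
  rw [MorphismProperty.map_eq_iff_precomp (FreeGroupoid.of O.S) ⊤]
  exact ⟨fun ⟨T, t, _, h⟩ => ⟨T, t, h⟩, fun ⟨T, t, h⟩ => ⟨T, t, trivial, h⟩⟩

theorem exists_roof {Z W : O.S} (x : FreeGroupoid.mk Z ⟶ FreeGroupoid.mk W) :
    ∃ (T : O.S) (a : T ⟶ Z) (b : T ⟶ W), homMk a ≫ x = homMk b := by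
  have : (⊤ : MorphismProperty O.S).HasRightCalculusOfFractions := hO
  obtain ⟨φ, rfl⟩ := Localization.exists_rightFraction (FreeGroupoid.of O.S) ⊤ x
  exact ⟨_, φ.s, φ.f, φ.map_s_comp_map _ _⟩

end CalculusOfFractions

namespace S

/-- The arrows agree at all coordinates outside `J`. -/
def AgreeOff {Z W : O.S} (J : Set (Fin W.len)) (a b : Z ⟶ W) : Prop :=
  ∀ j ∉ J, Corr (fun i => i) a j b j

namespace AgreeOff

variable {T Z W U : O.S} {J : Set (Fin W.len)} {a b c : Z ⟶ W}

theorem refl (J : Set (Fin W.len)) (a : Z ⟶ W) : AgreeOff J a a := fun _ _ => .refl _ _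

theorem symm (h : AgreeOff J a b) : AgreeOff J b a := fun j hj => (h j hj).symm

theorem trans (h : AgreeOff J a b) (h' : AgreeOff J b c) : AgreeOff J a c :=
  fun j hj => (h j hj).trans (h' j hj)

theorem mono {J' : Set (Fin W.len)} (hJ : J ⊆ J') (h : AgreeOff J a b) : AgreeOff J' a b :=
  fun j hj => h j fun hj' => hj (hJ hj')

theorem precomp (t : T ⟶ Z) (h : AgreeOff J a b) : AgreeOff J (t ≫ a) (t ≫ b) :=
  fun j hj => .comp .id (h j hj) fun _ _ => .refl _ _

theorem postcomp {u : W ⟶ U} {I : Set (Fin U.len)} (hJ : J ⊆ S.Hom.idx u ⁻¹' I)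
    (h : AgreeOff J a b) : AgreeOff I (a ≫ u) (b ≫ u) :=
  fun j hj => .comp .id (.refl u j) fun i hi => h i fun hi' => hj (hi ▸ hJ hi')

theorem eq_of_disjoint {J' : Set (Fin W.len)} (hJ : Disjoint J J') (h : AgreeOff J a b)
    (h' : AgreeOff J' a b) : a = b := by
  classical
  refine Corr.hom_ext fun j => ?_
  by_cases hj : j ∈ J
  · exact h' j (Set.disjoint_left.1 hJ hj)
  · exact h j hj

theorem mem_iff (h : AgreeOff J a b) (z : Fin Z.len) : S.Hom.idx a z ∈ J ↔ S.Hom.idx b z ∈ J := by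
  constructor
  · intro hz
    by_contra hz'
    exact hz' ((h.symm _ hz').idx rfl ▸ hz)
  · intro hz
    by_contra hz'
    exact hz' ((h _ hz').idx rfl ▸ hz)

theorem mem_iff_of_disjoint {J' : Set (Fin W.len)} (hJ : Disjoint J J') (h : AgreeOff J a b)
    (z : Fin Z.len) : S.Hom.idx a z ∈ J' ↔ S.Hom.idx b z ∈ J' := by
  constructor <;> intro hz
  · rwa [(h _ (Set.disjoint_right.1 hJ hz)).idx rfl]
  · rwa [(h.symm _ (Set.disjoint_right.1 hJ hz)).idx rfl]

end AgreeOff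

/-- The elements of the fundamental group that are supported on the set `J` of coordinates. -/
def supp (hO : O.CalculusOfFractions) {W : O.S} (J : Set (Fin W.len)) : Subgroup (piOne W) where
  carrier := {x | ∃ (Z : O.S) (a b : Z ⟶ W), AgreeOff J a b ∧ homMk a ≫ x = homMk b}
  one_mem' := ⟨W, 𝟙 W, 𝟙 W, .refl _ _, Category.comp_id _⟩
  mul_mem' := by
    rintro x y ⟨Z, a, b, hab, hx⟩ ⟨Z', c, d, hcd, hy⟩
    obtain ⟨T, s, t, hst⟩ := hO.exists_square b c
    refine ⟨T, s ≫ a, t ≫ d, (hab.precomp s).trans (hst ▸ hcd.precomp t), ?_⟩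
    change homMk (s ≫ a) ≫ x ≫ y = _
    rw [homMk_comp, Category.assoc, reassoc_of% hx, ← Category.assoc, ← homMk_comp,
      hst, homMk_comp, Category.assoc, hy, homMk_comp]
  inv_mem' := by
    rintro x ⟨Z, a, b, hab, hx⟩
    refine ⟨Z, b, a, hab.symm, ?_⟩
    rw [← hx, Category.assoc]
    exact congrArg (homMk a ≫ ·) (mul_inv_cancel x) |>.trans (Category.comp_id _)

variable (hO : O.CalculusOfFractions) {Z W : O.S} {I J : Set (Fin W.len)}

theorem supp_mono (h : I ⊆ J) : supp hO I ≤ supp hO J := fun _ ⟨Z, a, b, hab, hx⟩ =>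
  ⟨Z, a, b, hab.mono h, hx⟩

/-- Over a common refinement both roofs of x become the same pair of arrows. These agree off I and
off J, hence everywhere, so x = 1. -/
theorem disjoint_supp (h : Disjoint I J) : Disjoint (supp hO I) (supp hO J) := by
  rw [Subgroup.disjoint_def]
  rintro x ⟨Z, a, b, hab, hx⟩ ⟨Z', c, d, hcd, hx'⟩
  obtain ⟨T, s, t, hst⟩ := hO.exists_square a c
  have h1 : homMk (s ≫ b) = homMk (t ≫ d) := by
    rw [homMk_comp, homMk_comp, ← hx, ← hx', ← Category.assoc, ← Category.assoc,
      ← homMk_comp, ← homMk_comp, hst]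
  obtain ⟨T', r, hr⟩ := hO.homMk_eq_iff.1 h1
  have h2 : r ≫ s ≫ a = r ≫ s ≫ b := by
    refine AgreeOff.eq_of_disjoint h ((hab.precomp s).precomp r) ?_
    rw [hr, hst]
    exact (hcd.precomp t).precomp r
  have h3 : homMk a = homMk b := hO.homMk_eq_iff.2 ⟨T', r ≫ s, by simpa using h2⟩
  rw [← cancel_epi (homMk a), hx, ← h3]
  exact (Category.comp_id _).symm

theorem supp_empty : supp hO (∅ : Set (Fin W.len)) = ⊥ :=
  disjoint_self.1 (disjoint_supp hO (Set.disjoint_empty ∅))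

/-- Conjugation by an arrow. -/
noncomputable def conj (u : Z ⟶ W) : piOne Z ≃* piOne W := Groupoid.vertexGroupIsomOfMap (homMk u)

theorem conj_apply_eq_iff (u : Z ⟶ W) {x : piOne Z} {y : piOne W} :
    conj u x = y ↔ x ≫ homMk u = homMk u ≫ y := by
  change Groupoid.inv (homMk u) ≫ x ≫ homMk u = y ↔ _
  rw [Groupoid.inv_eq_inv, IsIso.inv_comp_eq]

theorem conj_mem_supp (u : Z ⟶ W) {I : Set (Fin Z.len)} (h : I ⊆ S.Hom.idx u ⁻¹' J) {x : piOne Z}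
    (hx : x ∈ supp hO I) : conj u x ∈ supp hO J := by
  obtain ⟨T, a, b, hab, hx⟩ := hx
  refine ⟨T, a ≫ u, b ≫ u, hab.postcomp h, ?_⟩
  rw [homMk_comp, Category.assoc, ← (conj_apply_eq_iff u).1 rfl, reassoc_of% hx,
    homMk_comp]

/-- A roof of y lifts through u to a pair p, r, but these may differ outside the preimage of J.
Gluing r over the preimage with p elsewhere corrects this without changing the composite with u,
since the composites of p and r agree off J. -/
theorem exists_conj_eq (hJ : Admissible J) (u : Z ⟶ W) {y : piOne W} (hy : y ∈ supp hO J) :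
    ∃ x ∈ supp hO (S.Hom.idx u ⁻¹' J), conj u x = y := by
  obtain ⟨T, c, d, hcd, hy⟩ := hy
  obtain ⟨T₁, p₁, s₁, h₁⟩ := hO.exists_square u c
  obtain ⟨T₂, r, s₂, h₂⟩ := hO.exists_square u (s₁ ≫ d)
  set p := s₂ ≫ p₁
  have hp : p ≫ u = s₂ ≫ s₁ ≫ c := by rw [Category.assoc, h₁]
  have hag : AgreeOff J (p ≫ u) (r ≫ u) := by
    rw [hp, h₂]
    exact (hcd.precomp s₁).precomp s₂
  obtain ⟨r', hr, hr'⟩ := exists_glue p r (hJ.preimage u) hag.mem_iff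
  have hru : r' ≫ u = r ≫ u := by
    refine Corr.hom_ext fun j => ?_
    by_cases hj : j ∈ J
    · exact .comp .id (.refl u j) fun i hi => hr i (by rw [Set.mem_preimage, hi]; exact hj)
    · refine Corr.trans (.comp .id (.refl u j) fun i hi => hr' i ?_) (hag j hj)
      rw [Set.mem_preimage, hi]; exact hj
  have : homMk p ≫ Groupoid.inv (homMk p) ≫ homMk r' = homMk r' := by simp
  refine ⟨Groupoid.inv (homMk p) ≫ homMk r', ⟨T₂, p, r', fun j hj => (hr' j hj).symm, this⟩, ?_⟩
  rw [conj_apply_eq_iff, ← cancel_epi (homMk p), ← Category.assoc, this, ← homMk_comp, hru,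
    ← Category.assoc, ← homMk_comp, h₂, hp, homMk_comp, homMk_comp,
    homMk_comp, homMk_comp, Category.assoc, Category.assoc, hy]

theorem map_conj_supp (hJ : Admissible J) (u : Z ⟶ W) :
    (supp hO (S.Hom.idx u ⁻¹' J)).map (conj u).toMonoidHom = supp hO J := by
  ext y
  constructor
  · rintro ⟨x, hx, rfl⟩
    exact conj_mem_supp hO u subset_rfl hx
  · intro hy
    exact exists_conj_eq hO hJ u hy

include hO in
/-- An element with support in `J` is determined by its action on the coordinates in `J`. -/
theorem comp_eq_of_agreeOff (hJ : Admissible J) {a b c d : Z ⟶ W} (hac : AgreeOff J a c)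
    (hbd : AgreeOff J b d) (hab : AgreeOff Jᶜ a b) (hcd : AgreeOff Jᶜ c d) {x : piOne W}
    (hx : homMk a ≫ x = homMk c) : homMk b ≫ x = homMk d := by
  obtain ⟨T, s, t, hst⟩ := hO.exists_square a b
  have hsb : ∀ z, S.Hom.idx a z ∈ J ↔ S.Hom.idx b z ∈ J :=
    hab.mem_iff_of_disjoint disjoint_compl_left
  -- The glued arrow follows s over J and t elsewhere, so that it carries b to s ≫ a and d to s ≫ c
  -- simultaneously.
  obtain ⟨t', ht, ht'⟩ := exists_glue t s (hJ.preimage b) fun z => by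
    change S.Hom.idx (t ≫ b) z ∈ J ↔ S.Hom.idx b (S.Hom.idx s z) ∈ J
    rw [← hst, ← hsb]
    rfl
  have htb : t' ≫ b = s ≫ a := by
    refine Corr.hom_ext fun j => ?_
    by_cases hj : j ∈ J
    · exact .comp .id (hab.symm j fun h => h hj) fun i hi => ht i (by
        rw [Set.mem_preimage, hi]; exact hj)
    · rw [hst]
      exact .comp .id (.refl b j) fun i hi => ht' i (by rw [Set.mem_preimage, hi]; exact hj)
  have htd : t' ≫ d = s ≫ c := by
    refine Corr.hom_ext fun j => ?_
    by_cases hj : j ∈ J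
    · exact .comp .id (hcd.symm j fun h => h hj) fun i hi => ht i (by
        rw [Set.mem_preimage, hbd.mem_iff, hi]; exact hj)
    · refine Corr.trans ?_ (hac.precomp s j hj)
      rw [← htb]
      exact hbd.symm.precomp t' j hj
  rw [← cancel_epi (homMk t'), ← Category.assoc, ← homMk_comp, ← homMk_comp, htb, htd,
    homMk_comp, homMk_comp, Category.assoc, hx]

/-- Over a common leg a, let x carry a to b (changed on I) and y carry a to c (changed on J). Gluing
b and c gives d with both changes; then y carries b to d and x carries c to d, so both products
carry a to d. -/
theorem commute_of_disjoint (hI : Admissible I) (hJ : Admissible J) (h : Disjoint I J)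
    {x y : piOne W} (hx : x ∈ supp hO I) (hy : y ∈ supp hO J) : x * y = y * x := by
  obtain ⟨Z, a, b, hab, hx⟩ := hx
  obtain ⟨Z', a', c, hac, hy⟩ := hy
  obtain ⟨T, s, t, hst⟩ := hO.exists_square a a'
  replace hab := hab.precomp s
  replace hac := hac.precomp t
  replace hx : homMk (s ≫ a) ≫ x = homMk (s ≫ b) := by
    rw [homMk_comp, Category.assoc, hx, homMk_comp]
  replace hy : homMk (t ≫ a') ≫ y = homMk (t ≫ c) := by
    rw [homMk_comp, Category.assoc, hy, homMk_comp]
  rw [← hst] at hac hy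
  generalize s ≫ a = a at *
  generalize s ≫ b = b at *
  generalize t ≫ c = c at *
  obtain ⟨d, hcd, hbd⟩ := exists_glue b c hJ fun z => by
    rw [← hab.mem_iff_of_disjoint h, hac.mem_iff]
  have hcd' : AgreeOff Jᶜ c d := fun j hj => (hcd j (not_not.1 hj)).symm
  have hbd' : AgreeOff J b d := fun j hj => (hbd j hj).symm
  have hab' : AgreeOff Jᶜ a b := hab.mono h.subset_compl_right
  have hac' : AgreeOff Iᶜ a c := hac.mono h.symm.subset_compl_right
  have hbd'' : AgreeOff Iᶜ b d := hbd'.mono h.symm.subset_compl_right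
  have hcd'' : AgreeOff I c d := by
    intro j hj
    by_cases hj' : j ∈ J
    · exact hcd' j fun h => h hj'
    · exact ((hac.symm j hj').trans (hab j hj)).trans (hbd' j hj')
  have h1 := comp_eq_of_agreeOff hO hJ hac hbd' hab' hcd' hy
  have h2 := comp_eq_of_agreeOff hO hI hab hcd'' hac' hbd'' hx
  change x ≫ y = y ≫ x
  rw [← cancel_epi (homMk a), reassoc_of% hx, reassoc_of% hy, h1, h2]

end S

end Operad

namespace Operad

variable {K : OperadKind} {O : Operad.{u} K}

open FreeGroupoid (homMk)

namespace S

/-! ### The functor that inserts a word between two others -/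

theorem append_assoc (A B C : O.S) : A ++ B ++ C = A ++ (B ++ C) :=
  List.append_assoc _ _ _

theorem exists_insert (A B : O.S) {V W : O.S} (f : V ⟶ W) :
    ∃ h, Shuffle.IsShuffled (.word A V B) (.word A W B) h f (𝟙 (A ++ B)) := by
  refine Shuffle.exists_isShuffled _ _ f _
    (Shuffle.adm_map_word _ (S.Hom.adm f) (S.Hom.adm (𝟙 (A ++ B))) ?_ ?_)
  · intro _ v u h
    change A.len ≤ (u : ℕ)
    rw [Fin.le_def, Shuffle.word_inl_val, Shuffle.word_inr_val] at h
    split_ifs at h <;> omega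
  · intro _ v u h
    change (u : ℕ) < A.len
    rw [Fin.le_def, Shuffle.word_inl_val, Shuffle.word_inr_val] at h
    have := v.2
    split_ifs at h <;> omega

/-- The arrow `1 ⊗ f ⊗ 1 : A ⊗ V ⊗ B ⟶ A ⊗ W ⊗ B`. -/
noncomputable def insertMap (A B : O.S) {V W : O.S} (f : V ⟶ W) : (A ++ V ++ B) ⟶ (A ++ W ++ B) :=
  (exists_insert A B f).choose

theorem insertMap_isShuffled (A B : O.S) {V W : O.S} (f : V ⟶ W) :
    Shuffle.IsShuffled (.word A V B) (.word A W B) (insertMap A B f) f (𝟙 (A ++ B)) :=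
  (exists_insert A B f).choose_spec

/-- The functor `V ↦ A ⊗ V ⊗ B`. -/
noncomputable def insert (A B : O.S) : O.S ⥤ O.S where
  obj V := A ++ V ++ B
  map f := insertMap A B f
  map_id V := (insertMap_isShuffled A B (𝟙 V)).unique .id
  map_comp f g := by
    refine (insertMap_isShuffled A B (f ≫ g)).unique ?_
    have := (insertMap_isShuffled A B f).comp (insertMap_isShuffled A B g)
    rwa [Category.comp_id] at this

/-- The positions `m, …, m + n - 1`. -/
def block (W : O.S) (m n : ℕ) : Set (Fin W.len) := {i | m ≤ (i : ℕ) ∧ (i : ℕ) < m + n}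

theorem admissible_block (W : O.S) (m n : ℕ) : Admissible (block W m n) := fun _ =>
  ⟨fun _ hx _ hy _ hz => ⟨hx.1.trans hz.1, lt_of_le_of_lt (Fin.le_def.1 hz.2) hy.2⟩⟩

theorem disjoint_block {W : O.S} {m n m' n' : ℕ} (h : m + n ≤ m') :
    Disjoint (block W m n) (block W m' n') :=
  Set.disjoint_left.2 fun _ hx hy => absurd (hx.2.trans_le (h.trans hy.1)) (lt_irrefl _)

theorem block_subset {W : O.S} {m n m' n' : ℕ} (h : m' ≤ m) (h' : m + n ≤ m' + n') :
    block W m n ⊆ block W m' n' := fun _ hx => ⟨h.trans hx.1, hx.2.trans_le h'⟩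

theorem block_subset_preimage_insertMap (A B : O.S) {V W : O.S} (f : V ⟶ W) :
    block (A ++ V ++ B) A.len V.len ⊆
      S.Hom.idx (insertMap A B f) ⁻¹' block (A ++ W ++ B) A.len W.len := by
  intro i hi
  obtain ⟨v, rfl⟩ : i ∈ Set.range (Shuffle.word A V B).inl := by
    rw [Shuffle.range_word_inl]
    exact hi
  rw [Set.mem_preimage, ((insertMap_isShuffled A B f).1 _).idx rfl]
  exact (Shuffle.range_word_inl A B W).subset ⟨_, rfl⟩

variable (hO : O.CalculusOfFractions)

/-- The homomorphism `π₁(Y) → π₁(A ⊗ Y ⊗ B)`. -/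
noncomputable def insertHom (A Y B : O.S) : piOne Y →* piOne (A ++ Y ++ B) :=
  (FreeGroupoid.map (insert A B)).mapVertexGroup (FreeGroupoid.mk Y)

theorem insertHom_eq_of_roof (A B : O.S) {Z Y : O.S} {a b : Z ⟶ Y} {x : piOne Y}
    (hx : homMk a ≫ x = homMk b) :
    homMk (insertMap A B a) ≫ insertHom A Y B x = homMk (insertMap A B b) := by
  have := congrArg (FreeGroupoid.map (insert A B)).map hx
  rwa [Functor.map_comp] at this

include hO in
-- An arrow equalizing the two inserted legs restricts, on the coordinates that reach the middle
-- block, to an arrow equalizing the original legs.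
theorem insertHom_injective (A Y B : O.S) : Function.Injective (insertHom A Y B) := by
  rw [injective_iff_map_eq_one]
  intro x hx
  obtain ⟨Z, a, b, hab⟩ := hO.exists_roof x
  have h := insertHom_eq_of_roof A B hab
  rw [hx] at h
  obtain ⟨T, t, ht⟩ := hO.homMk_eq_iff.1 ((Category.comp_id _).symm.trans h)
  obtain ⟨V, U, σ, hσ⟩ := exists_shuffle T
    (S.Hom.idx t ⁻¹' Set.range (Shuffle.word A Z B).inl)
  obtain ⟨s, hs⟩ := Shuffle.exists_restrict σ (.word A Z B) t fun z => by rw [hσ]; rfl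
  have h1 : ∀ y, Corr σ.inl (s ≫ a) y (t ≫ insertMap A B a) ((Shuffle.word A Y B).inl y) :=
    fun y => .comp σ.adm_inl ((insertMap_isShuffled A B a).1 y) fun j _ => hs j
  have h2 : ∀ y, Corr σ.inl (s ≫ b) y (t ≫ insertMap A B b) ((Shuffle.word A Y B).inl y) :=
    fun y => .comp σ.adm_inl ((insertMap_isShuffled A B b).1 y) fun j _ => hs j
  have h3 : s ≫ a = s ≫ b := by
    refine Corr.hom_ext fun y => ?_
    have h1 := h1 y
    rw [ht] at h1
    exact h1.cancel σ.inl_injective (fun _ => rfl) (h2 y)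
  rw [← cancel_epi (homMk a), hab, ← hO.homMk_eq_iff.2 ⟨_, s, h3⟩]
  exact (Category.comp_id _).symm

/-- Conversely to the evident inclusion, the legs a and b of a roof supported on the block are
shuffles of f and f' with the same g. Both factor through one arrow c, the shuffle of the identity
and g, so the element comes from the roof f, f'. -/
theorem range_insertHom (A Y B : O.S) :
    (insertHom A Y B).range = supp hO (block (A ++ Y ++ B) A.len Y.len) := by
  ext x
  constructor
  · rintro ⟨x, rfl⟩
    obtain ⟨Z, a, b, hab⟩ := hO.exists_roof x
    refine ⟨_, _, _, fun j hj => ?_, insertHom_eq_of_roof A B hab⟩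
    obtain ⟨y, rfl⟩ | ⟨p, rfl⟩ := (Shuffle.word A Y B).cases j
    · exact absurd ((Shuffle.range_word_inl A B Y).subset ⟨_, rfl⟩) hj
    · exact ((insertMap_isShuffled A B a).2 p).of_same ((insertMap_isShuffled A B b).2 p)
  · rintro ⟨Z, a, b, hab, hx⟩
    have hr : Set.range (Shuffle.word A Y B).inl = block _ A.len Y.len :=
      Shuffle.range_word_inl A B Y
    obtain ⟨V, U, σ, hσ⟩ := exists_shuffle Z
      (S.Hom.idx a ⁻¹' Set.range (Shuffle.word A Y B).inl)
    obtain ⟨f, g, hfg⟩ := Shuffle.exists_isShuffled_of_range σ (.word A Y B) a fun z => by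
      rw [hσ]; rfl
    obtain ⟨f', hf'⟩ := Shuffle.exists_restrict σ (.word A Y B) b fun z => by
      rw [hσ, hr, Set.mem_preimage, hab.mem_iff]
    have hfg' : Shuffle.IsShuffled σ (.word A Y B) b f' g := by
      refine ⟨hf', fun p => ?_⟩
      refine (hfg.2 p).trans (hab _ fun h => ?_)
      rw [← hr] at h
      exact Shuffle.mem_range_inr.1 ⟨p, rfl⟩ h
    obtain ⟨c, hc⟩ : ∃ c, Shuffle.IsShuffled σ (.word A V B) c (𝟙 V) g := by
      refine Shuffle.exists_isShuffled _ _ _ _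
        (Shuffle.adm_map_word σ (S.Hom.adm (𝟙 V)) (S.Hom.adm g) ?_ ?_)
      · intro hK v u h
        have := S.Hom.adm a hK h
        rw [(hfg.1 _).idx rfl, (hfg.2 _).idx rfl, Fin.le_def, Shuffle.word_inl_val,
          Shuffle.word_inr_val] at this
        split_ifs at this <;> omega
      · intro hK v u h
        have := S.Hom.adm a hK h
        rw [(hfg.1 _).idx rfl, (hfg.2 _).idx rfl, Fin.le_def, Shuffle.word_inl_val,
          Shuffle.word_inr_val] at this
        have := (S.Hom.idx f v).2
        split_ifs at * <;> omega
    have ha : c ≫ insertMap A B f = a := by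
      have := hc.comp (insertMap_isShuffled A B f)
      rw [Category.id_comp, Category.comp_id] at this
      exact this.unique hfg
    have hb : c ≫ insertMap A B f' = b := by
      have := hc.comp (insertMap_isShuffled A B f')
      rw [Category.id_comp, Category.comp_id] at this
      exact this.unique hfg'
    have hroof : homMk f ≫ Groupoid.inv (homMk f) ≫ homMk f' = homMk f' := by simp
    refine ⟨Groupoid.inv (homMk f) ≫ homMk f', ?_⟩
    rw [← cancel_epi (homMk a), hx, ← ha, ← hb, homMk_comp, homMk_comp, Category.assoc]
    congr 1
    exact insertHom_eq_of_roof A B hroof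

theorem _root_.Subgroup.le_normalizer_of_commute {G : Type*} [Group G] {H L : Subgroup G}
    (h : ∀ x ∈ H, ∀ y ∈ L, x * y = y * x) : H ≤ Subgroup.normalizer (L : Set G) := by
  intro x hx
  rw [Subgroup.mem_normalizer_iff]
  intro y
  constructor
  · intro hy
    rwa [h x hx y hy, mul_inv_cancel_right]
  · intro hy
    have h1 := h _ (inv_mem hx) _ hy
    have h2 : y = x⁻¹ * (x * y * x⁻¹) * x := by group
    rwa [h2, h1, inv_mul_cancel_right]

/-! ### Products of copies of the fundamental group of a split object -/

/-- The word enters through an equation, so that rebracketing a concatenation needs no casts. -/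
theorem exists_insertHom (W A Y B : O.S) (hW : W = A ++ Y ++ B) :
    ∃ β : piOne Y →* piOne W, Function.Injective β ∧
      β.range = supp hO (block W A.len Y.len) := by
  subst hW
  exact ⟨_, insertHom_injective hO A Y B, range_insertHom hO A Y B⟩

/-- A single coordinate lies in J, giving containment, or outside, giving commutation. This
dichotomy fails for larger sets and is the reason for the link condition. -/
theorem supp_singleton_le_normalizer {W : O.S} {J : Set (Fin W.len)} (hJ : Admissible J)
    (w : Fin W.len) : supp hO {w} ≤ Subgroup.normalizer (supp hO J : Set (piOne W)) := by
  classical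
  by_cases hw : w ∈ J
  · exact (supp_mono hO (Set.singleton_subset_iff.2 hw)).trans Subgroup.le_normalizer
  · exact Subgroup.le_normalizer_of_commute fun x hx y hy =>
      commute_of_disjoint hO (.singleton w) hJ (Set.disjoint_singleton_left.2 hw) hx hy

/-- Splitting the block produces two disjoint blocks Y. One carries a copy of Υ, the other a power
of Υ by induction, possibly after a further refinement u. Having disjoint supports, they generate
their direct product; the word is quantified because the induction is applied to the split one. -/
theorem exists_power_embedding {Y : O.S} (hY : IsSplit Y) (n : ℕ) : ∀ W A B : O.S,
    W = A ++ Y ++ B → ∃ (W' : O.S) (u : W' ⟶ W) (φ : groupPower (piOne Y) n →* piOne W'),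
      Function.Injective φ ∧ φ.range ≤ supp hO (S.Hom.idx u ⁻¹' block W A.len Y.len) ∧
      ∀ w, supp hO {w} ≤ Subgroup.normalizer (φ.range : Set (piOne W')) := by
  induction n with
  | zero =>
    intro W A B hW
    obtain ⟨β, hβ, hr⟩ := exists_insertHom hO W A Y B hW
    refine ⟨W, 𝟙 W, β, hβ, hr.le, fun w => ?_⟩
    have := supp_singleton_le_normalizer hO (admissible_block W A.len Y.len) w
    rwa [← hr] at this
  | succ n ih =>
    rintro W A B rfl
    obtain ⟨A₁, A₂, A₃, ⟨s⟩⟩ := hY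
    set W₁ := A ++ (A₁ ++ Y ++ A₂ ++ Y ++ A₃) ++ B with hW₁
    have e₁ : W₁ = (A ++ A₁) ++ Y ++ (A₂ ++ Y ++ A₃ ++ B) := by
      simp only [hW₁, append_assoc]
    have e₂ : W₁ = (A ++ A₁ ++ Y ++ A₂) ++ Y ++ (A₃ ++ B) := by
      simp only [hW₁, append_assoc]
    obtain ⟨β, hβ, hr⟩ := exists_insertHom hO W₁ _ Y _ e₁
    obtain ⟨W', u, φ, hφ, hφr, hφn⟩ := ih W₁ _ _ e₂
    let β' : piOne Y →* piOne W' := (conj u).symm.toMonoidHom.comp β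
    have hβ' : Function.Injective β' := (conj u).symm.injective.comp hβ
    -- The pulled back copy of Υ is still the full group supported on an admissible set, hence still
    -- normalized by single coordinates.
    have hr' : β'.range = supp hO (S.Hom.idx u ⁻¹' block W₁ (A ++ A₁).len Y.len) := by
      rw [MonoidHom.range_comp, hr, ← map_conj_supp hO (admissible_block _ _ _) u,
        Subgroup.map_map]
      convert Subgroup.map_id _
      ext x
      exact (conj u).symm_apply_apply x
    have hlen := len_append A A₁
    have hlen₁ := len_append (A ++ A₁) Y
    have hlen₂ := len_append (A ++ A₁ ++ Y) A₂
    have hlen₃ := len_append (A₁ ++ Y ++ A₂ ++ Y) A₃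
    have hlen₄ := len_append (A₁ ++ Y ++ A₂) Y
    have hlen₅ := len_append (A₁ ++ Y) A₂
    have hlen₆ := len_append A₁ Y
    have hdisj : Disjoint (S.Hom.idx u ⁻¹' block W₁ (A ++ A₁ ++ Y ++ A₂).len Y.len)
        (S.Hom.idx u ⁻¹' block W₁ (A ++ A₁).len Y.len) :=
      (disjoint_block (by omega)).symm.preimage _
    have hcomm : ∀ m n, Commute (φ m) (β' n) := fun m n =>
      commute_of_disjoint hO ((admissible_block _ _ _).preimage u)
        ((admissible_block _ _ _).preimage u) hdisj (hφr ⟨m, rfl⟩) (hr'.le ⟨n, rfl⟩)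
    have hrange : (φ.noncommCoprod β' hcomm).range = φ.range ⊔ β'.range :=
      MonoidHom.noncommCoprod_range _ _ _
    have hblock : ∀ {m : ℕ}, A.len ≤ m → m + Y.len ≤ A.len + (A₁ ++ Y ++ A₂ ++ Y ++ A₃).len →
        S.Hom.idx u ⁻¹' block W₁ m Y.len ⊆
          S.Hom.idx (u ≫ insertMap A B s) ⁻¹' block (A ++ Y ++ B) A.len Y.len := fun h h' _ hi =>
      block_subset_preimage_insertMap A B s (block_subset h h' hi)
    have hinj : Function.Injective (φ.noncommCoprod β' hcomm) := by
      rw [MonoidHom.noncommCoprod_injective]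
      refine ⟨hφ, hβ', ?_⟩
      rw [hr']
      exact (disjoint_supp hO hdisj).mono_left hφr
    refine ⟨W', u ≫ insertMap A B s, φ.noncommCoprod β' hcomm, hinj, hrange.le.trans
      (sup_le (hφr.trans (supp_mono hO (hblock ?_ ?_)))
        (hr'.le.trans (supp_mono hO (hblock ?_ ?_)))), fun w => ?_⟩
    any_goals omega
    have := (le_inf (hφn w) (hr' ▸ supp_singleton_le_normalizer hO
      ((admissible_block _ _ _).preimage u) w)).trans
      (Subgroup.normalizer_inf_normalizer_le_normalizer_sup _ _)
    rwa [← hrange] at this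

/-! ### The normalizing family of a progressive object -/

theorem map_supp_singleton_le {Z W : O.S} (u : Z ⟶ W) (z : Fin Z.len) :
    (supp hO {z}).map (conj u).toMonoidHom ≤ supp hO {S.Hom.idx u z} := by
  rintro _ ⟨x, hx, rfl⟩
  exact conj_mem_supp hO u (by rintro _ rfl; exact rfl) hx

theorem vertexGroupIsomOfMap_comp {C : Type*} [Groupoid C] {a b c : C} (f : a ⟶ b) (g : b ⟶ c)
    (x : a ⟶ a) : Groupoid.vertexGroupIsomOfMap (f ≫ g) x =
      Groupoid.vertexGroupIsomOfMap g (Groupoid.vertexGroupIsomOfMap f x) := by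
  simp [Groupoid.inv_eq_inv]

theorem conj_comp {T Z W : O.S} (t : T ⟶ Z) (u : Z ⟶ W) (x : piOne T) :
    conj (t ≫ u) x = conj u (conj t x) := by
  unfold conj
  rw [homMk_comp]
  exact vertexGroupIsomOfMap_comp _ _ _

/-- The subgroups that are the members of the normalizing family. -/
def normalizingFamily (X : O.S) (H : Type u) [Group H] : Set (Subgroup (piOne X)) :=
  {N | ∃ (W : O.S) (g : FreeGroupoid.mk W ⟶ FreeGroupoid.mk X) (φ : H →* piOne W),
    Function.Injective φ ∧ (∀ w, supp hO {w} ≤ Subgroup.normalizer (φ.range : Set (piOne W))) ∧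
      φ.range.map (Groupoid.vertexGroupIsomOfMap g).toMonoidHom = N}

variable {X : O.S} {H : Type u} [Group H]

/-- An arrow sends a single coordinate to a single coordinate, so the property survives refinement.
A roof connects the refinement found so far with the word W of the next member. -/
theorem exists_normalized (s : Finset (Subgroup (piOne X)))
    (hs : ∀ M ∈ s, M ∈ normalizingFamily hO X H) :
    ∃ (Z : O.S) (p : Z ⟶ X), ∀ M ∈ s, ∀ z,
      (supp hO {z}).map (conj p).toMonoidHom ≤ Subgroup.normalizer (M : Set (piOne X)) := by
  classical
  induction s using Finset.induction_on with
  | empty => exact ⟨X, 𝟙 X, by simp⟩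
  | insert M s hM ih =>
    obtain ⟨Z, p, hp⟩ := ih fun M hM => hs M (Finset.mem_insert_of_mem hM)
    obtain ⟨W, g, φ, -, hφ, rfl⟩ := hs _ (Finset.mem_insert_self _ _)
    obtain ⟨T, a, b, hab⟩ := hO.exists_roof (homMk p ≫ Groupoid.inv g)
    have hg : homMk (a ≫ p) = homMk b ≫ g := by
      rw [← hab, homMk_comp]; simp
    refine ⟨T, a ≫ p, fun M' hM' t => ?_⟩
    rintro _ ⟨x, hx, rfl⟩
    obtain rfl | hM' := Finset.mem_insert.1 hM'
    · have h1 : conj (a ≫ p) x = Groupoid.vertexGroupIsomOfMap g (conj b x) := by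
        unfold conj
        rw [hg]
        exact vertexGroupIsomOfMap_comp _ _ _
      change conj (a ≫ p) x ∈ _
      rw [h1]
      exact Subgroup.le_normalizer_map _
        ⟨_, hφ _ (map_supp_singleton_le hO b t ⟨x, hx, rfl⟩), rfl⟩
    · change conj (a ≫ p) x ∈ _
      rw [conj_comp]
      exact hp M' hM' _ ⟨_, map_supp_singleton_le hO a t ⟨x, hx, rfl⟩, rfl⟩

include hO in
-- The link condition puts the copy of Υ^(m+1) over the block Y into the elements supported on one
-- coordinate of Z, and these normalize the given members. Conjugation only changes the connecting
-- morphism g of a member.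
theorem hasNormalizingFamily {Y : O.S} (hY : IsSplit Y) (hXY : IsProgressiveOver X Y) (m : ℕ) :
    HasNormalizingFamily (piOne X) (groupPower (piOne Y) m) := by
  refine ⟨normalizingFamily hO X (groupPower (piOne Y) m), ?_, fun s hs => ?_, ?_⟩
  · rintro _ ⟨W, g, φ, hinj, hφ, rfl⟩ γ
    refine ⟨W, g ≫ Groupoid.inv γ, φ, hinj, hφ, ?_⟩
    rw [Subgroup.map_map]
    congr 1
    ext x
    refine (vertexGroupIsomOfMap_comp _ _ _).trans ?_
    change Groupoid.inv (Groupoid.inv γ) ≫ _ ≫ Groupoid.inv γ = (γ ≫ _) ≫ Groupoid.inv γ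
    simp [Groupoid.inv_eq_inv]
  · obtain ⟨Z, p, hp⟩ := exists_normalized hO s hs
    obtain ⟨A, B, x, hx⟩ := hXY Z p
    obtain ⟨W', u, φ, hinj, hr, hφ⟩ := exists_power_embedding hO hY m _ A B rfl
    refine ⟨_, ⟨W', homMk (u ≫ x ≫ p), φ, hinj, hφ, rfl⟩, fun M hM => ?_⟩
    rintro _ ⟨y, hy, rfl⟩
    change conj (u ≫ x ≫ p) y ∈ _
    -- For the empty word Y there is no coordinate to link to, but then the support is empty and the
    -- subgroup trivial.
    obtain h0 | h0 := Nat.eq_zero_or_pos Y.len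
    · have hempty : block (A ++ Y ++ B) A.len Y.len = ∅ :=
        Set.eq_empty_of_forall_notMem fun i hi => by
          have h1 := hi.1
          have h2 := hi.2
          omega
      rw [hempty, Set.preimage_empty, supp_empty, le_bot_iff] at hr
      rw [hr, SetLike.mem_coe, Subgroup.mem_bot] at hy
      rw [hy, map_one]
      exact one_mem _
    · have h1 := len_append (A ++ Y) B
      have h2 := len_append A Y
      rw [← Category.assoc, conj_comp]
      refine hp M hM (S.Hom.idx x ⟨A.len, by omega⟩) ⟨_, conj_mem_supp hO (u ≫ x) ?_ (hr hy), rfl⟩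
      intro i hi
      exact hx _ _ hi.1 hi.2 le_rfl (Nat.lt_add_of_pos_right h0)
  · rintro _ ⟨W, g, φ, hinj, -, rfl⟩
    refine ⟨(Groupoid.vertexGroupIsomOfMap g).toMonoidHom.comp φ,
      (Groupoid.vertexGroupIsomOfMap g).injective.comp hinj, MonoidHom.range_comp _ _⟩

end S

end Operad

/-- The three homological parts (unrestricted; relative to a property `P` of groups; for a
`Y`-progressive object `X`), each followed by its cohomological counterpart. -/
theorem theorem2p3 {K : OperadKind} (O : Operad.{u} K) (hO : O.CalculusOfFractions)
    (M : CoefficientSystem.{u}) :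
    (M.Kunneth → M.Inductive → ∀ X : O.S, Operad.IsSplit X → Operad.IsProgressive X →
      CoefficientSystem.HomologyVanishes (M (Operad.piOne X)) 0 →
      ∀ k : ℕ, CoefficientSystem.HomologyVanishes (M (Operad.piOne X)) k) ∧
    (M.CoKunneth → M.CoInductive → ∀ X : O.S, Operad.IsSplit X → Operad.IsProgressive X →
      CoefficientSystem.CohomologyVanishes (M (Operad.piOne X)) 0 →
      ∀ k : ℕ, CoefficientSystem.CohomologyVanishes (M (Operad.piOne X)) k) ∧
    (∀ P : GroupProperty.{u}, P.ClosedUnderProducts → M.KunnethFor P → M.InductiveFor P →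
      ∀ X : O.S, Operad.IsSplit X → Operad.IsProgressive X → P (Operad.piOne X) →
      CoefficientSystem.HomologyVanishes (M (Operad.piOne X)) 0 →
      ∀ k : ℕ, CoefficientSystem.HomologyVanishes (M (Operad.piOne X)) k) ∧
    (∀ P : GroupProperty.{u}, P.ClosedUnderProducts → M.CoKunnethFor P → M.CoInductiveFor P →
      ∀ X : O.S, Operad.IsSplit X → Operad.IsProgressive X → P (Operad.piOne X) →
      CoefficientSystem.CohomologyVanishes (M (Operad.piOne X)) 0 →
      ∀ k : ℕ, CoefficientSystem.CohomologyVanishes (M (Operad.piOne X)) k) ∧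
    (∀ P : GroupProperty.{u}, P.ClosedUnderProducts → M.KunnethFor P → M.InductiveFor P →
      ∀ X Y : O.S, Operad.IsSplit Y → Operad.IsProgressiveOver X Y → P (Operad.piOne Y) →
      CoefficientSystem.HomologyVanishes (M (Operad.piOne Y)) 0 →
      ∀ k : ℕ, CoefficientSystem.HomologyVanishes (M (Operad.piOne X)) k) ∧
    (∀ P : GroupProperty.{u}, P.ClosedUnderProducts → M.CoKunnethFor P → M.CoInductiveFor P →
      ∀ X Y : O.S, Operad.IsSplit Y → Operad.IsProgressiveOver X Y → P (Operad.piOne Y) →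
      CoefficientSystem.CohomologyVanishes (M (Operad.piOne Y)) 0 →
      ∀ k : ℕ, CoefficientSystem.CohomologyVanishes (M (Operad.piOne X)) k) := by
  have hom : ∀ P : GroupProperty.{u}, P.ClosedUnderProducts → M.KunnethFor P → M.InductiveFor P →
      ∀ X Y : O.S, Operad.IsSplit Y → Operad.IsProgressiveOver X Y → P (Operad.piOne Y) →
      CoefficientSystem.HomologyVanishes (M (Operad.piOne Y)) 0 →
      ∀ k : ℕ, CoefficientSystem.HomologyVanishes (M (Operad.piOne X)) k :=
    fun P hP hK hI X Y hY hXY hPY h0 k =>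
      DetectedOnSimplices.coefficientSystem_vanishing
        (Van := fun A k => CoefficientSystem.HomologyVanishes A k) detectedOnSimplices_groupHomology
        hP hK hI hPY h0 (Operad.S.hasNormalizingFamily hO hY hXY) k
  have cohom : ∀ P : GroupProperty.{u}, P.ClosedUnderProducts → M.CoKunnethFor P →
      M.CoInductiveFor P →
      ∀ X Y : O.S, Operad.IsSplit Y → Operad.IsProgressiveOver X Y → P (Operad.piOne Y) →
      CoefficientSystem.CohomologyVanishes (M (Operad.piOne Y)) 0 →
      ∀ k : ℕ, CoefficientSystem.CohomologyVanishes (M (Operad.piOne X)) k :=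
    fun P hP hK hI X Y hY hXY hPY h0 k =>
      DetectedOnSimplices.coefficientSystem_vanishing
        (Van := fun A k => CoefficientSystem.CohomologyVanishes A k)
        detectedOnSimplices_groupCohomology
        hP hK hI hPY h0 (Operad.S.hasNormalizingFamily hO hY hXY) k
  refine ⟨fun hK hI X hX hX' h0 => ?_, fun hK hI X hX hX' h0 => ?_,
    fun P hP hK hI X hX hX' hPX h0 => hom P hP hK hI X X hX hX' hPX h0,
    fun P hP hK hI X hX hX' hPX h0 => cohom P hP hK hI X X hX hX' hPX h0, hom, cohom⟩
  · exact hom _ (fun _ _ _ _ _ _ => trivial) hK hI X X hX hX' trivial h0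
  · exact cohom _ (fun _ _ _ _ _ _ => trivial) hK hI X X hX hX' trivial h0
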